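/- Let $n,k\ge 0$ and $N=n+k$. Let $\mathcal R$ be the ring of rational functions in $\beta$ that are regular at $\beta=0$ and $\beta=-1$, let $\mathcal R(\mathbb T)$ be the ring of rational functions in $\beta,t_1,\dots,t_N$ that are regular at $\beta=0$ and at $\beta=-1$ (quotients of polynomials whose denominator is a nonzero polynomial in $t$ both at $\beta=0$ and at $\beta=-1$), and let $\mathcal R(\mathbb T,q)=\mathcal R(\mathbb T)[\![q]\!]$. Put $x\ominus y=\frac{x-y}{1+\beta y}$ and $\ominus x=0\ominus x$. *The ring $qh_n^*$.* On $V=\langle v_0,v_1\rangle$ let $\sigma^-v_1=v_0$, $\sigma^-v_0=0$, $\sigma^+v_0=v_1$, $\sigma^+v_1=0$, and set $$L_j(x)=\begin{pmatrix}\sigma_j^+\sigma_j^-+(x\ominus t_j)\,\sigma_j^-\sigma_j^+&(1+\beta\,(x\ominus t_j))\,\sigma_j^+\\ \sigma_j^-&\sigma_j^-\sigma_j^+\end{pmatrix},\qquad L_N(x)\cdots L_1(x)=\begin{pmatrix}A(x)&B(x)\\ C(x)&D(x)\end{pmatrix},$$ where $\sigma_j^\pm$ acts on the $j$-th factor of $V^{\otimes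 N}$. For a partition $\lambda=(\lambda_1\ge\dots\ge\lambda_n)$ in the $n\times k$ box, written $\lambda\subset(k^n)$, put $w(i)=\lambda_{n+1-i}+i$ and let $v_\lambda=v_{b_1}\otimes\cdots\otimes v_{b_N}$ with $b_j=1$ if $j\in\{w(1),\dots,w(n)\}$ and $b_j=0$ otherwise. Let $y_\lambda=(y_1,\dots,y_n)$ be the unique tuple in $\mathcal R(\mathbb T,q)$ with constant terms $y_i|_{q=0}=t_{w(i)}$ that solves the Bethe ansatz equations $$(-1)^n\frac{\prod_{l=1}^n(1+\beta y_l)}{(1+\beta y_i)^n}\prod_{j=1}^N(y_i\ominus t_j)+q=0,\qquad i=1,\dots,n.$$ Let $|y_\lambda\rangle=B(y_n)\cdots B(y_1)\,v_0^{\otimes N}$, let $e(y_\lambda,y_\lambda)$ be the coefficient of $v_0^{\otimes N}$ in $C(y_1)\cdots C(y_n)|y_\lambda\rangle$, and let $Y_\lambda=e(y_\lambda,y_\lambda)^{-1}|y_\lambda\rangle$. Then $qh_n^*$ is the free $\mathcal R(\mathbb T,q)$-module with basis $\{v_\lambda\}_{\lambda\subset(k^n)}$, equipped with the $\mathcal R(\mathbb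 T,q)$-bilinear product $\circledast$ determined by $Y_\lambda\circledast Y_\mu=\delta_{\lambda\mu}Y_\mu$. Its structure constants are defined by $v_\mu\circledast v_\nu=\sum_{\lambda\subset(k^n)}C_{\mu\nu}^{\lambda}(t,q)\,v_\lambda$. The ring $qh_k^*$ is defined in the same way with the roles of $n$ and $k$ exchanged and with the same $t_1,\dots,t_N$. **Corollary (level-rank duality).** The $Y_\lambda$, $\lambda\subset(k^n)$, form a basis of $qh_n^*$ over $\mathcal R(\mathbb T,q)$ (so that $\circledast$ is well defined), and $v_\emptyset$ is the unit of $qh_n^*$. For $f\in\mathcal R(\mathbb T,q)$ let $f(\ominus t',q)$ be obtained by the substitution $t_i\mapsto\ominus t_{N+1-i}$ $(1\le i\le N)$ with $\beta$ and $q$ fixed, and let $\lambda'$ be the conjugate partition of $\lambda$. The additive map with $$f(t,q)\,v_\lambda\longmapsto f(\ominus t',q)\,v_{\lambda'}\qquad(f\in\mathcal R(\mathbb T,q),\ \lambda\subset(k^n))$$ is a ring isomorphism $qh_n^*\to qh_k^*$ that is linear over $\mathcal R[\![q]\!]$, and its inverse is given by the same formula with $n$ and $k$ exchanged. That is, for all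 $\lambda,\mu,\nu\subset(k^n)$, $$C_{\mu\nu}^{\lambda}(t,q)=C_{\mu'\nu'}^{\lambda'}(\ominus t',q),$$ where the left-hand side is a structure constant of $qh_n^*$ and the right-hand side is one of $qh_k^*$ after the substitution. -/

import Mathlib

open scoped Matrix

noncomputable section

namespace GrQH

/-! ### Coefficient rings -/

section Coefficients

/-- Polynomials in `β` that vanish neither at `β = 0` nor at `β = -1`. -/
def regConst : Submonoid (Polynomial ℤ) where
  carrier := {p | p.eval 0 ≠ 0 ∧ p.eval (-1) ≠ 0}
  one_mem' := by simp
  mul_mem' := by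
    rintro a b ⟨ha, ha'⟩ ⟨hb, hb'⟩
    simp only [Set.mem_ofPred_eq, Polynomial.eval_mul]
    exact ⟨mul_ne_zero ha hb, mul_ne_zero ha' hb'⟩

/-- The ring `R` of rational functions in `β` that are regular at `β = 0` and `β = -1`. -/
abbrev R : Type := Localization regConst

/-- Specialisation `β = b` of a polynomial in `β, t₁, …, t_N`. -/
def spec (N : ℕ) (b : ℤ) : MvPolynomial (Fin N) (Polynomial ℤ) →+* MvPolynomial (Fin N) ℤ :=
  MvPolynomial.map (Polynomial.evalRingHom b)

/-- Polynomials in `β, t₁, …, t_N` whose specialisations at `β = 0` and at `β = -1` are nonzero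
polynomials in `t₁, …, t_N`. -/
def reg (N : ℕ) : Submonoid (MvPolynomial (Fin N) (Polynomial ℤ)) where
  carrier := {p | spec N 0 p ≠ 0 ∧ spec N (-1) p ≠ 0}
  one_mem' := by simp
  mul_mem' := by
    rintro a b ⟨ha, ha'⟩ ⟨hb, hb'⟩
    simp only [Set.mem_ofPred_eq, map_mul]
    exact ⟨mul_ne_zero ha hb, mul_ne_zero ha' hb'⟩

/-- The ring `R(T) = R(t₁, …, t_N)` of rational functions in `β, t₁, …, t_N` that are regular
at `β = 0` and at `β = -1`. -/
abbrev RT (N : ℕ) : Type := Localization (reg N)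

/-- The ring `R(T, q) = R(T)⟦q⟧`. -/
abbrev RTq (N : ℕ) : Type := PowerSeries (RT N)

theorem regConst_le (N : ℕ) : regConst ≤ (reg N).comap MvPolynomial.C := by
  rintro p ⟨h0, h1⟩
  have h (b : ℤ) (hb : p.eval b ≠ 0) : spec N b (MvPolynomial.C p) ≠ 0 := by
    simpa [spec] using hb
  exact ⟨h 0 h0, h (-1) h1⟩

/-- The inclusion of `R` into `R(T)`. -/
def constRT (N : ℕ) : R →+* RT N :=
  IsLocalization.map (RT N) MvPolynomial.C (regConst_le N)

/-- The parameter `β` in `R(T)`. -/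
def beta₀ (N : ℕ) : RT N :=
  algebraMap (MvPolynomial (Fin N) (Polynomial ℤ)) (RT N) (MvPolynomial.C Polynomial.X)

/-- The equivariant parameters in `R(T)`; `t₀ j` is the parameter usually called `t_{j+1}`. -/
def t₀ {N : ℕ} (j : Fin N) : RT N :=
  algebraMap (MvPolynomial (Fin N) (Polynomial ℤ)) (RT N) (MvPolynomial.X j)

/-- The subtraction `x ⊖ y = (x - y) / (1 + β y)` of the multiplicative formal group law. It is
only ever applied when `1 + β y` is a unit. -/
def fsub {A : Type*} [CommRing A] (β x y : A) : A := (x - y) * Ring.inverse (1 + β * y)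

theorem isUnit_of_spec {N : ℕ} {p : MvPolynomial (Fin N) (Polynomial ℤ)} (hp : p ∈ reg N) :
    IsUnit (algebraMap _ (RT N) p) :=
  IsLocalization.map_units (RT N) (⟨p, hp⟩ : reg N)

theorem one_add_mem_reg {N : ℕ} (j : Fin N) :
    (1 + MvPolynomial.C Polynomial.X * MvPolynomial.X j :
      MvPolynomial (Fin N) (Polynomial ℤ)) ∈ reg N := by
  have h (b : ℤ) : spec N b (1 + MvPolynomial.C Polynomial.X * MvPolynomial.X j) ≠ 0 := by
    intro h
    have := congrArg (MvPolynomial.eval (fun _ => (0 : ℤ))) h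
    simp [spec] at this
  exact ⟨h 0, h (-1)⟩

theorem isUnit_one_add {N : ℕ} (j : Fin N) : IsUnit (1 + beta₀ N * t₀ j) := by
  have := isUnit_of_spec (one_add_mem_reg j)
  simpa [beta₀, t₀] using this

theorem X_sub_X_mem_reg {N : ℕ} {i j : Fin N} (hij : i ≠ j) :
    (MvPolynomial.X i - MvPolynomial.X j : MvPolynomial (Fin N) (Polynomial ℤ)) ∈ reg N := by
  have h (b : ℤ) : spec N b (MvPolynomial.X i - MvPolynomial.X j) ≠ 0 := by
    intro h
    have := congrArg (MvPolynomial.eval (fun l => if l = i then (1 : ℤ) else 0)) h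
    simp [spec, hij.symm] at this
  exact ⟨h 0, h (-1)⟩

theorem isUnit_t₀_sub {N : ℕ} {i j : Fin N} (hij : i ≠ j) :
    IsUnit (t₀ i - t₀ j : RT N) := by
  have := isUnit_of_spec (X_sub_X_mem_reg hij)
  simpa [t₀] using this

/-- The substitution `t_i ↦ ⊖ t_{N+1-i}` on polynomials. -/
def lrPoly (N : ℕ) : MvPolynomial (Fin N) (Polynomial ℤ) →+* RT N :=
  MvPolynomial.eval₂Hom ((algebraMap (MvPolynomial (Fin N) (Polynomial ℤ)) (RT N)).comp MvPolynomial.C)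
    (fun i => fsub (beta₀ N) 0 (t₀ i.rev))


/-- The product of all `1 + b t_i`. -/
def denProd (N : ℕ) (b : ℤ) : MvPolynomial (Fin N) ℤ :=
  ∏ i, (1 + MvPolynomial.C b * MvPolynomial.X i)

abbrev Lt (N : ℕ) (b : ℤ) : Type := Localization.Away (denProd N b)

theorem denProd_ne_zero (N : ℕ) (b : ℤ) : denProd N b ≠ 0 := by
  refine Finset.prod_ne_zero_iff.2 fun i _ h => ?_
  have := congrArg (MvPolynomial.eval (fun _ => (0 : ℤ))) h
  simp at this

theorem isUnit_Lt {N : ℕ} {b : ℤ} (i : Fin N) :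
    IsUnit (algebraMap (MvPolynomial (Fin N) ℤ) (Lt N b)
      (1 + MvPolynomial.C b * MvPolynomial.X i)) := by
  have h : IsUnit (algebraMap (MvPolynomial (Fin N) ℤ) (Lt N b) (denProd N b)) :=
    IsLocalization.Away.algebraMap_isUnit _
  refine isUnit_of_dvd_unit (map_dvd _ ?_) h
  exact Finset.dvd_prod_of_mem _ (Finset.mem_univ i)

def invLt {N : ℕ} (b : ℤ) (i : Fin N) : Lt N b := ↑(isUnit_Lt (b := b) i).unit⁻¹

theorem mul_invLt {N : ℕ} (b : ℤ) (i : Fin N) :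
    algebraMap (MvPolynomial (Fin N) ℤ) (Lt N b) (1 + MvPolynomial.C b * MvPolynomial.X i) *
      invLt b i = 1 := (isUnit_Lt (b := b) i).mul_val_inv

def substLt (N : ℕ) (b : ℤ) : MvPolynomial (Fin N) ℤ →+* Lt N b :=
  MvPolynomial.eval₂Hom (Int.castRingHom _)
    (fun i => -algebraMap (MvPolynomial (Fin N) ℤ) (Lt N b) (MvPolynomial.X i.rev) * invLt b i.rev)

theorem substLt_one_add {N : ℕ} (b : ℤ) (i : Fin N) :
    substLt N b (1 + MvPolynomial.C b * MvPolynomial.X i) = invLt b i.rev := by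
  have h := mul_invLt b i.rev
  simp only [substLt, map_add, map_mul, map_one, MvPolynomial.coe_eval₂Hom,
    MvPolynomial.eval₂_X, eq_intCast, map_intCast] at h ⊢
  linear_combination -h

theorem substLt_injective (N : ℕ) (b : ℤ) : Function.Injective (substLt N b) := by
  have hu : IsUnit (substLt N b (denProd N b)) := by
    have h : substLt N b (denProd N b) =
        ∏ i, substLt N b (1 + MvPolynomial.C b * MvPolynomial.X i) := map_prod _ _ _
    rw [h]
    refine Finset.prod_induction _ IsUnit (fun _ _ => IsUnit.mul) isUnit_one fun i _ => ?_
    rw [substLt_one_add]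
    exact Units.isUnit _
  let s' : Lt N b →+* Lt N b := IsLocalization.Away.lift (denProd N b) hu
  have hs (p) : s' (algebraMap _ _ p) = substLt N b p := IsLocalization.Away.lift_eq _ hu p
  have hinv (i : Fin N) : s' (invLt b i) =
      algebraMap (MvPolynomial (Fin N) ℤ) (Lt N b) (1 + MvPolynomial.C b * MvPolynomial.X i.rev) := by
    have h1 := congrArg s' (mul_invLt b i)
    rw [map_mul, hs, substLt_one_add, map_one] at h1
    have h2 := mul_invLt b i.rev
    linear_combination (algebraMap (MvPolynomial (Fin N) ℤ) (Lt N b)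
      (1 + MvPolynomial.C b * MvPolynomial.X i.rev)) * h1 - s' (invLt b i) * h2
  have key : (s'.comp (substLt N b)) = algebraMap (MvPolynomial (Fin N) ℤ) (Lt N b) := by
    refine MvPolynomial.ringHom_ext (fun r => by simp) fun i => ?_
    have h2 := mul_invLt b i
    have hX : substLt N b (MvPolynomial.X i) =
      -algebraMap (MvPolynomial (Fin N) ℤ) (Lt N b) (MvPolynomial.X i.rev) * invLt b i.rev := by
      simp [substLt]
    have hX' : substLt N b (MvPolynomial.X i.rev) =
      -algebraMap (MvPolynomial (Fin N) ℤ) (Lt N b) (MvPolynomial.X i) * invLt b i := by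
      simp [substLt]
    rw [RingHom.comp_apply, hX, map_mul, map_neg, hs, hX', hinv, Fin.rev_rev]
    linear_combination (algebraMap (MvPolynomial (Fin N) ℤ) (Lt N b) (MvPolynomial.X i)) * h2
  have hinj : Function.Injective (algebraMap (MvPolynomial (Fin N) ℤ) (Lt N b)) :=
    IsLocalization.injective _ (powers_le_nonZeroDivisors_of_noZeroDivisors (denProd_ne_zero N b))
  intro p p' h
  apply hinj
  rw [← key]
  exact congrArg s' h

abbrev Kt (N : ℕ) : Type := FractionRing (MvPolynomial (Fin N) ℤ)

/-- The inclusion of `ℤ[t][1 / (1 + b t_i)]` into the field of rational functions. -/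
def LtToKt (N : ℕ) (b : ℤ) : Lt N b →+* Kt N :=
  IsLocalization.lift (M := Submonoid.powers (denProd N b))
    (g := algebraMap (MvPolynomial (Fin N) ℤ) (Kt N)) (fun y => by
      refine IsUnit.mk0 _ ?_
      rw [Ne, IsFractionRing.to_map_eq_zero_iff]
      exact nonZeroDivisors.ne_zero
        (powers_le_nonZeroDivisors_of_noZeroDivisors (denProd_ne_zero N b) y.2))

theorem LtToKt_algebraMap {N : ℕ} {b : ℤ} (p : MvPolynomial (Fin N) ℤ) :
    LtToKt N b (algebraMap _ _ p) = algebraMap _ (Kt N) p := IsLocalization.lift_eq _ p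

theorem LtToKt_injective (N : ℕ) (b : ℤ) : Function.Injective (LtToKt N b) := by
  refine (IsLocalization.lift_injective_iff _).2 fun x y => ?_
  rw [(IsLocalization.injective (Lt N b)
    (powers_le_nonZeroDivisors_of_noZeroDivisors (denProd_ne_zero N b))).eq_iff,
    (IsFractionRing.injective (MvPolynomial (Fin N) ℤ) (Kt N)).eq_iff]

/-- Evaluation of elements of `R(T)` at `β = b`, for `b = 0` and `b = -1`. -/
def ev (N : ℕ) (b : ℤ) (hb : b = 0 ∨ b = -1) : RT N →+* Kt N :=
  IsLocalization.lift (M := reg N)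
    (g := (algebraMap (MvPolynomial (Fin N) ℤ) (Kt N)).comp (spec N b)) (fun y => by
      refine IsUnit.mk0 _ ?_
      rw [Ne, RingHom.comp_apply, IsFractionRing.to_map_eq_zero_iff]
      rcases hb with rfl | rfl
      · exact y.2.1
      · exact y.2.2)

theorem ev_algebraMap {N : ℕ} {b : ℤ} (hb : b = 0 ∨ b = -1)
    (p : MvPolynomial (Fin N) (Polynomial ℤ)) :
    ev N b hb (algebraMap _ _ p) = algebraMap _ (Kt N) (spec N b p) := IsLocalization.lift_eq _ p

theorem ev_lrPoly {N : ℕ} {b : ℤ} (hb : b = 0 ∨ b = -1)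
    (p : MvPolynomial (Fin N) (Polynomial ℤ)) :
    ev N b hb (lrPoly N p) = LtToKt N b (substLt N b (spec N b p)) := by
  have key : (ev N b hb).comp (lrPoly N) = (LtToKt N b).comp ((substLt N b).comp (spec N b)) := by
    refine MvPolynomial.ringHom_ext (fun r => ?_) fun i => ?_
    · have h1 : spec N b (MvPolynomial.C r) = MvPolynomial.C (r.eval b) := by simp [spec]
      have h2 : substLt N b (MvPolynomial.C (r.eval b)) = ((r.eval b : ℤ) : Lt N b) := by
        rw [eq_intCast]; exact map_intCast _ _
      have h3 : lrPoly N (MvPolynomial.C r) =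
          algebraMap (MvPolynomial (Fin N) (Polynomial ℤ)) (RT N) (MvPolynomial.C r) := by
        simp only [lrPoly, MvPolynomial.coe_eval₂Hom, MvPolynomial.eval₂_C, RingHom.comp_apply]
      simp only [RingHom.comp_apply, h1, h2, h3, ev_algebraMap, map_intCast]
      simp
    · have h1 := congrArg (LtToKt N b) (mul_invLt b i.rev)
      have h2 := congrArg (ev N b hb) (Ring.mul_inverse_cancel _ (isUnit_one_add i.rev))
      simp only [map_mul, LtToKt_algebraMap, map_one] at h1
      have h3 : ev N b hb (1 + beta₀ N * t₀ i.rev) =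
          algebraMap _ (Kt N) (1 + MvPolynomial.C b * MvPolynomial.X i.rev) := by
        simp [beta₀, t₀, ev_algebraMap, spec]
      rw [map_mul, h3, map_one] at h2
      have h4 : ev N b hb (Ring.inverse (1 + beta₀ N * t₀ i.rev)) =
          LtToKt N b (invLt b i.rev) := by
        linear_combination LtToKt N b (invLt b i.rev) * h2 -
          ev N b hb (Ring.inverse (1 + beta₀ N * t₀ i.rev)) * h1
      have h5 : ev N b hb (t₀ i.rev) =
          algebraMap (MvPolynomial (Fin N) ℤ) (Kt N) (MvPolynomial.X i.rev) := by
        simp [t₀, ev_algebraMap, spec]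
      simp [lrPoly, spec, substLt, fsub, h4, h5, LtToKt_algebraMap]
  exact congrArg (fun f => f p) (congrArg DFunLike.coe key)

theorem isUnit_lrPoly {N : ℕ} (p : reg N) : IsUnit (lrPoly N p) := by
  obtain ⟨⟨a, s⟩, h⟩ := IsLocalization.surj (reg N) (lrPoly N p)
  have ha (b : ℤ) (hb : b = 0 ∨ b = -1) (hp : spec N b p ≠ 0) : spec N b a ≠ 0 := by
    intro h0
    have h1 := congrArg (ev N b hb) h
    simp only [map_mul, ev_algebraMap, h0, map_zero, mul_eq_zero, ev_lrPoly] at h1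
    rcases h1 with h1 | h1
    · rw [map_eq_zero_iff _ (LtToKt_injective N b), map_eq_zero_iff _ (substLt_injective N b)] at h1
      exact hp h1
    · rw [IsFractionRing.to_map_eq_zero_iff] at h1
      rcases hb with rfl | rfl
      · exact s.2.1 h1
      · exact s.2.2 h1
  have hu : IsUnit (algebraMap _ (RT N) a) :=
    isUnit_of_spec ⟨ha 0 (Or.inl rfl) p.2.1, ha (-1) (Or.inr rfl) p.2.2⟩
  rw [← h] at hu
  exact isUnit_of_mul_isUnit_left hu

/-- The substitution `f(t) ↦ f(⊖t')`, `t_i ↦ ⊖ t_{N+1-i}`, on `R(T)`. -/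
def lr₀ (N : ℕ) : RT N →+* RT N :=
  IsLocalization.lift (M := reg N) (g := lrPoly N) isUnit_lrPoly

/-- The substitution `f(t, q) ↦ f(⊖t', q)` on `R(T)⟦q⟧`. -/
def lr (N : ℕ) : RTq N →+* RTq N := PowerSeries.map (lr₀ N)

/-- The inclusion of `R⟦q⟧` into `R(T)⟦q⟧`. -/
def constRTq (N : ℕ) : PowerSeries R →+* RTq N := PowerSeries.map (constRT N)

/-- The parameter `β` in `R(T)⟦q⟧`. -/
def β (N : ℕ) : RTq N := PowerSeries.C (beta₀ N)

/-- The equivariant parameters in `R(T)⟦q⟧`. -/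
def t {N : ℕ} (j : Fin N) : RTq N := PowerSeries.C (t₀ j)

/-- The quantum parameter. -/
def q (N : ℕ) : RTq N := PowerSeries.X

end Coefficients

/-! ### Solutions of the Bethe ansatz equations -/

section BetheRoots

/-- The Bethe ansatz equations
`(-1)^n Π(y) / (1 + β y_i)^n ∏_j (y_i ⊖ t_j) + q = 0`, where `Π(y) = ∏_l (1 + β y_l)`. -/
def IsBetheSolution {A : Type*} [CommRing A] {N n : ℕ} (β q : A) (t : Fin N → A)
    (y : Fin n → A) : Prop :=
  ∀ i, (-1) ^ n * ((∏ l, (1 + β * y l)) * Ring.inverse ((1 + β * y i) ^ n)) *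
    (∏ j : Fin N, fsub β (y i) (t j)) + q = 0

theorem dvd_inverse_sub {A : Type*} [CommRing A] {c a b : A} (ha : IsUnit a) (hb : IsUnit b)
    (h : c ∣ a - b) : c ∣ Ring.inverse a - Ring.inverse b := by
  have h1 : Ring.inverse a - Ring.inverse b = -(Ring.inverse a * Ring.inverse b) * (a - b) := by
    have ha' := Ring.mul_inverse_cancel a ha
    have hb' := Ring.mul_inverse_cancel b hb
    linear_combination (-Ring.inverse a) * hb' + Ring.inverse b * ha'
  rw [h1]
  exact h.mul_left _

theorem dvd_mul_sub_mul' {A : Type*} [CommRing A] {c a b a' b' : A} (h : c ∣ a - b)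
    (h' : c ∣ a' - b') : c ∣ a * a' - b * b' := by
  have : a * a' - b * b' = (a - b) * a' + b * (a' - b') := by ring
  rw [this]
  exact dvd_add (h.mul_right _) (h'.mul_left _)

theorem dvd_prod_sub_prod {A ι : Type*} [CommRing A] {c : A} (s : Finset ι) {f g : ι → A}
    (h : ∀ i ∈ s, c ∣ f i - g i) : c ∣ (∏ i ∈ s, f i) - ∏ i ∈ s, g i := by
  classical
  induction s using Finset.induction_on with
  | empty => simp
  | insert a s ha ih =>
    rw [Finset.prod_insert ha, Finset.prod_insert ha]
    exact dvd_mul_sub_mul' (h a (Finset.mem_insert_self _ _))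
      (ih fun i hi => h i (Finset.mem_insert_of_mem hi))

open PowerSeries (C X constantCoeff)

variable {A : Type*} [CommRing A] {N n : ℕ} {b : A} {τ : Fin N → A}
  {w : Fin n → Fin N} {y z : Fin n → PowerSeries A}

theorem isUnit_one_add_t (hb : ∀ j, IsUnit (1 + b * τ j)) (j : Fin N) :
    IsUnit (1 + C b * C (τ j)) := by
  rw [PowerSeries.isUnit_iff_constantCoeff]
  simpa using hb j

theorem isUnit_one_add_y (hb : ∀ j, IsUnit (1 + b * τ j))
    (hy : ∀ i, constantCoeff (y i) = τ (w i)) (i : Fin n) :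
    IsUnit (1 + C b * y i) := by
  rw [PowerSeries.isUnit_iff_constantCoeff]
  simpa [β, hy] using hb (w i)

/-- The product of the unit factors of the Bethe ansatz equation for `y_i`. -/
def betheDen (b : A) (τ : Fin N → A) (w : Fin n → Fin N) (y : Fin n → PowerSeries A) (i : Fin n) : PowerSeries A :=
  (-1) ^ n * (∏ l, (1 + C b * y l)) *
    ∏ j ∈ Finset.univ.erase (w i), fsub (C b) (y i) (C (τ j))

theorem isUnit_betheDen (hb : ∀ j, IsUnit (1 + b * τ j))
    (hτ : ∀ i j, i ≠ j → IsUnit (τ i - τ j))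
    (hy : ∀ i, constantCoeff (y i) = τ (w i)) (i : Fin n) :
    IsUnit (betheDen b τ w y i) := by
  refine ((IsUnit.pow _ isUnit_one.neg).mul ?_).mul ?_
  · exact Finset.prod_induction _ IsUnit (fun _ _ => IsUnit.mul) isUnit_one
      fun l _ => isUnit_one_add_y hb hy l
  · refine Finset.prod_induction _ IsUnit (fun _ _ => IsUnit.mul) isUnit_one fun j hj => ?_
    refine IsUnit.mul ?_ (isUnit_one_add_t hb j).ringInverse
    rw [PowerSeries.isUnit_iff_constantCoeff]
    simpa [hy] using hτ _ _ (Finset.ne_of_mem_erase hj).symm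

/-- The Bethe ansatz equations in fixed point form. -/
def betheStep (b : A) (τ : Fin N → A) (w : Fin n → Fin N) (y : Fin n → PowerSeries A) (i : Fin n) : PowerSeries A :=
  C (τ (w i)) - X * ((1 + C b * C (τ (w i))) * (1 + C b * y i) ^ n * Ring.inverse (betheDen b τ w y i))

theorem isBetheSolution_iff (hb : ∀ j, IsUnit (1 + b * τ j))
    (hτ : ∀ i j, i ≠ j → IsUnit (τ i - τ j))
    (hy : ∀ i, constantCoeff (y i) = τ (w i)) :
    IsBetheSolution (C b) X (fun j => C (τ j)) y ↔ ∀ i, y i = betheStep b τ w y i := by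
  refine forall_congr' fun i => ?_
  have h1 := Ring.mul_inverse_cancel _ (isUnit_one_add_t hb (w i))
  have h2 := Ring.mul_inverse_cancel _ ((isUnit_one_add_y hb hy i).pow n)
  have h3 := Ring.mul_inverse_cancel _ (isUnit_betheDen hb hτ hy i)
  rw [← Finset.mul_prod_erase Finset.univ (fun j => fsub (C b) (y i) (C (τ j))) (Finset.mem_univ (w i))]
  have h4 : (-1) ^ n * ((∏ l, (1 + C b * y l)) * Ring.inverse ((1 + C b * y i) ^ n)) *
      (fsub (C b) (y i) (C (τ (w i))) *
        ∏ j ∈ Finset.univ.erase (w i), fsub (C b) (y i) (C (τ j))) =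
      (y i - C (τ (w i))) * Ring.inverse (1 + C b * C (τ (w i))) *
        Ring.inverse ((1 + C b * y i) ^ n) * betheDen b τ w y i := by
    rw [betheDen, fsub]; ring
  rw [h4, betheStep]
  generalize betheDen b τ w y i = D at *
  generalize Ring.inverse D = D' at *
  generalize (1 + C b * y i) ^ n = E at *
  generalize Ring.inverse E = E' at *
  generalize 1 + C b * C (τ (w i)) = T at *
  generalize Ring.inverse T = T' at *
  constructor
  · intro h
    linear_combination (T * E * D') * h - (y i - C (τ (w i))) * (h1 * (E * E') * (D * D') + h2 * (D * D') + h3)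
  · intro h
    linear_combination (T' * E' * D) * h - X * (h1 * (E * E') * (D * D') + h2 * (D * D') + h3)

theorem constantCoeff_betheStep (i : Fin n) :
    constantCoeff (betheStep b τ w y i) = τ (w i) := by
  simp [betheStep]

theorem betheStep_congr (hb : ∀ j, IsUnit (1 + b * τ j))
    (hτ : ∀ i j, i ≠ j → IsUnit (τ i - τ j))
    (hy : ∀ i, constantCoeff (y i) = τ (w i))
    (hz : ∀ i, constantCoeff (z i) = τ (w i)) {m : ℕ}
    (h : ∀ i, (X : PowerSeries A) ^ m ∣ y i - z i) (i : Fin n) :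
    (X : PowerSeries A) ^ (m + 1) ∣ betheStep b τ w y i - betheStep b τ w z i := by
  have h1 (l) : (X : PowerSeries A) ^ m ∣ (1 + C b * y l) - (1 + C b * z l) := by
    have : (1 + C b * y l) - (1 + C b * z l) = C b * (y l - z l) := by ring
    rw [this]
    exact (h l).mul_left _
  have h2 : (X : PowerSeries A) ^ m ∣ betheDen b τ w y i - betheDen b τ w z i := by
    refine dvd_mul_sub_mul' (dvd_mul_sub_mul' (by simp) (dvd_prod_sub_prod _ fun l _ => h1 l))
      (dvd_prod_sub_prod _ fun j _ => ?_)
    refine dvd_mul_sub_mul' ?_ (by simp)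
    simpa using h i
  have h3 : (X : PowerSeries A) ^ m ∣ (1 + C b * y i) ^ n - (1 + C b * z i) ^ n :=
    (h1 i).trans (sub_dvd_pow_sub_pow _ _ n)
  have h4 := dvd_mul_sub_mul' h3
    (dvd_inverse_sub (isUnit_betheDen hb hτ hy i) (isUnit_betheDen hb hτ hz i) h2)
  have h5 : betheStep b τ w y i - betheStep b τ w z i = -(1 + C b * C (τ (w i))) * (X *
      ((1 + C b * y i) ^ n * Ring.inverse (betheDen b τ w y i) -
        (1 + C b * z i) ^ n * Ring.inverse (betheDen b τ w z i))) := by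
    rw [betheStep, betheStep]; ring
  rw [h5, pow_succ']
  exact (mul_dvd_mul_left _ h4).mul_left _

/-- For every choice of the constant terms `t_{w(1)}, …, t_{w(n)}` the Bethe ansatz equations have
exactly one solution in formal power series in `q`. -/
theorem existsUnique_bethe (hb : ∀ j, IsUnit (1 + b * τ j))
    (hτ : ∀ i j, i ≠ j → IsUnit (τ i - τ j)) (w : Fin n → Fin N) : ∃! y : Fin n → PowerSeries A,
    (∀ i, constantCoeff (y i) = τ (w i)) ∧ IsBetheSolution (C b) X (fun j => C (τ j)) y := by
  let s : ℕ → Fin n → PowerSeries A := fun m => (betheStep b τ w)^[m] fun i => C (τ (w i))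
  have hs1 (m i) : constantCoeff (s m i) = τ (w i) := by
    cases m with
    | zero => simp [s]
    | succ m => simp only [s, Function.iterate_succ_apply', constantCoeff_betheStep]
  have hsucc (m) : s (m + 1) = betheStep b τ w (s m) := Function.iterate_succ_apply' _ _ _
  have hs2 (m i) : (X : PowerSeries A) ^ (m + 1) ∣ s (m + 1) i - s m i := by
    induction m generalizing i with
    | zero => rw [zero_add, pow_one, PowerSeries.X_dvd_iff, map_sub, hs1, hs1, sub_self]
    | succ m ih =>
      have h := betheStep_congr hb hτ (hs1 (m + 1)) (hs1 m) ih i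
      rwa [← hsucc, ← hsucc] at h
  have hs3 (m d i) : (X : PowerSeries A) ^ (m + 1) ∣ s (m + d) i - s m i := by
    induction d with
    | zero => simp
    | succ d ih =>
      have h := (pow_dvd_pow (X : PowerSeries A)
        (show m + 1 ≤ m + d + 1 by omega)).trans (hs2 (m + d) i)
      have := dvd_add h ih
      rwa [sub_add_sub_cancel] at this
  let y : Fin n → PowerSeries A := fun i => PowerSeries.mk fun m => PowerSeries.coeff m (s m i)
  have hy1 (m i) : (X : PowerSeries A) ^ (m + 1) ∣ y i - s m i := by
    rw [PowerSeries.X_pow_dvd_iff]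
    intro l hl
    obtain ⟨d, rfl⟩ : ∃ d, m = l + d := ⟨m - l, by omega⟩
    have := (PowerSeries.X_pow_dvd_iff.1 (hs3 l d i)) l (by omega)
    rw [map_sub, sub_eq_zero] at this
    simp [y, this]
  have hy2 (i) : constantCoeff (y i) = τ (w i) := by
    have := hy1 0 i
    rw [zero_add, pow_one, PowerSeries.X_dvd_iff, map_sub, sub_eq_zero] at this
    rw [this, hs1]
  have eq_of (a b : PowerSeries A) (h : ∀ m, (X : PowerSeries A) ^ m ∣ a - b) : a = b := by
    rw [← sub_eq_zero]
    ext m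
    simpa using PowerSeries.X_pow_dvd_iff.1 (h (m + 1)) m (by omega)
  refine ⟨y, ⟨hy2, (isBetheSolution_iff hb hτ hy2).2 fun i => eq_of _ _ fun m => ?_⟩, ?_⟩
  · have h1 := (pow_dvd_pow (X : PowerSeries A)
      (show m ≤ m + 1 + 1 by omega)).trans (hy1 (m + 1) i)
    have h2 := (pow_dvd_pow (X : PowerSeries A)
      (show m ≤ m + 1 + 1 by omega)).trans (betheStep_congr hb hτ hy2 (hs1 m) (hy1 m) i)
    rw [hsucc] at h1
    have := dvd_sub h1 h2
    rwa [sub_sub_sub_cancel_right] at this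
  · rintro z ⟨hz, hz'⟩
    have hz'' := (isBetheSolution_iff hb hτ hz).1 hz'
    funext i
    refine eq_of _ _ fun m => ?_
    have hm (m : ℕ) : ∀ i, (X : PowerSeries A) ^ (m + 1) ∣ z i - s m i := by
      induction m with
      | zero =>
        intro i
        rw [zero_add, pow_one, PowerSeries.X_dvd_iff, map_sub, hs1, hz, sub_self]
      | succ m ih =>
        intro i
        rw [hz'' i, hsucc]
        exact betheStep_congr hb hτ hz (hs1 m) ih i
    have := dvd_sub (hm m i) (hy1 m i)
    rw [sub_sub_sub_cancel_right] at this
    exact (pow_dvd_pow _ (Nat.le_succ m)).trans this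

end BetheRoots

/-! ### The Yang-Baxter algebra on `V^{⊗N}`

The basis of `V^{⊗N}` is indexed by the binary strings `Fin N → Fin 2`, and operators are matrices
whose entry at `(c, b)` is the coefficient of `v_c` in the image of `v_b`. -/

section YangBaxter

variable {A : Type*} [CommRing A] {N : ℕ}

/-- `σ⁻ v₁ = v₀`, `σ⁻ v₀ = 0`. -/
def sigmaMinus (A : Type*) [CommRing A] : Matrix (Fin 2) (Fin 2) A := !![0, 1; 0, 0]

/-- `σ⁺ v₀ = v₁`, `σ⁺ v₁ = 0`. -/
def sigmaPlus (A : Type*) [CommRing A] : Matrix (Fin 2) (Fin 2) A := !![0, 0; 1, 0]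

/-- The `L`-operator `L(x|s)`, as a `2 × 2` matrix (in the auxiliary space) of operators on `V`. -/
def Lop (β x s : A) : Matrix (Fin 2) (Fin 2) (Matrix (Fin 2) (Fin 2) A) :=
  !![sigmaPlus A * sigmaMinus A + fsub β x s • (sigmaMinus A * sigmaPlus A),
      (1 + β * fsub β x s) • sigmaPlus A;
    sigmaMinus A, sigmaMinus A * sigmaPlus A]

/-- The operator on `V^{⊗N}` that acts as `m` on the `j`-th tensor factor and as the identity on
all others. -/
def site (j : Fin N) (m : Matrix (Fin 2) (Fin 2) A) :
    Matrix (Fin N → Fin 2) (Fin N → Fin 2) A :=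
  Matrix.of fun c b => if ∀ i, i ≠ j → c i = b i then m (c j) (b j) else 0

/-- The row monodromy matrix `M(x|t) = L_N ⋯ L_2 L_1` with `L_j = L(x|t_j)` acting on the
auxiliary space and on the `j`-th factor of `V^{⊗N}`. -/
def monodromy (β : A) (t : Fin N → A) (x : A) :
    Matrix (Fin 2) (Fin 2) (Matrix (Fin N → Fin 2) (Fin N → Fin 2) A) :=
  ((List.finRange N).reverse.map fun j => (Lop β x (t j)).map (site j)).prod

/-- The operator `B(x|t) = M₀₁(x|t)`. -/
def Bop (β : A) (t : Fin N → A) (x : A) : Matrix (Fin N → Fin 2) (Fin N → Fin 2) A :=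
  monodromy β t x 0 1

/-- The operator `C(x|t) = M₁₀(x|t)`. -/
def Cop (β : A) (t : Fin N → A) (x : A) : Matrix (Fin N → Fin 2) (Fin N → Fin 2) A :=
  monodromy β t x 1 0

/-- The Bethe vector `|y₁, …, y_n⟩ = B(y_n|t) ⋯ B(y₁|t) v₀ ⊗ ⋯ ⊗ v₀`. -/
def betheVector {n : ℕ} (β : A) (t : Fin N → A) (y : Fin n → A) : (Fin N → Fin 2) → A :=
  (List.ofFn fun i => Bop β t (y i)).reverse.prod *ᵥ Pi.single 0 1

/-- The matrix element `e(x, y) = ⟨0| C(x₁) ⋯ C(x_n) B(y_n) ⋯ B(y₁) |0⟩`. -/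
def betheNorm {n : ℕ} (β : A) (t : Fin N → A) (x y : Fin n → A) : A :=
  ((List.ofFn fun i => Cop β t (x i)).prod *ᵥ betheVector β t y) 0

end YangBaxter

/-! ### Boxed partitions -/

/-- Partitions `λ = (λ₁ ≥ ⋯ ≥ λ_n)` with `λ₁ ≤ k`, i.e. `λ ⊂ (k^n)`. -/
abbrev BoxedPartition (n k : ℕ) : Type := {l : Fin n → Fin (k + 1) // Antitone l}

namespace BoxedPartition

variable {N n k : ℕ}

/-- The empty partition. -/
def empty (n k : ℕ) : BoxedPartition n k := ⟨fun _ => 0, fun _ _ _ => le_rfl⟩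

/-- The conjugate partition `λ'`, with `λ'_j = #{i | λ_i ≥ j}` (here `j` starts from `0`). -/
def conj (l : BoxedPartition n k) : BoxedPartition k n :=
  ⟨fun j => ⟨(Finset.univ.filter fun i => (j : ℕ) < (l.1 i : ℕ)).card,
      Nat.lt_succ_of_le ((Finset.card_filter_le _ _).trans (by simp))⟩, fun j j' hjj' => by
    refine Fin.mk_le_mk.2 (Finset.card_le_card fun i hi => ?_)
    simp only [Finset.mem_filter, Finset.mem_univ, true_and] at hi ⊢
    exact lt_of_le_of_lt hjj' hi⟩

/-- The position `w(i) = λ_{n+1-i} + i` of the `i`-th letter `1` in the binary string of `λ`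
(here `i` and the positions start from `0`). -/
def pos (h : n + k = N) (l : BoxedPartition n k) (i : Fin n) : Fin N :=
  ⟨(l.1 i.rev : ℕ) + i, by have := (l.1 i.rev).2; have := i.2; omega⟩

/-- The binary string of `λ`. -/
def word (h : n + k = N) (l : BoxedPartition n k) : Fin N → Fin 2 :=
  fun j => if ∃ i, pos h l i = j then 1 else 0

end BoxedPartition

/-! ### The ring `qh_n^*` -/

section Ring

variable {N n k : ℕ}

/-- The solution `y_λ` of the Bethe ansatz equations with constant terms `t_{w(1)}, …, t_{w(n)}`. -/
def betheRoot (h : n + k = N) (l : BoxedPartition n k) : Fin n → RTq N :=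
  (existsUnique_bethe (b := beta₀ N) (τ := t₀) isUnit_one_add (fun _ _ => isUnit_t₀_sub)
    (l.pos h)).choose

theorem betheRoot_spec (h : n + k = N) (l : BoxedPartition n k) :
    (∀ i, PowerSeries.constantCoeff (betheRoot h l i) = t₀ (l.pos h i)) ∧
      IsBetheSolution (β N) (q N) t (betheRoot h l) :=
  (existsUnique_bethe (b := beta₀ N) (τ := t₀) isUnit_one_add (fun _ _ => isUnit_t₀_sub)
    (l.pos h)).choose_spec.1

theorem betheRoot_unique (h : n + k = N) (l : BoxedPartition n k) (y : Fin n → RTq N)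
    (hy : ∀ i, PowerSeries.constantCoeff (y i) = t₀ (l.pos h i))
    (hy' : IsBetheSolution (β N) (q N) t y) : y = betheRoot h l :=
  (existsUnique_bethe (b := beta₀ N) (τ := t₀) isUnit_one_add (fun _ _ => isUnit_t₀_sub)
    (l.pos h)).choose_spec.2 y ⟨hy, hy'⟩

/-- The free module with basis `v_λ`, `λ ⊂ (k^n)`: the part of `V^{⊗N}` (over `R(T)⟦q⟧`) spanned by
the `v_b` for binary strings `b` with `n` letters `1`, where `v_λ = v_b` for the binary string `b`
of `λ`. It carries the product of `qh_n^*` introduced below. -/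
def QH (_h : n + k = N) : Type := BoxedPartition n k → RTq N

namespace QH

variable (h : n + k = N)

instance : AddCommGroup (QH h) := inferInstanceAs (AddCommGroup (BoxedPartition n k → RTq N))

instance : Module (RTq N) (QH h) := inferInstanceAs (Module (RTq N) (BoxedPartition n k → RTq N))

/-- The basis vector `v_λ`. -/
def v (l : BoxedPartition n k) : QH h := (Pi.single l 1 : BoxedPartition n k → RTq N)

/-- The coefficient of `v_λ` in an element. -/
def coeff (u : QH h) (l : BoxedPartition n k) : RTq N := u l

/-- The normalised Bethe vector `Y_λ = e(y_λ, y_λ)⁻¹ |y_λ⟩`. -/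
def Y (l : BoxedPartition n k) : QH h := fun m =>
  Ring.inverse (betheNorm (β N) t (betheRoot h l) (betheRoot h l)) *
    betheVector (β N) t (betheRoot h l) (m.word h)

/-- The matrix whose column with index `λ` holds the coordinates of `Y_λ`. -/
def transition : Matrix (BoxedPartition n k) (BoxedPartition n k) (RTq N) :=
  Matrix.of fun m l => coeff h (Y h l) m

/-- The bilinear product with `Y_λ ⊛ Y_μ = δ_{λμ} Y_μ`: pass to coordinates with respect to
the `Y_λ`, multiply them componentwise, and pass back to coordinates with respect to the `v_λ`. -/
def mul (u w : QH h) : QH h :=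
  transition h *ᵥ (((transition h)⁻¹ *ᵥ coeff h u) * ((transition h)⁻¹ *ᵥ coeff h w))

theorem transition_cancel (w : BoxedPartition n k → RTq N) (u : QH h) :
    ((transition h)⁻¹ *ᵥ (transition h *ᵥ w)) * ((transition h)⁻¹ *ᵥ coeff h u) =
      w * ((transition h)⁻¹ *ᵥ coeff h u) := by
  by_cases hu : IsUnit (transition h).det
  · rw [Matrix.mulVec_mulVec, Matrix.nonsing_inv_mul _ hu, Matrix.one_mulVec]
  · rw [Matrix.nonsing_inv_apply_not_isUnit _ hu]
    simp

instance : NonUnitalCommRing (QH h) :=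
  { (inferInstance : AddCommGroup (QH h)) with
    mul := mul h
    left_distrib := fun a b c => by
      change mul h a (b + c) = mul h a b + mul h a c
      unfold mul
      change _ *ᵥ (_ * (_ *ᵥ (coeff h b + coeff h c))) = _
      rw [Matrix.mulVec_add, mul_add, Matrix.mulVec_add]
      rfl
    right_distrib := fun a b c => by
      change mul h (a + b) c = mul h a c + mul h b c
      unfold mul
      change _ *ᵥ ((_ *ᵥ (coeff h a + coeff h b)) * _) = _
      rw [Matrix.mulVec_add, add_mul, Matrix.mulVec_add]
      rfl
    zero_mul := fun a => by
      change mul h 0 a = 0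
      unfold mul
      change _ *ᵥ ((_ *ᵥ (0 : BoxedPartition n k → RTq N)) * _) = _
      rw [Matrix.mulVec_zero, zero_mul, Matrix.mulVec_zero]
      rfl
    mul_zero := fun a => by
      change mul h a 0 = 0
      unfold mul
      change _ *ᵥ (_ * (_ *ᵥ (0 : BoxedPartition n k → RTq N))) = _
      rw [Matrix.mulVec_zero, mul_zero, Matrix.mulVec_zero]
      rfl
    mul_comm := fun a b => by
      change mul h a b = mul h b a
      unfold mul
      rw [mul_comm]
    mul_assoc := fun a b c => by
      change mul h (mul h a b) c = mul h a (mul h b c)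
      unfold mul
      change transition h *ᵥ (((transition h)⁻¹ *ᵥ (transition h *ᵥ _)) * _) =
        transition h *ᵥ (_ * ((transition h)⁻¹ *ᵥ (transition h *ᵥ _)))
      rw [transition_cancel, mul_comm (_ *ᵥ coeff h a) (_ *ᵥ (transition h *ᵥ _)),
        transition_cancel]
      congr 1
      ring }

/-- The structure constant `C_{μν}^λ(t, q)`: the coefficient of `v_λ` in `v_μ ⊛ v_ν`. -/
def structureConst (m m' l : BoxedPartition n k) : RTq N := coeff h (v h m * v h m') l

end QH

end Ring

end GrQH

end

/-! The product is diagonal in the `Y_λ`, so in the coordinates attached to that basis the ring is a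
product of copies of R(T)⟦q⟧. These coordinates are pairings with the dual Bethe vectors
⟨0|C(y_1)⋯C(y_n), as soon as the dual vectors are orthogonal to the Bethe vectors with other labels
and the norms e(y_λ, y_λ) are units.

Orthogonality comes from a Chevalley operator on binary strings. Its matrix elements `moveCoeff β q
b c * wordWeight β t c` move letters 1 cyclically one step to the left, with a factor β for each
moved letter and a factor q for crossing the origin. Bethe vectors are right eigenvectors and dual
Bethe vectors left eigenvectors, both with eigenvalue ∏(1 + β y_i). At q = 0 this is ∏(1 + β
t_{w(i)}), which determines the string (`wordWeight_injective`), so different labels have different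
eigenvalues. The norms are units because at q = 0 the two families are triangular in opposite
directions (`isUnit_betheNorm`).

The eigenvector property rests on a determinant formula. The exchange relations of the monodromy
matrix yield the action of A(x) on Bethe vectors, and from it `diffProd_mul_betheVector`: a
coefficient times a Vandermonde product is a determinant of one-particle functions. Multiplying row
i by 1 + β y_i splits each column into a part where the letter stays and a part where it moves.
Blocked moves vanish by column operations, and the Bethe equations turn a move across the origin
into a factor q.

For the duality, reversing and complementing strings preserves moves, and t_i ↦ ⊖t_{N+1-i} inverts
the weights 1 + β t_j up to reversal. The dual of `Y_λ` is therefore an eigenvector of the operator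
for `qh_k^*`, orthogonal to all dual Bethe vectors except the one for λ', hence a multiple of
`Y_λ'`. The factor is 1 because the sum of all `Y_λ` is `v_∅` (`sum_Y`), and `v_∅` is mapped to
`v_∅`. So `dual_Y` needs no comparison of Bethe roots or norms for n and k. -/

noncomputable section

namespace GrQH

/-! ### Matrix elements of the monodromy matrix -/

section Monodromy

variable {A : Type*} [CommRing A] {N : ℕ}

/-- The matrix element of the `L`-operator between `v_b` and `v_c`, a matrix in the auxiliary
space. -/
def lmat (β x s : A) (c b : Fin 2) : Matrix (Fin 2) (Fin 2) A :=
  Matrix.of fun r r' => Lop β x s r r' c b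

theorem lmat_eq (β x s : A) (c b : Fin 2) : lmat β x s c b =
    !![if c = b then (if b = 0 then fsub β x s else 1) else 0,
      if c = 1 ∧ b = 0 then 1 + β * fsub β x s else 0;
      if c = 0 ∧ b = 1 then 1 else 0, if c = 0 ∧ b = 0 then 1 else 0] := by
  ext r r'
  fin_cases r <;> fin_cases r' <;> fin_cases c <;> fin_cases b <;>
    simp [lmat, Lop, sigmaPlus, sigmaMinus]

theorem sum_site_mul (j : Fin N) (m : Matrix (Fin 2) (Fin 2) A)
    (X : Matrix (Fin N → Fin 2) (Fin N → Fin 2) A) (c b : Fin N → Fin 2) :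
    (site j m * X) c b = ∑ e, m (c j) e * X (Function.update c j e) b := by
  classical
  rw [Matrix.mul_apply, ← Finset.sum_subset (Finset.subset_univ
    (Finset.univ.image fun e => Function.update c j e))]
  · rw [Finset.sum_image fun e _ e' _ h => by simpa using congrFun h j]
    refine Finset.sum_congr rfl fun e _ => ?_
    rw [site, Matrix.of_apply, if_pos fun i hi => by simp [hi]]
    simp
  · intro d _ hd
    rw [site, Matrix.of_apply, if_neg, zero_mul]
    intro h
    refine hd (Finset.mem_image.2 ⟨d j, Finset.mem_univ _, ?_⟩)
    funext i
    rcases eq_or_ne i j with rfl | hi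
    · simp
    · simp [hi, h i hi]

/-- Each site occurs at most once, so its input and output letters are fixed and only the auxiliary
index is summed over. -/
theorem prod_site_apply (β : A) (t : Fin N → A) (x : A) (l : List (Fin N)) (hl : l.Nodup)
    (r s : Fin 2) (c b : Fin N → Fin 2) :
    (l.map fun j => (Lop β x (t j)).map (site j)).prod r s c b =
      if ∀ i, i ∉ l → c i = b i then (l.map fun j => lmat β x (t j) (c j) (b j)).prod r s
      else 0 := by
  classical
  induction l generalizing r s c with
  | nil =>
    rw [List.map_nil, List.prod_nil, List.map_nil, List.prod_nil]
    have h : (∀ i, i ∉ ([] : List (Fin N)) → c i = b i) ↔ c = b := by simp [funext_iff]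
    simp only [h, Matrix.one_apply]
    by_cases hrs : r = s <;> simp [hrs, Matrix.one_apply]
  | cons j l ih =>
    rw [List.nodup_cons] at hl
    rw [List.map_cons, List.prod_cons, List.map_cons, List.prod_cons, Matrix.mul_apply,
      Matrix.mul_apply, Matrix.sum_apply]
    have key (a : Fin 2) : ((Lop β x (t j)).map (site j) r a *
        (l.map fun j => (Lop β x (t j)).map (site j)).prod a s) c b =
        if ∀ i, i ∉ j :: l → c i = b i then lmat β x (t j) (c j) (b j) r a *
          (l.map fun j => lmat β x (t j) (c j) (b j)).prod a s else 0 := by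
      rw [Matrix.map_apply, sum_site_mul]
      have h1 (e : Fin 2) : (l.map fun i => lmat β x (t i) (Function.update c j e i) (b i)) =
          l.map fun i => lmat β x (t i) (c i) (b i) := by
        refine List.map_congr_left fun i hi => ?_
        rw [Function.update_of_ne]
        rintro rfl
        exact hl.1 hi
      have h2 (e : Fin 2) : (∀ i, i ∉ l → Function.update c j e i = b i) ↔
          e = b j ∧ ∀ i, i ∉ j :: l → c i = b i := by
        constructor
        · intro h
          refine ⟨by simpa using h j hl.1, fun i hi => ?_⟩
          rw [List.mem_cons, not_or] at hi
          simpa [hi.1] using h i hi.2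
        · rintro ⟨h, h'⟩ i hi
          rcases eq_or_ne i j with rfl | hij
          · simp [h]
          · rw [Function.update_of_ne hij]
            exact h' i (by simp [hij, hi])
      simp only [ih hl.2, h1, h2]
      by_cases h : ∀ i, i ∉ j :: l → c i = b i
      · rw [if_pos h, Finset.sum_eq_single (b j), if_pos ⟨rfl, h⟩]
        · rfl
        · rintro e - he
          rw [if_neg fun h' => he h'.1, mul_zero]
        · simp
      · rw [if_neg h]
        refine Finset.sum_eq_zero fun e _ => ?_
        rw [if_neg fun h' => h h'.2, mul_zero]
    simp only [key]
    split_ifs <;> simp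

theorem monodromy_apply (β : A) (t : Fin N → A) (x : A) (r s : Fin 2) (c b : Fin N → Fin 2) :
    monodromy β t x r s c b =
      ((List.finRange N).reverse.map fun j => lmat β x (t j) (c j) (b j)).prod r s := by
  rw [monodromy, prod_site_apply _ _ _ _ (List.nodup_reverse.2 (List.nodup_finRange N)), if_pos]
  intro i hi
  simp at hi

/-- The operator of site 0 is the rightmost factor of the ordered product. Splitting it off drives
the inductions on N. -/
theorem monodromy_cons (β : A) (t : Fin (N + 1) → A) (x : A) (r s : Fin 2)
    (c₀ b₀ : Fin 2) (c b : Fin N → Fin 2) :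
    monodromy β t x r s (Fin.cons c₀ c) (Fin.cons b₀ b) =
      ∑ a, monodromy β (fun j => t j.succ) x r a c b * lmat β x (t 0) c₀ b₀ a s := by
  simp only [monodromy_apply, List.finRange_succ, List.reverse_cons, List.map_append,
    List.prod_append, ← List.map_reverse, List.map_map, Function.comp_def, Fin.cons_succ,
    List.map_cons, List.map_nil, List.prod_singleton, Fin.cons_zero, Matrix.mul_apply]

/-- The part of a vector in `V^{⊗(N+1)}` whose first tensor factor is `v_a`. -/
def slice {α : Type*} (a : Fin 2) (f : (Fin (N + 1) → Fin 2) → α) : (Fin N → Fin 2) → α :=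
  fun w => f (Fin.cons a w)

theorem slice_ext {α : Type*} {f g : (Fin (N + 1) → Fin 2) → α} (h0 : slice 0 f = slice 0 g)
    (h1 : slice 1 f = slice 1 g) : f = g := by
  funext w
  rw [← Fin.cons_self_tail w]
  generalize w 0 = a
  fin_cases a
  · exact congrFun h0 _
  · exact congrFun h1 _

theorem slice_mulVec (β : A) (t : Fin (N + 1) → A) (x : A) (r s : Fin 2) (c₀ : Fin 2)
    (f : (Fin (N + 1) → Fin 2) → A) :
    slice c₀ (monodromy β t x r s *ᵥ f) =
      ∑ b₀, ∑ a, lmat β x (t 0) c₀ b₀ a s •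
        (monodromy β (fun j => t j.succ) x r a *ᵥ slice b₀ f) := by
  funext c
  simp only [slice, Matrix.mulVec, dotProduct, Finset.sum_apply, Pi.smul_apply, smul_eq_mul]
  rw [← Fintype.sum_equiv (Fin.consEquiv fun _ : Fin (N + 1) => Fin 2)
    (fun p => monodromy β t x r s (Fin.cons c₀ c) (Fin.cons p.1 p.2) * f (Fin.cons p.1 p.2)) _
    fun p => rfl, Fintype.sum_prod_type]
  refine Finset.sum_congr rfl fun b₀ _ => ?_
  simp only [monodromy_cons, Finset.sum_mul, Finset.mul_sum]
  rw [Finset.sum_comm]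
  refine Finset.sum_congr rfl fun a _ => Finset.sum_congr rfl fun b _ => by ring

variable (β : A) (t : Fin (N + 1) → A) (x : A) (r : Fin 2) (f : (Fin (N + 1) → Fin 2) → A)

/-- Splitting on the right changes only the column index, so one recursion treats A and C (column 0)
and another B and D (column 1), for either row r. -/
theorem slice_col_zero_zero : slice 0 (monodromy β t x r 0 *ᵥ f) =
    fsub β x (t 0) • (monodromy β (fun j => t j.succ) x r 0 *ᵥ slice 0 f) +
      monodromy β (fun j => t j.succ) x r 1 *ᵥ slice 1 f := by
  simp [slice_mulVec, lmat_eq, Fin.sum_univ_two]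

theorem slice_col_zero_one : slice 1 (monodromy β t x r 0 *ᵥ f) =
    monodromy β (fun j => t j.succ) x r 0 *ᵥ slice 1 f := by
  simp [slice_mulVec, lmat_eq, Fin.sum_univ_two]

theorem slice_col_one_zero : slice 0 (monodromy β t x r 1 *ᵥ f) =
    monodromy β (fun j => t j.succ) x r 1 *ᵥ slice 0 f := by
  simp [slice_mulVec, lmat_eq, Fin.sum_univ_two]

theorem slice_col_one_one : slice 1 (monodromy β t x r 1 *ᵥ f) =
    (1 + β * fsub β x (t 0)) • (monodromy β (fun j => t j.succ) x r 0 *ᵥ slice 0 f) := by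
  simp [slice_mulVec, lmat_eq, Fin.sum_univ_two]

end Monodromy

/-! ### Exchange relations and Bethe vectors -/

section Exchange

variable {A : Type*} [CommRing A] {N n : ℕ}

theorem monodromy_zero (β : A) (t : Fin 0 → A) (x : A) : monodromy β t x = 1 := by
  simp [monodromy]

/-- The usual relation between A and B divides by y - x. The map `S` stands for the divided
difference of B(x)A(y) - B(y)A(x), so no division is needed. The relations feed each other in the
induction on N and are proved together. -/
theorem exchange_relations (β : A) (t : Fin N → A) (ht : ∀ j, IsUnit (1 + β * t j)) (x y : A) :
    ∃ S : ((Fin N → Fin 2) → A) → ((Fin N → Fin 2) → A), ∀ f,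
      monodromy β t x 0 0 *ᵥ (monodromy β t y 0 1 *ᵥ f) = (1 + β * y) • S f ∧
      monodromy β t y 0 0 *ᵥ (monodromy β t x 0 1 *ᵥ f) = (1 + β * x) • S f ∧
      monodromy β t x 0 1 *ᵥ (monodromy β t y 0 0 *ᵥ f) =
        monodromy β t y 0 1 *ᵥ (monodromy β t x 0 0 *ᵥ f) + (y - x) • S f ∧
      monodromy β t x 0 0 *ᵥ (monodromy β t y 0 0 *ᵥ f) =
        monodromy β t y 0 0 *ᵥ (monodromy β t x 0 0 *ᵥ f) ∧
      monodromy β t x 0 1 *ᵥ (monodromy β t y 0 1 *ᵥ f) =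
        monodromy β t y 0 1 *ᵥ (monodromy β t x 0 1 *ᵥ f) := by
  induction N with
  | zero =>
    refine ⟨fun _ => 0, fun f => ?_⟩
    simp [monodromy_zero]
  | succ N ih =>
    obtain ⟨S, hS⟩ := ih (fun j => t j.succ) fun j => ht _
    let A' := fun x => monodromy β (fun j => t j.succ) x 0 0
    let B' := fun x => monodromy β (fun j => t j.succ) x 0 1
    let v := Ring.inverse (1 + β * t 0)
    have hv : (1 + β * t 0) * v = 1 := Ring.mul_inverse_cancel _ (ht 0)
    have hu (x : A) : fsub β x (t 0) = (x - t 0) * v := rfl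
    -- `S0` and `S1` are read off from the two slices of A(x)B(y)f by cancelling 1 + β y, using 1 +
    -- β (y ⊖ t_0) = (1 + β y) v.
    let S0 : ((Fin (N + 1) → Fin 2) → A) → (Fin N → Fin 2) → A := fun f =>
      fsub β x (t 0) • S (slice 0 f) + v • (B' x *ᵥ (A' y *ᵥ slice 0 f))
    let S1 : ((Fin (N + 1) → Fin 2) → A) → (Fin N → Fin 2) → A := fun f =>
      v • (A' x *ᵥ (A' y *ᵥ slice 0 f))
    have hsl (f) : ∃ g : (Fin (N + 1) → Fin 2) → A, slice 0 g = S0 f ∧ slice 1 g = S1 f :=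
      ⟨fun w => if w 0 = 0 then S0 f (Fin.tail w) else S1 f (Fin.tail w), by
        funext w; simp [slice], by funext w; simp [slice]⟩
    choose S' hS'0 hS'1 using hsl
    have hadd (a : Fin 2) (f g : (Fin (N + 1) → Fin 2) → A) :
      slice a (f + g) = slice a f + slice a g := rfl
    have hsmul (a : Fin 2) (c : A) (f : (Fin (N + 1) → Fin 2) → A) :
      slice a (c • f) = c • slice a f := rfl
    refine ⟨S', fun f => ?_⟩
    obtain ⟨h1, h2, h3, h4, h5⟩ := hS (slice 0 f)
    obtain ⟨k1, k2, k3, k4, k5⟩ := hS (slice 1 f)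
    refine ⟨slice_ext ?_ ?_, slice_ext ?_ ?_, slice_ext ?_ ?_, slice_ext ?_ ?_, slice_ext ?_ ?_⟩ <;>
      simp only [slice_col_zero_zero, slice_col_zero_one, slice_col_one_zero, slice_col_one_one,
        Matrix.mulVec_add, Matrix.mulVec_smul, hS'0, hS'1, S0, S1, A', B', h1, h2, h3, h4, h5,
        k1, k2, k3, k4, k5, hadd, hsmul, hu] <;>
      funext w <;> simp only [Pi.add_apply, Pi.smul_apply, smul_eq_mul] <;>
      generalize (monodromy β (fun j => t j.succ) y 0 1 *ᵥ
        monodromy β (fun j => t j.succ) x 0 0 *ᵥ slice 0 f) w = B0 <;>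
      generalize (monodromy β (fun j => t j.succ) y 0 0 *ᵥ
        monodromy β (fun j => t j.succ) x 0 0 *ᵥ slice 0 f) w = A0 <;>
      generalize S (slice 0 f) w = s0 <;>
      generalize S (slice 1 f) w = s1
    · linear_combination (-B0 - (y - x) * s0) * hv
    · linear_combination -A0 * hv
    · linear_combination -B0 * hv
    · linear_combination -A0 * hv
    · ring
    · linear_combination -(β * (y - x) * s1) * hv
    · linear_combination -((y - x) * s1) * hv
    · linear_combination -(β * (y - x) * s0) * hv

/-- The operators `B(x)` commute. -/
theorem commute_Bop (β : A) (t : Fin N → A) (ht : ∀ j, IsUnit (1 + β * t j)) (x y : A) :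
    Commute (Bop β t x) (Bop β t y) := by
  obtain ⟨S, hS⟩ := exchange_relations β t ht x y
  refine Matrix.ext_of_mulVec_single fun i => ?_
  rw [← Matrix.mulVec_mulVec, ← Matrix.mulVec_mulVec]
  exact (hS _).2.2.2.2

theorem betheVector_zero (β : A) (t : Fin N → A) (y : Fin 0 → A) :
    betheVector β t y = Pi.single 0 1 := by
  rw [betheVector, List.ofFn_zero, List.reverse_nil, List.prod_nil, Matrix.one_mulVec]

/-- The Bethe vector does not depend on the order in which the operators `B` are applied. -/
theorem betheVector_cons (β : A) (t : Fin N → A) (ht : ∀ j, IsUnit (1 + β * t j)) (x : A)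
    (y : Fin n → A) :
    betheVector β t (Fin.cons x y : Fin (n + 1) → A) = Bop β t x *ᵥ betheVector β t y := by
  have h : Commute (Bop β t x) (List.ofFn fun i => Bop β t (y i)).reverse.prod := by
    refine Commute.list_prod_right _ _ fun M hM => ?_
    rw [List.mem_reverse, List.mem_ofFn] at hM
    obtain ⟨i, rfl⟩ := hM
    exact commute_Bop β t ht _ _
  simp only [betheVector, List.ofFn_succ, Fin.cons_zero, Fin.cons_succ, List.reverse_cons,
    List.prod_append, List.prod_singleton]
  rw [← h.eq, Matrix.mulVec_mulVec]

theorem betheVector_succ (β : A) (t : Fin N → A) (ht : ∀ j, IsUnit (1 + β * t j))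
    (y : Fin (n + 1) → A) :
    betheVector β t y = Bop β t (y 0) *ᵥ betheVector β t (Fin.tail y) := by
  rw [← betheVector_cons β t ht, Fin.cons_self_tail]

theorem slice_zero_vacuum : slice 0 (Pi.single 0 1 : (Fin (N + 1) → Fin 2) → A) =
    Pi.single 0 1 := by
  funext w
  simp only [slice, Pi.single_apply]
  congr 1
  rw [← Matrix.vecCons, Matrix.cons_eq_zero_iff]
  simp

theorem slice_one_vacuum : slice 1 (Pi.single 0 1 : (Fin (N + 1) → Fin 2) → A) = 0 := by
  funext w
  simp only [slice, Pi.single_apply, Pi.zero_apply]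
  rw [if_neg fun h => by simpa using congrFun h 0]

theorem monodromy_zero_zero_vacuum (β : A) (t : Fin N → A) (x : A) :
    monodromy β t x 0 0 *ᵥ Pi.single 0 1 = (∏ j, fsub β x (t j)) • Pi.single 0 1 := by
  induction N with
  | zero =>
    rw [monodromy_zero, Matrix.one_apply_eq, Matrix.one_mulVec, Finset.univ_eq_empty,
      Finset.prod_empty, one_smul]
  | succ N ih =>
    refine slice_ext ?_ ?_
    · rw [slice_col_zero_zero, slice_zero_vacuum, slice_one_vacuum, ih, Matrix.mulVec_zero,
        add_zero, smul_smul, Fin.prod_univ_succ]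
      exact (congrArg _ slice_zero_vacuum).symm
    · rw [slice_col_zero_one, slice_one_vacuum, Matrix.mulVec_zero]
      exact ((congrArg ((∏ j, fsub β x (t j)) • ·) slice_one_vacuum).trans (smul_zero _)).symm

/-- In column 1 a leading 0 arises only from a leading 0 and with weight 1, so the first parameter
drops out. -/
theorem slice_zero_betheVector (β : A) (t : Fin (N + 1) → A) (ht : ∀ j, IsUnit (1 + β * t j))
    (y : Fin n → A) :
    slice 0 (betheVector β t y) = betheVector β (fun j => t j.succ) y := by
  induction n with
  | zero => rw [betheVector_zero, betheVector_zero, slice_zero_vacuum]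
  | succ n ih =>
    rw [betheVector_succ β t ht, betheVector_succ β _ fun j => ht _, Bop, slice_col_one_zero, ih]
    rfl

theorem slice_one_betheVector (β : A) (t : Fin (N + 1) → A) (ht : ∀ j, IsUnit (1 + β * t j))
    (y : Fin (n + 1) → A) :
    slice 1 (betheVector β t y) = (1 + β * fsub β (y 0) (t 0)) •
      (monodromy β (fun j => t j.succ) (y 0) 0 0 *ᵥ
        betheVector β (fun j => t j.succ) (Fin.tail y)) := by
  rw [betheVector_succ β t ht, Bop, slice_col_one_one, slice_zero_betheVector _ _ ht]

/-- The product of all differences `y_i - y_j`, `i < j`. -/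
def diffProd {A : Type*} [CommRing A] : {n : ℕ} → (Fin n → A) → A
  | 0, _ => 1
  | _ + 1, y => (∏ j, (y 0 - Fin.tail y j)) * diffProd (Fin.tail y)

theorem diffProd_cons (x : A) (y : Fin n → A) :
    diffProd (Fin.cons x y : Fin (n + 1) → A) = (∏ j, (x - y j)) * diffProd y := by
  simp [diffProd]

theorem isUnit_diffProd (y : Fin n → A) (h : ∀ i j, i ≠ j → IsUnit (y i - y j)) :
    IsUnit (diffProd y) := by
  induction n with
  | zero => exact isUnit_one
  | succ n ih =>
    refine IsUnit.mul (Finset.prod_induction _ IsUnit (fun _ _ => IsUnit.mul) isUnit_one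
      fun j _ => h _ _ (Fin.succ_ne_zero j).symm) (ih _ fun i j hij => h _ _ ?_)
    simpa using hij

theorem cons_comp_succAbove_zero {α : Type*} (x : α) (y : Fin n → α) :
    (Fin.cons x y : Fin (n + 1) → α) ∘ Fin.succAbove 0 = y := by
  funext j
  simp

theorem cons_comp_succAbove_succ {α : Type*} (x : α) (y : Fin (n + 1) → α) (i : Fin (n + 1)) :
    (Fin.cons x y : Fin (n + 2) → α) ∘ i.succ.succAbove = Fin.cons x (y ∘ i.succAbove) := by
  funext j
  refine Fin.cases ?_ (fun j => ?_) j <;> simp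

theorem cons_comp_succAbove_succ_zero {α : Type*} (x x' : α) (y : Fin n → α) :
    (Fin.cons x (Fin.cons x' y : Fin (n + 1) → α) : Fin (n + 2) → α) ∘ (Fin.succ 0).succAbove =
      Fin.cons x y := by
  rw [cons_comp_succAbove_succ, cons_comp_succAbove_zero]

/-- The expansion of `A(x) B(y_1) ⋯ B(y_n) v_0 ⊗ ⋯ ⊗ v_0` in Bethe vectors. -/
theorem diffProd_smul_mulVec_betheVector (β : A) (t : Fin N → A)
    (ht : ∀ j, IsUnit (1 + β * t j)) (x : A) (y : Fin n → A) :
    diffProd (Fin.cons x y : Fin (n + 1) → A) • (monodromy β t x 0 0 *ᵥ betheVector β t y) =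
      (∏ j, (1 + β * y j)) • ∑ i : Fin (n + 1),
        ((-1) ^ (i : ℕ) * (∏ j, fsub β ((Fin.cons x y : Fin (n + 1) → A) i) (t j)) *
          diffProd ((Fin.cons x y : Fin (n + 1) → A) ∘ i.succAbove)) •
            betheVector β t ((Fin.cons x y : Fin (n + 1) → A) ∘ i.succAbove) := by
  induction n generalizing x with
  | zero =>
    rw [betheVector_zero, monodromy_zero_zero_vacuum]
    simp [diffProd, betheVector_zero]
  | succ n ih =>
    obtain ⟨x', y, rfl⟩ : ∃ x' y', y = Fin.cons x' y' := ⟨_, _, (Fin.cons_self_tail y).symm⟩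
    obtain ⟨S, hS⟩ := exchange_relations β t ht x' x
    have h2 := (hS (betheVector β t y)).2.1
    have h3 := (hS (betheVector β t y)).2.2.1
    -- One exchange relation carries A past B(x'), producing A(x) and A(x') acting on one B fewer;
    -- the induction hypothesis applies to both.
    have key : diffProd (Fin.cons x (Fin.cons x' y) : Fin (n + 2) → A) •
        (monodromy β t x 0 0 *ᵥ betheVector β t (Fin.cons x' y : Fin (n + 1) → A)) =
        (1 + β * x') • ((∏ j, (x' - y j)) • (Bop β t x' *ᵥ
          (diffProd (Fin.cons x y : Fin (n + 1) → A) •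
            (monodromy β t x 0 0 *ᵥ betheVector β t y))) -
          (∏ j, (x - y j)) • (Bop β t x *ᵥ
          (diffProd (Fin.cons x' y : Fin (n + 1) → A) •
            (monodromy β t x' 0 0 *ᵥ betheVector β t y)))) := by
      rw [betheVector_cons β t ht, Bop, Bop, h2, Matrix.mulVec_smul, Matrix.mulVec_smul, h3]
      simp only [diffProd_cons, Fin.prod_univ_succ, Fin.cons_zero, Fin.cons_succ]
      module
    rw [key, ih, ih, Fin.prod_univ_succ, Fin.sum_univ_succ, Fin.sum_univ_succ, Fin.sum_univ_succ,
      Fin.sum_univ_succ]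
    simp only [Matrix.mulVec_smul, Matrix.mulVec_add, Matrix.mulVec_sum, ← betheVector_cons β t ht,
      cons_comp_succAbove_zero, Fin.cons_zero, Fin.cons_succ, cons_comp_succAbove_succ_zero,
      diffProd_cons]
    cases n with
    | zero =>
      simp
      module
    | succ n =>
      have e1 (i : Fin (n + 1)) : betheVector β t (Fin.cons x' (Fin.cons x (y ∘ i.succAbove))) =
          betheVector β t (Fin.cons x (Fin.cons x' (y ∘ i.succAbove))) := by
        simp only [betheVector_cons β t ht, Matrix.mulVec_mulVec, (commute_Bop β t ht x x').eq]
      simp only [cons_comp_succAbove_succ, e1, diffProd_cons]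
      have e2 (i : Fin (n + 1)) (z : A) : ∏ j, (z - y j) =
          (z - y i) * ∏ j, (z - (y ∘ i.succAbove) j) :=
        Fin.prod_univ_succAbove _ i
      simp only [smul_add, smul_sub, Finset.smul_sum, smul_smul]
      rw [add_sub_add_comm, ← Finset.sum_sub_distrib]
      rw [← add_assoc]
      congr 1
      · simp only [Fin.val_zero, Fin.val_succ, pow_succ, pow_zero]
        module
      · refine Finset.sum_congr rfl fun i _ => ?_
        rw [← sub_smul]
        congr 1
        -- In both expansions the term omitting y_i carries the same Bethe vector. The coefficients
        -- combine through (x' - y_i) - (x - y_i) = x' - x.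
        rw [e2 i x, e2 i x', Fin.prod_univ_succ (fun j => x - _)]
        simp only [Fin.val_succ, pow_succ, Fin.cons_zero, Fin.cons_succ]
        ring

end Exchange

/-! ### Determinantal formula for Bethe vectors -/

section Determinant

variable {A : Type*} [CommRing A] {N n : ℕ}

/-- The binary string with letters `1` at the positions `w 0, w 1, …`. -/
def wordOf (w : Fin n → Fin N) : Fin N → Fin 2 := fun j => if ∃ i, w i = j then 1 else 0

/-- The number of letters `1` of a binary string. -/
def ones (b : Fin N → Fin 2) : ℕ := ∑ j, (b j : ℕ)

/-- The coefficients of `B(y) v_0 ⊗ ⋯ ⊗ v_0`. -/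
def oneParticle (β : A) (t : Fin N → A) (p : Fin N) (y : A) : A :=
  (1 + β * fsub β y (t p)) * ∏ l ∈ Finset.Ioi p, fsub β y (t l)

/-- Each L-operator conserves the number of letters 1, counted together with the auxiliary index. -/
theorem monodromy_eq_zero (β : A) (t : Fin N → A) (x : A) (r s : Fin 2) (c b : Fin N → Fin 2)
    (h : ones c + r ≠ ones b + s) : monodromy β t x r s c b = 0 := by
  induction N generalizing s with
  | zero =>
    rw [monodromy_zero, Matrix.one_apply_ne, Matrix.zero_apply]
    rintro rfl
    simp [ones] at h
  | succ N ih =>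
    obtain ⟨c₀, c, rfl⟩ : ∃ c₀ c', c = Fin.cons c₀ c' := ⟨_, _, (Fin.cons_self_tail c).symm⟩
    obtain ⟨b₀, b, rfl⟩ : ∃ b₀ b', b = Fin.cons b₀ b' := ⟨_, _, (Fin.cons_self_tail b).symm⟩
    rw [monodromy_cons]
    refine Finset.sum_eq_zero fun a _ => ?_
    by_cases h' : ones c + r = ones b + a
    · have h2 : lmat β x (t 0) c₀ b₀ a s = 0 := by
        simp only [ones, Fin.sum_univ_succ, Fin.cons_zero, Fin.cons_succ] at h h'
        rw [lmat_eq]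
        revert h
        fin_cases c₀ <;> fin_cases b₀ <;> fin_cases a <;> fin_cases s <;> simp at * <;> omega
      rw [h2, mul_zero]
    · rw [ih _ _ _ _ h', zero_mul]

theorem betheVector_eq_zero (β : A) (t : Fin N → A) (ht : ∀ j, IsUnit (1 + β * t j))
    (y : Fin n → A) (c : Fin N → Fin 2) (h : ones c ≠ n) : betheVector β t y c = 0 := by
  induction n generalizing c with
  | zero =>
    rw [betheVector_zero, Pi.single_eq_of_ne]
    rintro rfl
    simp [ones] at h
  | succ n ih =>
    rw [betheVector_succ β t ht]
    refine Finset.sum_eq_zero fun b _ => ?_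
    change monodromy β t (y 0) 0 1 c b * _ = 0
    by_cases hb : ones b = n
    · rw [monodromy_eq_zero, zero_mul]
      simpa [hb] using h
    · rw [ih _ _ hb, mul_zero]

theorem wordOf_eq_zero (w : Fin 0 → Fin N) : wordOf w = 0 := by
  funext j
  simp [wordOf]

theorem wordOf_eq_one {w : Fin n → Fin N} {p : Fin N} : wordOf w p = 1 ↔ ∃ i, w i = p := by
  unfold wordOf
  split_ifs with h <;> simp [h]

theorem wordOf_eq_zero_iff {w : Fin n → Fin N} {p : Fin N} :
    wordOf w p = 0 ↔ ¬ ∃ i, w i = p := by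
  unfold wordOf
  split_ifs with h <;> simp [h]

theorem wordOf_congr {n' : ℕ} {w : Fin n → Fin N} {w' : Fin n' → Fin N}
    (h : ∀ p, (∃ i, w i = p) ↔ ∃ i, w' i = p) : wordOf w = wordOf w' := by
  funext p
  simp only [wordOf, h]

theorem wordOf_succ (w : Fin n → Fin N) :
    wordOf (fun i => (w i).succ) = Fin.cons 0 (wordOf w) := by
  funext j
  refine Fin.cases ?_ (fun j => ?_) j <;> simp [wordOf]

theorem wordOf_cons (w : Fin n → Fin N) :
    wordOf (Fin.cons 0 fun i => (w i).succ : Fin (n + 1) → Fin (N + 1)) =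
      Fin.cons 1 (wordOf w) := by
  funext j
  refine Fin.cases ?_ (fun j => ?_) j <;> simp [wordOf, Fin.exists_fin_succ, (Fin.succ_ne_zero _).symm]

theorem oneParticle_succ (β : A) (t : Fin (N + 1) → A) (p : Fin N) (y : A) :
    oneParticle β t p.succ y = oneParticle β (fun j => t j.succ) p y := by
  rw [oneParticle, oneParticle, Fin.Ioi_succ, Finset.prod_map]
  rfl

theorem oneParticle_zero (β : A) (t : Fin (N + 1) → A) (y : A) :
    oneParticle β t 0 y = (1 + β * fsub β y (t 0)) * ∏ l : Fin N, fsub β y (t l.succ) := by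
  rw [oneParticle, Fin.Ioi_zero_eq_map, Finset.prod_map]
  rfl

theorem one_add_mul_fsub {β s : A} (hs : IsUnit (1 + β * s)) (x : A) :
    1 + β * fsub β x s = (1 + β * x) * Ring.inverse (1 + β * s) := by
  have h := Ring.mul_inverse_cancel _ hs
  rw [fsub]
  linear_combination -h

/-- The matrix whose determinant is the coefficient of a Bethe vector, up to `diffProd`. -/
def particleMatrix (β : A) (t : Fin N → A) (w : Fin n → Fin N) (z : Fin n → A) :
    Matrix (Fin n) (Fin n) A :=
  Matrix.of fun i j => oneParticle β t (w j) (z i) * (1 + β * z i) ^ (j : ℕ)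

/-- Induction on N. A leading 0 just removes a parameter from both sides. For a leading 1, the
remaining slice is A applied to a shorter Bethe vector, and its expansion
`diffProd_smul_mulVec_betheVector` is the Laplace expansion along column 0. -/
theorem diffProd_mul_betheVector (β : A) (t : Fin N → A) (ht : ∀ j, IsUnit (1 + β * t j))
    (z : Fin n → A) (w : Fin n → Fin N) (hw : StrictMono w) :
    diffProd z * betheVector β t z (wordOf w) = (particleMatrix β t w z).det := by
  induction N generalizing n with
  | zero =>
    cases n with
    | zero => rw [wordOf_eq_zero, betheVector_zero]; simp [diffProd]
    | succ n => exact (w 0).elim0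
  | succ N ih =>
    cases n with
    | zero => rw [wordOf_eq_zero, betheVector_zero]; simp [diffProd]
    | succ n =>
      by_cases h0 : w 0 = 0
      · obtain ⟨w', hw', rfl⟩ : ∃ w' : Fin n → Fin N, StrictMono w' ∧
            w = Fin.cons 0 fun i => (w' i).succ := by
          have h (i : Fin n) : w i.succ ≠ 0 := by
            have := hw (Fin.succ_pos i)
            rw [h0] at this
            exact this.ne'
          refine ⟨fun i => (w i.succ).pred (h i), fun i j hij => ?_, ?_⟩
          · rw [Fin.pred_lt_pred_iff]
            exact hw (by simpa using hij)
          · funext i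
            refine Fin.cases ?_ (fun i => ?_) i <;> simp [h0]
        have h1 := congrFun (slice_one_betheVector β t ht z) (wordOf w')
        have h2 := congrFun (diffProd_smul_mulVec_betheVector β (fun j => t j.succ)
          (fun j => ht _) (z 0) (Fin.tail z)) (wordOf w')
        rw [Fin.cons_self_tail] at h2
        rw [slice, ← wordOf_cons] at h1
        rw [h1, Matrix.det_succ_column_zero]
        simp only [Pi.smul_apply, smul_eq_mul, Finset.sum_apply] at h2 ⊢
        rw [mul_left_comm, h2, one_add_mul_fsub (ht 0), Finset.mul_sum, Finset.mul_sum]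
        refine Finset.sum_congr rfl fun i _ => ?_
        have h3 := ih (fun j => t j.succ) (fun j => ht _) (z ∘ i.succAbove) w' hw'
        -- Removing column 0 lowers every column index by one, so each remaining row releases one
        -- factor 1 + β z. With the factor of row i these give the full product, whichever i is
        -- removed.
        have h4 : (particleMatrix β t (Fin.cons 0 fun i => (w' i).succ) z).submatrix
            i.succAbove Fin.succ = Matrix.of fun i' j => (1 + β * (z ∘ i.succAbove) i') *
              particleMatrix β (fun j => t j.succ) w' (z ∘ i.succAbove) i' j := by
          ext i' j
          simp [particleMatrix, oneParticle_succ]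
          ring
        have h5 : (1 + β * z 0) * ∏ j, (1 + β * Fin.tail z j) =
            (1 + β * z i) * ∏ j, (1 + β * (z ∘ i.succAbove) j) :=
          (Fin.prod_univ_succ fun i => 1 + β * z i).symm.trans
            (Fin.prod_univ_succAbove (fun i => 1 + β * z i) i)
        rw [h4, Matrix.det_mul_column, ← h3, particleMatrix, Matrix.of_apply, Fin.cons_zero,
          oneParticle_zero, one_add_mul_fsub (ht 0)]
        simp only [Fin.val_zero, pow_zero]
        linear_combination (Ring.inverse (1 + β * t 0) * (-1) ^ (i : ℕ) *
          (∏ l : Fin N, fsub β (z i) (t l.succ)) * diffProd (z ∘ i.succAbove) *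
          betheVector β (fun j => t j.succ) (z ∘ i.succAbove) (wordOf w')) * h5
      · obtain ⟨w', hw', rfl⟩ : ∃ w' : Fin (n + 1) → Fin N, StrictMono w' ∧
            w = fun i => (w' i).succ := by
          have h (i : Fin (n + 1)) : w i ≠ 0 := fun h =>
            h0 (le_antisymm (by simpa [h] using hw.monotone (Fin.zero_le i)) (Fin.zero_le _))
          refine ⟨fun i => (w i).pred (h i), fun i j hij => ?_, ?_⟩
          · rw [Fin.pred_lt_pred_iff]
            exact hw hij
          · funext i
            simp
        have h1 := congrFun (slice_zero_betheVector β t ht z) (wordOf w')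
        rw [slice, ← wordOf_succ] at h1
        rw [h1, ih _ (fun j => ht _) z w' hw']
        congr 1
        ext i j
        simp [particleMatrix, oneParticle_succ]

end Determinant

/-! ### Moving letters of cyclic binary strings -/

section Moves

variable {N n : ℕ} [NeZero N]

/-- The positions of the letters `1` that can be moved one step to the left, cyclically. -/
def free (b : Fin N → Fin 2) : Finset (Fin N) :=
  Finset.univ.filter fun p => b p = 1 ∧ b (p - 1) = 0

/-- The string obtained by moving the letters `1` at the positions in `S` one step to the left. -/
def move (b : Fin N → Fin 2) (S : Finset (Fin N)) : Fin N → Fin 2 :=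
  fun p => if p ∈ S then 0 else if p + 1 ∈ S then 1 else b p

/-- The positions of the letters after moving those with index in `J`. -/
def movePos (w : Fin n → Fin N) (J : Finset (Fin n)) : Fin n → Fin N :=
  fun j => if j ∈ J then w j - 1 else w j

theorem val_sub_one {p : Fin N} (hp : p ≠ 0) : ((p - 1 : Fin N) : ℕ) = p - 1 :=
  Fin.val_sub_one_of_ne_zero hp

theorem val_zero_sub_one : ((0 - 1 : Fin N) : ℕ) = N - 1 := by
  obtain ⟨N, rfl⟩ := Nat.exists_eq_succ_of_ne_zero (NeZero.ne N)
  simp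

theorem val_pos {p : Fin N} (hp : p ≠ 0) : 0 < (p : ℕ) :=
  Nat.pos_of_ne_zero fun h => hp (Fin.ext (by simpa using h))

theorem index_eq_zero {w : Fin (n + 1) → Fin N} (hw : StrictMono w) {j : Fin (n + 1)}
    (h : w j = 0) : j = 0 := by
  by_contra hj
  have := hw (Fin.pos_of_ne_zero hj)
  rw [h] at this
  exact absurd this (by simp)

/-- Positions increase with the index, so a letter can be blocked only by its cyclic predecessor.
For the letter at 0 this is the last letter, at N - 1. -/
theorem eq_sub_one_of_strictMono {w : Fin (n + 1) → Fin N} (hw : StrictMono w)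
    {i j : Fin (n + 1)} (h : w j - 1 = w i) : i = j - 1 := by
  have hlt (a b : Fin (n + 1)) : (w a : ℕ) < w b ↔ (a : ℕ) < b := hw.lt_iff_lt
  by_cases h0 : w j = 0
  · obtain rfl := index_eq_zero hw h0
    have h1 := congrArg Fin.val h
    rw [h0, val_zero_sub_one] at h1
    have h2 : ((0 - 1 : Fin (n + 1)) : ℕ) = n := val_zero_sub_one
    refine Fin.ext ?_
    rw [h2]
    by_contra h3
    have h4 := (hlt i (Fin.last n)).2 (by simp; omega)
    omega
  · have h1 := congrArg Fin.val h
    rw [val_sub_one h0] at h1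
    have h0' := val_pos h0
    have h2 := (hlt i j).1 (by omega)
    have hj : j ≠ 0 := by rintro rfl; simp at h2
    refine Fin.ext ?_
    rw [val_sub_one hj]
    by_contra h3
    let m : Fin (n + 1) := ⟨i + 1, by omega⟩
    have h4 := (hlt i m).2 (by simp [m])
    have h5 := (hlt m j).2 (by simp [m]; omega)
    omega

/-- If all letters were blocked, the occupied positions would be closed under p ↦ p - 1 and hence be
all of `Fin N`. The unblocked letter starts the cyclic column elimination. -/
theorem exists_sub_one_ne {w : Fin (n + 1) → Fin N} (hn : n + 1 < N) :
    ∃ j, w j - 1 ≠ w (j - 1) := by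
  by_contra! h
  have h1 (k : ℕ) : ∀ p p' : Fin N, (p : ℕ) = p' + k → (∃ i, w i = p) → ∃ i, w i = p' := by
    induction k with
    | zero => rintro p p' hp ⟨i, hi⟩; exact ⟨i, hi.trans (Fin.ext hp)⟩
    | succ k ih =>
      rintro p p' hp ⟨i, rfl⟩
      have h0 : w i ≠ 0 := fun h => by rw [h] at hp; simp at hp
      exact ih (w i - 1) p' (by rw [val_sub_one h0]; omega) ⟨i - 1, (h i).symm⟩
  have h2 : Function.Surjective w := fun p => by
    -- Descend from the first letter to 0, wrap around to N - 1, and descend from there to p.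
    obtain ⟨i, hi⟩ := h1 (w 0) (w 0) 0 (by simp) ⟨0, rfl⟩
    refine h1 (N - 1 - p) (0 - 1) p ?_ ⟨i - 1, by rw [← h, hi]⟩
    rw [val_zero_sub_one]
    omega
  have := Fintype.card_le_of_surjective w h2
  simp at this
  omega

/-- The indices of the letters that can be moved. -/
def freeIdx (w : Fin (n + 1) → Fin N) : Finset (Fin (n + 1)) :=
  Finset.univ.filter fun j => w j - 1 ≠ w (j - 1)

theorem mem_freeIdx_iff {w : Fin (n + 1) → Fin N} (hw : StrictMono w) {j : Fin (n + 1)} :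
    j ∈ freeIdx w ↔ ∀ i, w i ≠ w j - 1 := by
  simp only [freeIdx, Finset.mem_filter, Finset.mem_univ, true_and]
  constructor
  · intro h i hi
    obtain rfl := eq_sub_one_of_strictMono hw hi.symm
    exact h hi.symm
  · intro h h'
    exact h _ h'.symm

theorem free_wordOf {w : Fin (n + 1) → Fin N} (hw : StrictMono w) :
    free (wordOf w) = (freeIdx w).map ⟨w, hw.injective⟩ := by
  ext p
  simp only [free, Finset.mem_filter, Finset.mem_univ, true_and, wordOf_eq_one,
    wordOf_eq_zero_iff, Finset.mem_map, Function.Embedding.coeFn_mk, mem_freeIdx_iff hw]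
  constructor
  · rintro ⟨⟨i, rfl⟩, h⟩
    exact ⟨i, fun j hj => h ⟨j, hj⟩, rfl⟩
  · rintro ⟨i, h, rfl⟩
    exact ⟨⟨i, rfl⟩, fun ⟨j, hj⟩ => h j hj⟩

theorem move_wordOf {w : Fin (n + 1) → Fin N} (hw : StrictMono w) {J : Finset (Fin (n + 1))}
    (hJ : J ⊆ freeIdx w) :
    move (wordOf w) (J.map ⟨w, hw.injective⟩) = wordOf (movePos w J) := by
  funext p
  have hmem (p) : p ∈ J.map ⟨w, hw.injective⟩ ↔ ∃ j ∈ J, w j = p := by simp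
  unfold move
  split_ifs with h1 h2
  · obtain ⟨j, hj, rfl⟩ := (hmem _).1 h1
    refine (wordOf_eq_zero_iff.2 ?_).symm
    rintro ⟨i, hi⟩
    unfold movePos at hi
    split_ifs at hi with h
    · exact (mem_freeIdx_iff hw).1 (hJ h) j hi.symm
    · exact h (hw.injective hi ▸ hj)
  · obtain ⟨j, hj, hj'⟩ := (hmem _).1 h2
    refine (wordOf_eq_one.2 ⟨j, ?_⟩).symm
    rw [movePos, if_pos hj, hj']
    abel
  · have h : (∃ i, w i = p) ↔ ∃ i, movePos w J i = p := by
      constructor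
      · rintro ⟨i, rfl⟩
        exact ⟨i, if_neg fun hi => h1 ((hmem _).2 ⟨i, hi, rfl⟩)⟩
      · rintro ⟨i, hi⟩
        unfold movePos at hi
        split_ifs at hi with h
        · refine absurd ((hmem _).2 ⟨i, h, ?_⟩) h2
          rw [← hi]
          abel
        · exact ⟨i, hi⟩
    simp only [wordOf, h]

/-- Free letters move into empty places, so the order can change only when the letter at 0 wraps
around. -/
theorem strictMono_movePos {w : Fin (n + 1) → Fin N} (hw : StrictMono w)
    {J : Finset (Fin (n + 1))} (hJ : J ⊆ freeIdx w) {i j : Fin (n + 1)} (hij : i < j)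
    (h0 : i ∈ J → w i ≠ 0) : movePos w J i < movePos w J j := by
  have h1 : (w i : ℕ) < w j := hw hij
  have hj : w j ≠ 0 := fun h => by rw [h] at h1; simp at h1
  have h3 := val_sub_one hj
  rw [Fin.lt_def]
  unfold movePos
  split_ifs with hi hj' hj'
  · have := val_sub_one (h0 hi)
    have := val_pos (h0 hi)
    omega
  · have := val_sub_one (h0 hi)
    omega
  · have h2 := (mem_freeIdx_iff hw).1 (hJ hj') i
    rw [Ne, Fin.ext_iff] at h2
    omega
  · exact h1

/-- The letter leaving 0 becomes the last one, at N - 1; one rotation of the indices restores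
increasing order. -/
theorem strictMono_movePos_comp_finRotate {w : Fin (n + 1) → Fin N} (hw : StrictMono w)
    {J : Finset (Fin (n + 1))} (hJ : J ⊆ freeIdx w) (h0 : 0 ∈ J) (hw0 : w 0 = 0) :
    StrictMono (movePos w J ∘ finRotate (n + 1)) := by
  have hne (i : Fin n) : w i.succ ≠ 0 := fun h => Fin.succ_ne_zero i (index_eq_zero hw h)
  intro i j hij
  cases i using Fin.lastCases with
  | last => exact absurd hij (by simpa using Fin.le_last j)
  | cast i =>
    cases j using Fin.lastCases with
    | last =>
      simp only [Function.comp_apply, finRotate_apply, Fin.coeSucc_eq_succ]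
      rw [Fin.last_add_one]
      have h1 : ((movePos w J 0 : Fin N) : ℕ) = N - 1 := by
        rw [movePos, if_pos h0, hw0, val_zero_sub_one]
      rw [Fin.lt_def, h1]
      have h2 := val_pos (hne i)
      unfold movePos
      split_ifs with h
      · rw [val_sub_one (hne i)]
        omega
      · have h3 := (mem_freeIdx_iff hw).1 (hJ h0) i.succ
        rw [hw0, Ne, Fin.ext_iff, val_zero_sub_one] at h3
        omega
    | cast j =>
      simp only [Function.comp_apply, finRotate_apply, Fin.coeSucc_eq_succ]
      exact strictMono_movePos hw hJ (by simpa using hij) fun _ => hne i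

end Moves

/-- A cyclic version of `Matrix.det_eq_of_forall_col_eq_smul_add_pred`. -/
theorem det_eq_of_forall_col_eq_smul_add_sub_one {R : Type*} [CommRing R] {n : ℕ}
    {A B : Matrix (Fin (n + 1)) (Fin (n + 1)) R} (c : Fin (n + 1) → R) (m : Fin (n + 1))
    (hm : c m = 0) (h : ∀ i j, A i j = B i j + c j * A i (j - 1)) : A.det = B.det := by
  -- Rotating the columns puts m first. Since c m = 0 the cycle is cut there, and the noncyclic
  -- elimination applies.
  have h1 : (A.submatrix id (Equiv.addRight m)).det = (B.submatrix id (Equiv.addRight m)).det := by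
    refine Matrix.det_eq_of_forall_col_eq_smul_add_pred (fun j => c (j.succ + m)) (fun i => ?_)
      fun i j => ?_
    · simp only [Matrix.submatrix_apply, id, Equiv.coe_addRight, zero_add]
      rw [h, hm, zero_mul, add_zero]
    · simp only [Matrix.submatrix_apply, id, Equiv.coe_addRight]
      rw [h]
      congr 3
      rw [← Fin.coeSucc_eq_succ]
      abel
  rw [Matrix.det_permute', Matrix.det_permute'] at h1
  exact ((Equiv.Perm.sign (Equiv.addRight m)).isUnit.map (Int.castRingHom R)).mul_left_cancel h1

/-! ### The Bethe vectors are eigenvectors of the Chevalley operator -/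

section Chevalley

variable {A : Type*} [CommRing A] {N n : ℕ} [NeZero N]

/-- The weight `∏ (1 + β t_j)` over the positions of the letters `1`. -/
def wordWeight {N : ℕ} (β : A) (t : Fin N → A) (b : Fin N → Fin 2) : A :=
  ∏ j, if b j = 1 then 1 + β * t j else 1

/-- The weight `β^|S|`, with an additional `q` if a letter passes the origin. -/
def moveWeight (β q : A) (S : Finset (Fin N)) : A := β ^ S.card * if 0 ∈ S then q else 1

/-- The sum of the weights of all ways to obtain `c` from `b` by moving letters to the left. -/
def moveCoeff (β q : A) (b c : Fin N → Fin 2) : A :=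
  ∑ S ∈ (free b).powerset, if move b S = c then moveWeight β q S else 0

theorem wordWeight_wordOf {N : ℕ} (β : A) (t : Fin N → A) {w : Fin n → Fin N}
    (hw : Function.Injective w) : wordWeight β t (wordOf w) = ∏ i, (1 + β * t (w i)) := by
  classical
  rw [wordWeight, ← Finset.prod_filter, ← Finset.prod_image (s := Finset.univ) (g := w)
    (f := fun j => 1 + β * t j) fun i _ j _ h => hw h]
  refine Finset.prod_congr ?_ fun _ _ => rfl
  ext p
  simp [wordOf_eq_one]

/-- The coefficients `(1 + β t_p) φ_p(y)` for the one-particle coefficients `φ_p(y)`. -/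
def oneParticle' {N : ℕ} (β : A) (t : Fin N → A) (p : Fin N) (y : A) : A :=
  (1 + β * t p) * oneParticle β t p y

theorem oneParticle'_eq {N : ℕ} (β : A) (t : Fin N → A) (ht : ∀ j, IsUnit (1 + β * t j))
    (p : Fin N) (y : A) :
    oneParticle' β t p y = (1 + β * y) * ∏ l ∈ Finset.Ioi p, fsub β y (t l) := by
  rw [oneParticle', oneParticle, one_add_mul_fsub (ht p)]
  linear_combination ((1 + β * y) * ∏ l ∈ Finset.Ioi p, fsub β y (t l)) *
    Ring.mul_inverse_cancel _ (ht p)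

/-- This is 1 + β (y ⊖ t_p) multiplied out. The first summand is the letter staying at p; the second
is the letter moved to p - 1, since ∏ over l ≥ p equals ∏ over l > p - 1 when p ≠ 0. -/
theorem mul_oneParticle {N : ℕ} (β : A) (t : Fin N → A) (ht : ∀ j, IsUnit (1 + β * t j))
    (p : Fin N) (y : A) :
    (1 + β * y) * oneParticle β t p y =
      oneParticle' β t p y + β * ((1 + β * y) * ∏ l ∈ Finset.Ici p, fsub β y (t l)) := by
  have h := Ring.mul_inverse_cancel _ (ht p)
  rw [oneParticle'_eq β t ht, oneParticle, one_add_mul_fsub (ht p), ← Finset.Ioi_insert p,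
    Finset.prod_insert (by simp), fsub]
  linear_combination ((1 + β * y) * ∏ l ∈ Finset.Ioi p, fsub β y (t l)) * h

theorem oneParticle'_sub_one (β : A) (t : Fin N → A) (ht : ∀ j, IsUnit (1 + β * t j))
    {p : Fin N} (hp : p ≠ 0) (y : A) :
    oneParticle' β t (p - 1) y = (1 + β * y) * ∏ l ∈ Finset.Ici p, fsub β y (t l) := by
  rw [oneParticle'_eq β t ht]
  congr 2
  ext l
  have := val_sub_one hp
  have := val_pos hp
  simp only [Finset.mem_Ioi, Finset.mem_Ici, Fin.lt_def, Fin.le_def]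
  omega

theorem oneParticle'_last (β : A) (t : Fin N → A) (ht : ∀ j, IsUnit (1 + β * t j)) (y : A) :
    oneParticle' β t (0 - 1) y = 1 + β * y := by
  rw [oneParticle'_eq β t ht, Finset.prod_eq_one, mul_one]
  intro l hl
  rw [Finset.mem_Ioi, Fin.lt_def, val_zero_sub_one] at hl
  omega

/-- For a letter at position 0 the second summand of `mul_oneParticle` contains the product over all
sites, which the Bethe equation evaluates. -/
theorem IsBetheSolution.prod_fsub {N : ℕ} {β q : A} {t : Fin N → A} {y : Fin (n + 1) → A}
    (hy : IsBetheSolution β q t y) (hu : ∀ i, IsUnit (1 + β * y i)) (i : Fin (n + 1)) :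
    ∏ j, fsub β (y i) (t j) =
      (-1) ^ n * q * Ring.inverse (∏ l, (1 + β * y l)) * (1 + β * y i) ^ (n + 1) := by
  have h := hy i
  have h1 := Ring.mul_inverse_cancel _ ((hu i).pow (n + 1))
  have h2 := Ring.mul_inverse_cancel (∏ l, (1 + β * y l))
    (Finset.prod_induction _ IsUnit (fun _ _ => IsUnit.mul) isUnit_one fun l _ => hu l)
  have h3 : ((-1 : A) ^ n) * (-1) ^ n = 1 := by rw [← mul_pow]; simp
  generalize Ring.inverse (∏ l, (1 + β * y l)) = P' at *
  generalize ∏ l, (1 + β * y l) = P at *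
  generalize ∏ j, fsub β (y i) (t j) = a at *
  generalize Ring.inverse ((1 + β * y i) ^ (n + 1)) = E' at *
  generalize (1 + β * y i) ^ (n + 1) = E at *
  rw [pow_succ] at h
  generalize (-1 : A) ^ n = s at *
  linear_combination (-s * P' * E) * h - (E * E' * P * P' * a) * h3 -
    (a * P * P') * h1 - a * h2

/-- The columns that replace those of `particleMatrix` when a letter moves. -/
def movedColumn (β q : A) (t : Fin N → A) (w : Fin (n + 1) → Fin N) (y : Fin (n + 1) → A)
    (i j : Fin (n + 1)) : A :=
  oneParticle' β t (w j - 1) (y i) * if w j = 0 then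
    (-1) ^ n * q * Ring.inverse (∏ l, (1 + β * y l)) * (1 + β * y i) ^ (n + 1)
    else (1 + β * y i) ^ (j : ℕ)

theorem mul_particleMatrix {β q : A} {t : Fin N → A} (ht : ∀ j, IsUnit (1 + β * t j))
    {y : Fin (n + 1) → A} (hu : ∀ i, IsUnit (1 + β * y i)) (hy : IsBetheSolution β q t y)
    {w : Fin (n + 1) → Fin N} (hw : StrictMono w) (i j : Fin (n + 1)) :
    (1 + β * y i) * particleMatrix β t w y i j =
      oneParticle' β t (w j) (y i) * (1 + β * y i) ^ (j : ℕ) + β * movedColumn β q t w y i j := by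
  rw [particleMatrix, Matrix.of_apply, ← mul_assoc, mul_oneParticle β t ht, movedColumn]
  split_ifs with h
  · obtain rfl := index_eq_zero hw h
    have h1 : (Finset.Ici (0 : Fin N)) = Finset.univ := by ext; simp
    rw [h, h1, hy.prod_fsub hu, oneParticle'_last β t ht]
    simp only [Fin.val_zero, pow_zero]
    ring
  · rw [oneParticle'_sub_one β t ht h]
    ring

/-- A blocked letter contributes a multiple of the preceding column. This also holds cyclically: the
power (1 + β y_i)^(n+1) from the Bethe equation is one more than the exponent n of the last column.
-/
theorem movedColumn_of_eq {β q : A} {t : Fin N → A}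
    {y : Fin (n + 1) → A} {w : Fin (n + 1) → Fin N} (hw : StrictMono w)
    {j : Fin (n + 1)} (hj : w j - 1 = w (j - 1)) (i : Fin (n + 1)) :
    movedColumn β q t w y i j = ((1 + β * t (w (j - 1))) *
      if w j = 0 then (-1) ^ n * q * Ring.inverse (∏ l, (1 + β * y l)) else 1) *
        ((1 + β * y i) * particleMatrix β t w y i (j - 1)) := by
  rw [particleMatrix, Matrix.of_apply, movedColumn, hj, oneParticle']
  split_ifs with h
  · obtain rfl := index_eq_zero hw h
    rw [val_zero_sub_one, Nat.add_sub_cancel, pow_succ]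
    ring
  · have hj0 : j ≠ 0 := by
      rintro rfl
      have h1 := congrArg Fin.val hj
      have h2 : (w 0 : ℕ) ≤ w (0 - 1) := hw.monotone (Fin.zero_le _)
      have := val_pos h
      rw [val_sub_one h] at h1
      omega
    obtain ⟨m, hm⟩ : ∃ m, (j : ℕ) = m + 1 := ⟨_, (Nat.succ_pred_eq_of_pos (val_pos hj0)).symm⟩
    rw [val_sub_one hj0, hm, Nat.add_sub_cancel, pow_succ]
    ring

/-- The matrix with the columns of the letters in `J` moved. -/
def movedMatrix (β q : A) (t : Fin N → A) (w : Fin (n + 1) → Fin N) (y : Fin (n + 1) → A)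
    (J : Finset (Fin (n + 1))) : Matrix (Fin (n + 1)) (Fin (n + 1)) A :=
  Matrix.of fun i j => if j ∈ J then movedColumn β q t w y i j else
    oneParticle' β t (w j) (y i) * (1 + β * y i) ^ (j : ℕ)

theorem prod_mul_det_particleMatrix {β q : A} {t : Fin N → A} (ht : ∀ j, IsUnit (1 + β * t j))
    {y : Fin (n + 1) → A} (hu : ∀ i, IsUnit (1 + β * y i)) (hy : IsBetheSolution β q t y)
    {w : Fin (n + 1) → Fin N} (hw : StrictMono w) (hn : n + 1 < N) :
    (∏ i, (1 + β * y i)) * (particleMatrix β t w y).det =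
      ∑ J ∈ (freeIdx w).powerset, β ^ J.card * (movedMatrix β q t w y J).det := by
  rw [← Matrix.det_mul_column]
  obtain ⟨m, hm⟩ := exists_sub_one_ne (w := w) hn
  let X : Fin (n + 1) → Fin (n + 1) → A := fun j i =>
    oneParticle' β t (w j) (y i) * (1 + β * y i) ^ (j : ℕ)
  let Z : Fin (n + 1) → Fin (n + 1) → A := fun j i =>
    if j ∈ freeIdx w then β * movedColumn β q t w y i j else 0
  -- Column operations discard the moved part of every blocked column. `X` collects the staying
  -- letters, `Z` the moves that remain.
  rw [det_eq_of_forall_col_eq_smul_add_sub_one (B := (Matrix.of (Z + X))ᵀ)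
    (fun j => if w j - 1 = w (j - 1) then β * ((1 + β * t (w (j - 1))) *
      if w j = 0 then (-1) ^ n * q * Ring.inverse (∏ l, (1 + β * y l)) else 1) else 0) m
    (if_neg hm), Matrix.det_transpose]
  · have h1 : (Matrix.of (Z + X)).det = Matrix.detRowAlternating (Z + X) := rfl
    -- Multilinearity gives one determinant for each set of moved letters; a set containing a
    -- blocked letter gives a zero row of the transpose.
    rw [h1, AlternatingMap.map_add_univ, ← Finset.sum_subset (Finset.subset_univ
      (freeIdx w).powerset)]
    · refine Finset.sum_congr rfl fun J hJ => ?_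
      rw [Finset.mem_powerset] at hJ
      have h2 : β ^ J.card = ∏ j, if j ∈ J then β else 1 := by
        rw [Finset.prod_ite_mem, Finset.univ_inter, Finset.prod_const]
      rw [h2, ← Matrix.det_mul_row, ← Matrix.det_transpose]
      change Matrix.det (Matrix.of (J.piecewise Z X)) = _
      congr 1
      ext j i
      by_cases hj : j ∈ J
      · simp [movedMatrix, hj, hJ hj, Z]
      · simp [movedMatrix, hj, X]
    · intro J _ hJ
      obtain ⟨j, hj, hj'⟩ := Finset.not_subset.1 fun h => hJ (Finset.mem_powerset.2 h)
      refine Matrix.det_eq_zero_of_row_eq_zero (A := J.piecewise Z X) j fun i => ?_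
      simp [hj, hj', Z]
  · intro i j
    rw [Matrix.transpose_apply, Matrix.of_apply, Matrix.of_apply, Matrix.of_apply,
      mul_particleMatrix ht hu hy hw, Pi.add_apply, Pi.add_apply]
    by_cases hj : w j - 1 = w (j - 1)
    · have hj' : j ∉ freeIdx w := by simp [freeIdx, hj]
      rw [movedColumn_of_eq hw hj, if_pos hj]
      simp only [Z, X, if_neg hj']
      ring
    · have hj' : j ∈ freeIdx w := by simp [freeIdx, hj]
      rw [if_neg hj]
      simp only [Z, X, if_pos hj']
      ring

/-- After scaling its columns by the weights 1 + β t, the moved matrix is the particle matrix of the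
moved string, with its columns rotated if a letter crosses the origin. -/
theorem det_movedMatrix {β q : A} {t : Fin N → A} (ht : ∀ j, IsUnit (1 + β * t j))
    {y : Fin (n + 1) → A} (hu : ∀ i, IsUnit (1 + β * y i))
    {w : Fin (n + 1) → Fin N} (hw : StrictMono w) {J : Finset (Fin (n + 1))}
    (hJ : J ⊆ freeIdx w) :
    (movedMatrix β q t w y J).det = (if 0 ∈ J.map ⟨w, hw.injective⟩ then q else 1) *
      (wordWeight β t (wordOf (movePos w J)) *
        (diffProd y * betheVector β t y (wordOf (movePos w J)))) := by
  by_cases h0 : 0 ∈ J.map ⟨w, hw.injective⟩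
  · obtain ⟨j, hj, hj0⟩ := Finset.mem_map.1 h0
    replace hj0 : w j = 0 := hj0
    obtain rfl := index_eq_zero hw hj0
    have hw' := strictMono_movePos_comp_finRotate hw hJ hj hj0
    have h1 : wordOf (movePos w J) = wordOf (movePos w J ∘ finRotate (n + 1)) :=
      wordOf_congr fun p => ((finRotate (n + 1)).surjective.exists (p := fun i => movePos w J i = p))
    let κ := (-1) ^ n * q * Ring.inverse (∏ l, (1 + β * y l))
    -- After rotation all exponents are one too high, so each row releases 1 + β y_i. Their product
    -- cancels the inverse in `κ`, and the sign (-1)^n of the rotation cancels the sign of `κ`,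
    -- leaving q.
    have h2 : (movedMatrix β q t w y J).submatrix id (finRotate (n + 1)) = Matrix.of fun i j =>
        ((1 + β * t ((movePos w J ∘ finRotate (n + 1)) j)) * if j = Fin.last n then κ else 1) *
        (Matrix.of fun i j => (1 + β * y i) *
          particleMatrix β t (movePos w J ∘ finRotate (n + 1)) y i j) i j := by
      ext i j
      cases j using Fin.lastCases with
      | last =>
        simp only [Matrix.submatrix_apply, id, finRotate_last, movedMatrix, Matrix.of_apply,
          if_pos hj, particleMatrix, Function.comp_apply, movePos, movedColumn, if_pos hj0,
          oneParticle', Fin.val_last, κ, if_true]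
        ring
      | cast j =>
        have hne : w j.succ ≠ 0 := fun h => Fin.succ_ne_zero j (index_eq_zero hw h)
        have hl : j.castSucc ≠ Fin.last n := (Fin.castSucc_lt_last j).ne
        simp only [Matrix.submatrix_apply, id, finRotate_apply, Fin.coeSucc_eq_succ, movedMatrix,
          Matrix.of_apply, particleMatrix, Function.comp_apply, movePos, movedColumn, if_neg hne,
          oneParticle', Fin.val_succ, if_neg hl, Fin.val_castSucc]
        split_ifs <;> ring
    have h3 := Matrix.det_permute' (finRotate (n + 1)) (movedMatrix β q t w y J)
    rw [h2, Matrix.det_mul_row, Matrix.det_mul_column, sign_finRotate, Finset.prod_mul_distrib,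
      Finset.prod_ite_eq', if_pos (Finset.mem_univ _),
      ← diffProd_mul_betheVector β t ht y _ hw', ← wordWeight_wordOf β t hw'.injective] at h3
    have h4 := Ring.mul_inverse_cancel (∏ l, (1 + β * y l))
      (Finset.prod_induction _ IsUnit (fun _ _ => IsUnit.mul) isUnit_one fun l _ => hu l)
    have h5 : ((-1 : A) ^ n) * (-1) ^ n = 1 := by rw [← mul_pow]; simp
    rw [if_pos h0, h1]
    push_cast at h3
    simp only [κ] at h3
    generalize diffProd y * betheVector β t y _ = D at *
    generalize wordWeight β t _ = W at *
    generalize Ring.inverse (∏ l, (1 + β * y l)) = P' at *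
    generalize ∏ l, (1 + β * y l) = P at *
    generalize (-1 : A) ^ n = s at *
    linear_combination (-s) * h3 - (movedMatrix β q t w y J).det * h5 + W * q * D * (h5 * P * P' + h4)
  · have h0' (j) (hj : j ∈ J) : w j ≠ 0 := fun h => h0 (Finset.mem_map.2 ⟨j, hj, h⟩)
    have hw' : StrictMono (movePos w J) := fun i j hij => strictMono_movePos hw hJ hij (h0' i)
    have h2 : movedMatrix β q t w y J = Matrix.of fun i j =>
        (1 + β * t (movePos w J j)) * particleMatrix β t (movePos w J) y i j := by
      ext i j
      simp only [movedMatrix, particleMatrix, Matrix.of_apply, movePos, movedColumn, oneParticle']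
      split_ifs with h h'
      · exact absurd h' (h0' j h)
      · ring
      · ring
    rw [h2, Matrix.det_mul_row, if_neg h0, one_mul, wordWeight_wordOf β t hw'.injective,
      diffProd_mul_betheVector β t ht y _ hw']

/-- The Bethe vectors are eigenvectors of the operator with matrix elements
`moveCoeff β q b c * wordWeight β t c`. -/
theorem chevalley_wordOf {β q : A} {t : Fin N → A} (ht : ∀ j, IsUnit (1 + β * t j))
    {y : Fin n → A} (hu : ∀ i, IsUnit (1 + β * y i)) (hy : IsBetheSolution β q t y)
    (hd : IsUnit (diffProd y)) {w : Fin n → Fin N} (hw : StrictMono w) (hn0 : 0 < n) (hn : n < N) :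
    (∏ i, (1 + β * y i)) * betheVector β t y (wordOf w) =
      ∑ S ∈ (free (wordOf w)).powerset, moveWeight β q S *
        (wordWeight β t (move (wordOf w) S) * betheVector β t y (move (wordOf w) S)) := by
  obtain ⟨n, rfl⟩ := Nat.exists_eq_succ_of_ne_zero hn0.ne'
  refine hd.mul_left_cancel ?_
  rw [mul_left_comm, diffProd_mul_betheVector β t ht y w hw,
    prod_mul_det_particleMatrix ht hu hy hw hn, Finset.mul_sum]
  refine Finset.sum_bij (fun J _ => J.map ⟨w, hw.injective⟩) ?_ ?_ ?_ ?_
  · intro J hJ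
    rw [free_wordOf hw, Finset.mem_powerset, Finset.map_subset_map]
    exact Finset.mem_powerset.1 hJ
  · intro J _ J' _ h
    exact Finset.map_injective _ h
  · intro S hS
    rw [free_wordOf hw, Finset.mem_powerset, Finset.subset_map_iff] at hS
    obtain ⟨J, hJ, rfl⟩ := hS
    exact ⟨J, Finset.mem_powerset.2 hJ, rfl⟩
  · intro J hJ
    rw [Finset.mem_powerset] at hJ
    rw [det_movedMatrix ht hu hw hJ, move_wordOf hw hJ, moveWeight, Finset.card_map]
    ring

end Chevalley

/-! ### Dual Bethe vectors -/

section Mirror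

variable {A : Type*} [CommRing A] {N n : ℕ}

/-- A single L-operator equals its transpose in both spaces up to a diagonal gauge: 1 + β t_j in the
quantum space and 1 + β x in the auxiliary one. The auxiliary gauge telescopes along the product. -/
theorem mul_prod_lmat {β x : A} {t : Fin N → A} (ht : ∀ j, IsUnit (1 + β * t j))
    (c b : Fin N → Fin 2) (l : List (Fin N)) (r s : Fin 2) :
    (l.map fun j => if b j = 1 then 1 + β * t j else 1).prod * (1 + β * x) ^ (r : ℕ) *
        (l.map fun j => lmat β x (t j) (b j) (c j)).prod r s =
      (l.map fun j => if c j = 1 then 1 + β * t j else 1).prod * (1 + β * x) ^ (s : ℕ) *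
        (l.map fun j => (lmat β x (t j) (c j) (b j))ᵀ).prod r s := by
  induction l generalizing r s with
  | nil =>
    by_cases h : r = s
    · subst h; rfl
    · simp [h]
  | cons j l ih =>
    have hj (a : Fin 2) : (if b j = 1 then 1 + β * t j else 1) * (1 + β * x) ^ (r : ℕ) *
        lmat β x (t j) (b j) (c j) r a = (if c j = 1 then 1 + β * t j else 1) *
          (1 + β * x) ^ (a : ℕ) * lmat β x (t j) (c j) (b j) a r := by
      have h1 := Ring.mul_inverse_cancel _ (ht j)
      simp only [lmat_eq, one_add_mul_fsub (ht j)]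
      generalize b j = b', c j = c'
      fin_cases r <;> fin_cases a <;> fin_cases b' <;> fin_cases c' <;> simp <;>
        first | linear_combination (1 + β * x) * h1 | linear_combination -(1 + β * x) * h1
    simp only [List.map_cons, List.prod_cons, Matrix.mul_apply, Finset.mul_sum,
      Matrix.transpose_apply]
    refine Finset.sum_congr rfl fun a _ => ?_
    linear_combination ((l.map fun j => if b j = 1 then 1 + β * t j else 1).prod *
      (l.map fun j => lmat β x (t j) (b j) (c j)).prod a s) * hj a +
      ((if c j = 1 then 1 + β * t j else 1) * lmat β x (t j) (c j) (b j) a r) * ih a s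

/-- Transposition of the monodromy matrix reverses the order of the tensor factors. -/
theorem monodromy_rev {β x : A} {t : Fin N → A} (ht : ∀ j, IsUnit (1 + β * t j))
    (c b : Fin N → Fin 2) (r s : Fin 2) :
    wordWeight β t b * (1 + β * x) ^ (s : ℕ) *
        monodromy β (t ∘ Fin.rev) x s r (b ∘ Fin.rev) (c ∘ Fin.rev) =
      wordWeight β t c * (1 + β * x) ^ (r : ℕ) * monodromy β t x r s c b := by
  have h1 : (List.finRange N).reverse = (List.finRange N).map Fin.rev := List.finRange_reverse
  have h2 (b : Fin N → Fin 2) : wordWeight β t b =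
      ((List.finRange N).map fun j => if b j = 1 then 1 + β * t j else 1).prod := by
    rw [wordWeight, ← List.ofFn_eq_map, List.prod_ofFn]
  have h3 : monodromy β (t ∘ Fin.rev) x s r (b ∘ Fin.rev) (c ∘ Fin.rev) =
      ((List.finRange N).map fun j => lmat β x (t j) (b j) (c j)).prod s r := by
    rw [monodromy_apply, List.map_reverse]
    have : (List.finRange N).map (fun j => lmat β x ((t ∘ Fin.rev) j) ((b ∘ Fin.rev) j)
        ((c ∘ Fin.rev) j)) = ((List.finRange N).map fun j => lmat β x (t j) (b j) (c j)).reverse := by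
      rw [← List.map_reverse, h1, List.map_map]
      rfl
    rw [this, List.reverse_reverse]
  have h4 : monodromy β t x r s c b =
      ((List.finRange N).map fun j => (lmat β x (t j) (c j) (b j))ᵀ).prod s r := by
    rw [monodromy_apply]
    refine (Matrix.transpose_apply _ s r).symm.trans ?_
    rw [Matrix.transpose_list_prod, List.map_map, ← List.map_reverse, List.reverse_reverse]
    rfl
  rw [h2, h2, h3, h4, mul_prod_lmat ht]

/-- The dual Bethe vector, the row with index `v_0 ⊗ ⋯ ⊗ v_0` of `C(x_1) ⋯ C(x_n)`. -/
def betheCovector (β : A) (t : Fin N → A) (x : Fin n → A) : (Fin N → Fin 2) → A :=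
  (List.ofFn fun i => Cop β t (x i)).prod 0

theorem betheNorm_eq (β : A) (t : Fin N → A) (x y : Fin n → A) :
    betheNorm β t x y = ∑ b, betheCovector β t x b * betheVector β t y b := rfl

/-- By `monodromy_rev` each C is a transposed B on the reversed chain. Results on Bethe vectors thus
pass to the dual ones. -/
theorem prod_Cop_eq {β : A} {t : Fin N → A} (ht : ∀ j, IsUnit (1 + β * t j)) (x : Fin n → A)
    (c b : Fin N → Fin 2) :
    (∏ i, (1 + β * x i)) * wordWeight β t c * (List.ofFn fun i => Cop β t (x i)).prod c b =
      wordWeight β t b * (List.ofFn fun i => Bop β (t ∘ Fin.rev) (x i)).reverse.prod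
        (b ∘ Fin.rev) (c ∘ Fin.rev) := by
  induction n generalizing c with
  | zero =>
    have h : b ∘ Fin.rev = c ∘ Fin.rev ↔ b = c := Fin.rev_surjective.injective_comp_right.eq_iff
    simp only [List.ofFn_zero, List.prod_nil, List.reverse_nil, Matrix.one_apply, h,
      eq_comm (a := c)]
    split_ifs with hbc <;> simp [hbc]
  | succ n ih =>
    simp only [List.ofFn_succ, List.prod_cons, List.reverse_cons, List.prod_append,
      List.prod_nil, mul_one, Matrix.mul_apply, Finset.mul_sum, Fin.prod_univ_succ]
    refine Eq.trans ?_ (Equiv.sum_comp (Equiv.arrowCongr Fin.revPerm (Equiv.refl (Fin 2))) _)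
    refine Finset.sum_congr rfl fun d _ => ?_
    have h1 := monodromy_rev (x := x 0) ht c d 1 0
    simp only [Fin.val_zero, pow_zero, mul_one, Fin.val_one, pow_one] at h1
    have h2 := ih (fun i => x i.succ) d
    have h3 : (Equiv.arrowCongr Fin.revPerm (Equiv.refl (Fin 2))) d = d ∘ Fin.rev := rfl
    rw [h3, Cop, Bop]
    linear_combination (-(∏ i : Fin n, (1 + β * x i.succ)) *
      (List.ofFn fun i => Cop β t (x i.succ)).prod d b) * h1 +
      monodromy β (t ∘ Fin.rev) (x 0) 0 1 (d ∘ Fin.rev) (c ∘ Fin.rev) * h2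

theorem wordWeight_zero (β : A) (t : Fin N → A) : wordWeight β t 0 = 1 := by
  simp [wordWeight]

theorem betheCovector_eq {β : A} {t : Fin N → A} (ht : ∀ j, IsUnit (1 + β * t j))
    (x : Fin n → A) (b : Fin N → Fin 2) :
    (∏ i, (1 + β * x i)) * betheCovector β t x b =
      wordWeight β t b * betheVector β (t ∘ Fin.rev) x (b ∘ Fin.rev) := by
  have h := prod_Cop_eq ht x 0 b
  rw [wordWeight_zero, mul_one] at h
  refine h.trans ?_
  rw [betheVector, Matrix.mulVec_single_one]
  rfl

theorem ones_comp_rev (b : Fin N → Fin 2) : ones (b ∘ Fin.rev) = ones b :=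
  Equiv.sum_comp Fin.revPerm fun j => (b j : ℕ)

theorem betheCovector_eq_zero {β : A} {t : Fin N → A} (ht : ∀ j, IsUnit (1 + β * t j))
    {x : Fin n → A} (hx : ∀ i, IsUnit (1 + β * x i)) (b : Fin N → Fin 2) (h : ones b ≠ n) :
    betheCovector β t x b = 0 := by
  have hu : IsUnit (∏ i, (1 + β * x i)) :=
    Finset.prod_induction _ IsUnit (fun _ _ => IsUnit.mul) isUnit_one fun l _ => hx l
  refine hu.mul_left_cancel ?_
  rw [betheCovector_eq ht, betheVector_eq_zero β (t ∘ Fin.rev) (fun j => ht _) _ _ (by rwa [ones_comp_rev]),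
    mul_zero, mul_zero]

/-- The binary string `1 ⋯ 1 0 ⋯ 0` with `n` letters `1`. -/
def firstWord (N n : ℕ) : Fin N → Fin 2 := fun j => if (j : ℕ) < n then 1 else 0

theorem slice_single (a a' : Fin 2) (w : Fin N → Fin 2) :
    slice a (Pi.single (Fin.cons a' w) 1 : (Fin (N + 1) → Fin 2) → A) =
      if a = a' then Pi.single w 1 else 0 := by
  funext w'
  split_ifs with h
  · subst h
    simp only [slice, Pi.single_apply]
    congr 1
    rw [Fin.cons_inj]
    simp
  · simp only [slice, Pi.single_apply, Pi.zero_apply]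
    rw [if_neg fun h' => h ((Fin.cons_inj.1 h').1)]

theorem firstWord_succ (N n : ℕ) :
    firstWord (N + 1) (n + 1) = Fin.cons 1 (firstWord N n) := by
  funext j
  refine Fin.cases ?_ (fun j => ?_) j <;> simp [firstWord]

theorem firstWord_zero (N : ℕ) : firstWord N 0 = 0 := by
  funext j
  simp [firstWord]

theorem Cop_vacuum (β : A) (t : Fin N → A) (x : A) :
    Cop β t x *ᵥ Pi.single 0 1 = 0 := by
  induction N with
  | zero => rw [Cop, monodromy_zero, Matrix.one_apply_ne (by simp), Matrix.zero_mulVec]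
  | succ N ih =>
    refine slice_ext ?_ ?_
    · rw [Cop, slice_col_zero_zero, slice_zero_vacuum, slice_one_vacuum, Matrix.mulVec_zero,
        add_zero]
      exact (congrArg (fsub β x (t 0) • ·) (ih _)).trans (smul_zero _)
    · rw [Cop, slice_col_zero_one, slice_one_vacuum, Matrix.mulVec_zero]
      rfl

theorem monodromy_one_one_vacuum (β : A) (t : Fin N → A) (x : A) :
    monodromy β t x 1 1 *ᵥ Pi.single 0 1 = Pi.single 0 1 := by
  induction N with
  | zero => rw [monodromy_zero, Matrix.one_apply_eq, Matrix.one_mulVec]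
  | succ N ih =>
    refine slice_ext ?_ ?_
    · rw [slice_col_one_zero, slice_zero_vacuum, ih]
    · rw [slice_col_one_one, slice_zero_vacuum, slice_one_vacuum]
      exact (congrArg ((1 + β * fsub β x (t 0)) • ·) (Cop_vacuum _ _ _)).trans (smul_zero _)

theorem monodromy_col_one_firstWord (β : A) (t : Fin N → A) (x : A) (h : n + 1 ≤ N)
    (r : Fin 2) : monodromy β t x r 1 *ᵥ Pi.single (firstWord N (n + 1)) 1 = 0 := by
  cases N with
  | zero => omega
  | succ N =>
    rw [firstWord_succ]
    refine slice_ext ?_ ?_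
    · rw [slice_col_one_zero, slice_single, if_neg (by simp), Matrix.mulVec_zero]; rfl
    · rw [slice_col_one_one, slice_single, if_neg (by simp), Matrix.mulVec_zero, smul_zero]; rfl

/-- Column 1 annihilates strings with leading 1, so C passes over the leading letters 1 and removes
the last of them with coefficient 1. -/
theorem Cop_mulVec_firstWord (β : A) (t : Fin N → A) (x : A) (h : n + 1 ≤ N) :
    Cop β t x *ᵥ Pi.single (firstWord N (n + 1)) 1 = Pi.single (firstWord N n) 1 := by
  induction N generalizing n with
  | zero => omega
  | succ N ih =>
    rw [firstWord_succ]
    refine slice_ext ?_ ?_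
    · rw [Cop, slice_col_zero_zero, slice_single, if_neg (by simp), Matrix.mulVec_zero, smul_zero,
        zero_add, slice_single, if_pos rfl]
      cases n with
      | zero => rw [firstWord_zero, firstWord_zero, monodromy_one_one_vacuum, slice_zero_vacuum]
      | succ n =>
        rw [monodromy_col_one_firstWord _ _ _ (by omega), firstWord_succ, slice_single,
          if_neg (by simp)]
    · rw [Cop, slice_col_zero_one, slice_single, if_pos rfl]
      cases n with
      | zero =>
        rw [firstWord_zero, firstWord_zero, slice_one_vacuum]
        exact Cop_vacuum _ _ _
      | succ n =>
        rw [firstWord_succ N n, slice_single, if_pos rfl]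
        exact ih _ (by omega)

theorem prod_Cop_mulVec_firstWord (β : A) (t : Fin N → A) (m : ℕ) (x : Fin n → A)
    (h : m + n ≤ N) :
    (List.ofFn fun i => Cop β t (x i)).prod *ᵥ Pi.single (firstWord N (m + n)) 1 =
      Pi.single (firstWord N m) 1 := by
  induction n generalizing m with
  | zero => rw [List.ofFn_zero, List.prod_nil, Matrix.one_mulVec, add_zero]
  | succ n ih =>
    have h1 := ih (m + 1) (fun i => x i.succ) (by omega)
    rw [List.ofFn_succ, List.prod_cons, ← Matrix.mulVec_mulVec, show m + (n + 1) = m + 1 + n by omega,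
      h1, Cop_mulVec_firstWord _ _ _ (by omega)]

/-- The value is independent of x. For this reason all coordinates of `v_∅` are 1 and it is the
unit. -/
theorem betheCovector_firstWord (β : A) (t : Fin N → A) (x : Fin n → A) (h : n ≤ N) :
    betheCovector β t x (firstWord N n) = 1 := by
  have h1 := congrFun (prod_Cop_mulVec_firstWord β t 0 x (by omega)) 0
  rw [zero_add, firstWord_zero, Matrix.mulVec_single_one, Pi.single_eq_same] at h1
  exact h1

end Mirror

/-! ### Symmetries of the coefficients of the Chevalley operator -/

section Symmetry

variable {A : Type*} [CommRing A] {N n : ℕ} [NeZero N]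

/-- A symmetric form of the relation `move b S = c`. -/
def IsMove (S : Finset (Fin N)) (b c : Fin N → Fin 2) : Prop :=
  (∀ p ∈ S, b p = 1 ∧ b (p - 1) = 0 ∧ c p = 0 ∧ c (p - 1) = 1) ∧
    ∀ p, p ∉ S → p + 1 ∉ S → c p = b p

theorem isMove_iff {S : Finset (Fin N)} {b c : Fin N → Fin 2} :
    IsMove S b c ↔ S ⊆ free b ∧ move b S = c := by
  constructor
  · rintro ⟨h1, h2⟩
    refine ⟨fun p hp => ?_, funext fun p => ?_⟩
    · simp [free, h1 p hp]
    · unfold move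
      split_ifs with hp hp'
      · exact (h1 p hp).2.2.1.symm
      · simpa using (h1 _ hp').2.2.2.symm
      · exact (h2 p hp hp').symm
  · rintro ⟨h1, rfl⟩
    have h2 (p) (hp : p ∈ S) : b p = 1 ∧ b (p - 1) = 0 := by simpa [free] using h1 hp
    refine ⟨fun p hp => ⟨(h2 p hp).1, (h2 p hp).2, by simp [move, hp], ?_⟩, fun p hp hp' => by
      simp [move, hp, hp']⟩
    have h3 : p - 1 ∉ S := fun h => by
      have := (h2 _ h).1
      rw [(h2 p hp).2] at this
      exact absurd this (by simp)
    simp [move, h3, hp]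

open Classical in
theorem moveCoeff_eq (β q : A) (b c : Fin N → Fin 2) :
    moveCoeff β q b c = ∑ S : Finset (Fin N), if IsMove S b c then moveWeight β q S else 0 := by
  rw [moveCoeff, ← Finset.sum_subset (Finset.subset_univ (free b).powerset)]
  · refine Finset.sum_congr rfl fun S hS => ?_
    simp only [isMove_iff, Finset.mem_powerset.1 hS, true_and]
  · intro S _ hS
    rw [if_neg]
    rw [isMove_iff]
    exact fun h => hS (Finset.mem_powerset.2 h.1)

theorem rev_neg (p : Fin N) : Fin.rev (-p) = p - 1 := by
  obtain ⟨N, rfl⟩ := Nat.exists_eq_succ_of_ne_zero (NeZero.ne N)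
  have h := Fin.rev_sub 0 p
  rw [zero_sub, Fin.rev_zero] at h
  rw [h, eq_sub_iff_add_eq, add_right_comm, Fin.last_add_one, zero_add]

theorem rev_neg_sub_one (p : Fin N) : Fin.rev (-p - 1) = p := by
  rw [← rev_neg, neg_neg, Fin.rev_rev]

/-- A move is labelled by the right end p of the bond (p - 1, p), which reversal sends to (-p - 1,
-p). Hence S becomes -S, keeping its size and the membership of 0. -/
theorem moveCoeff_neg (β q : A) {b c b' c' : Fin N → Fin 2}
    (h : ∀ S, IsMove (S.map (Equiv.neg (Fin N)).toEmbedding) b' c' ↔ IsMove S b c) :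
    moveCoeff β q b' c' = moveCoeff β q b c := by
  classical
  rw [moveCoeff_eq, moveCoeff_eq, ← Equiv.sum_comp (Equiv.neg (Fin N)).finsetCongr]
  refine Finset.sum_congr rfl fun S _ => ?_
  simp only [Equiv.finsetCongr_apply, h, moveWeight, Finset.card_map]
  congr 3
  simp

theorem rev_eq (p : Fin N) : Fin.rev p = -p - 1 := by
  rw [← rev_neg, neg_neg]

/-- Reversal turns left moves into right moves, which are left moves with source and target
exchanged. -/
theorem IsMove.rev {S : Finset (Fin N)} {b c : Fin N → Fin 2} (h : IsMove S b c) :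
    IsMove (S.map (Equiv.neg (Fin N)).toEmbedding) (c ∘ Fin.rev) (b ∘ Fin.rev) := by
  refine ⟨fun p hp => ?_, fun p hp hp' => ?_⟩
  · obtain ⟨s, hs, rfl⟩ := Finset.mem_map.1 hp
    obtain ⟨h1, h2, h3, h4⟩ := h.1 s hs
    simp [rev_neg, rev_neg_sub_one, h1, h2, h3, h4]
  · simp only [Function.comp_apply, rev_eq]
    refine (h.2 _ (fun h' => hp' ?_) fun h' => hp ?_).symm
    · exact Finset.mem_map.2 ⟨_, h', by simp [Equiv.neg_apply, add_comm]⟩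
    · exact Finset.mem_map.2 ⟨_, h', by simp [Equiv.neg_apply]⟩

/-- The reversed complement of a binary string. -/
def dualWord {N : ℕ} (b : Fin N → Fin 2) : Fin N → Fin 2 := fun j => 1 - b j.rev

theorem dualWord_dualWord {N : ℕ} (b : Fin N → Fin 2) : dualWord (dualWord b) = b := by
  funext j
  simp [dualWord]

/-- A 1 moving left is a 0 moving right. Complementing and reversing together give a left move
again, with source and target kept. -/
theorem IsMove.dual {S : Finset (Fin N)} {b c : Fin N → Fin 2} (h : IsMove S b c) :
    IsMove (S.map (Equiv.neg (Fin N)).toEmbedding) (dualWord b) (dualWord c) := by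
  refine ⟨fun p hp => ?_, fun p hp hp' => ?_⟩
  · obtain ⟨s, hs, rfl⟩ := Finset.mem_map.1 hp
    obtain ⟨h1, h2, h3, h4⟩ := h.1 s hs
    simp [dualWord, rev_neg, rev_neg_sub_one, h1, h2, h3, h4]
  · simp only [dualWord, rev_eq]
    refine congrArg _ (h.2 _ (fun h' => hp' ?_) fun h' => hp ?_)
    · exact Finset.mem_map.2 ⟨_, h', by simp [Equiv.neg_apply, add_comm]⟩
    · exact Finset.mem_map.2 ⟨_, h', by simp [Equiv.neg_apply]⟩

theorem map_neg_map_neg {N : ℕ} [NeZero N] (S : Finset (Fin N)) :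
    (S.map (Equiv.neg (Fin N)).toEmbedding).map (Equiv.neg (Fin N)).toEmbedding = S := by
  ext p
  simp

theorem moveCoeff_rev (β q : A) (b c : Fin N → Fin 2) :
    moveCoeff β q (c ∘ Fin.rev) (b ∘ Fin.rev) = moveCoeff β q b c := by
  refine moveCoeff_neg β q fun S => ⟨fun h => ?_, IsMove.rev⟩
  have h' := h.rev
  rw [map_neg_map_neg] at h'
  simpa [Function.comp_def] using h'

theorem moveCoeff_dualWord (β q : A) (b c : Fin N → Fin 2) :
    moveCoeff β q (dualWord b) (dualWord c) = moveCoeff β q b c := by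
  refine moveCoeff_neg β q fun S => ⟨fun h => ?_, IsMove.dual⟩
  have h' := h.dual
  rwa [map_neg_map_neg, dualWord_dualWord, dualWord_dualWord] at h'

end Symmetry

/-! ### Eigenvector equations -/

section Eigen

variable {A : Type*} [CommRing A] {N n : ℕ}

theorem exists_strictMono_wordOf (b : Fin N → Fin 2) (hb : ones b = n) :
    ∃ w : Fin n → Fin N, StrictMono w ∧ wordOf w = b := by
  classical
  let s : Finset (Fin N) := Finset.univ.filter fun j => b j = 1
  have hs : s.card = n := by
    rw [← hb, Finset.card_filter, ones]
    refine Finset.sum_congr rfl fun j _ => ?_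
    generalize b j = a
    fin_cases a <;> simp
  refine ⟨s.orderEmbOfFin hs, (s.orderEmbOfFin hs).strictMono, funext fun j => ?_⟩
  have h : (∃ i, s.orderEmbOfFin hs i = j) ↔ b j = 1 := by
    have h1 := Set.ext_iff.1 (Finset.range_orderEmbOfFin s hs) j
    rw [Set.mem_range] at h1
    rw [h1, Finset.mem_coe, Finset.mem_filter]
    simp
  simp only [wordOf, h]
  generalize b j = a
  fin_cases a <;> simp

theorem ones_wordOf {w : Fin n → Fin N} (hw : Function.Injective w) : ones (wordOf w) = n := by
  classical
  have h (j : Fin N) : ((wordOf w j : Fin 2) : ℕ) = if j ∈ Finset.univ.image w then 1 else 0 := by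
    unfold wordOf
    simp only [Finset.mem_image, Finset.mem_univ, true_and]
    split_ifs <;> rfl
  simp only [ones, h]
  rw [Finset.sum_ite_mem, Finset.univ_inter, Finset.sum_const, Finset.card_image_of_injective _ hw]
  simp

variable [NeZero N] {β q : A} {t : Fin N → A}

theorem sum_moveCoeff_mul (b : Fin N → Fin 2) (f : (Fin N → Fin 2) → A) :
    ∑ c, moveCoeff β q b c * f c =
      ∑ S ∈ (free b).powerset, moveWeight β q S * f (move b S) := by
  simp only [moveCoeff, Finset.sum_mul]
  rw [Finset.sum_comm]
  refine Finset.sum_congr rfl fun S _ => ?_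
  simp [ite_mul]

/-- The Bethe vectors are right eigenvectors. -/
theorem sum_moveCoeff_mul_betheVector (ht : ∀ j, IsUnit (1 + β * t j)) {y : Fin n → A}
    (hu : ∀ i, IsUnit (1 + β * y i)) (hy : IsBetheSolution β q t y) (hd : IsUnit (diffProd y))
    (hn0 : 0 < n) (hn : n < N) (b : Fin N → Fin 2) (hb : ones b = n) :
    ∑ c, moveCoeff β q b c * (wordWeight β t c * betheVector β t y c) =
      (∏ i, (1 + β * y i)) * betheVector β t y b := by
  obtain ⟨w, hw, rfl⟩ := exists_strictMono_wordOf b hb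
  rw [sum_moveCoeff_mul, chevalley_wordOf ht hu hy hd hw hn0 hn]

theorem wordWeight_comp_rev {N : ℕ} (β : A) (t : Fin N → A) (b : Fin N → Fin 2) :
    wordWeight β (t ∘ Fin.rev) (b ∘ Fin.rev) = wordWeight β t b :=
  Equiv.prod_comp Fin.revPerm fun j => if b j = 1 then 1 + β * t j else 1

theorem IsBetheSolution.comp_rev {N : ℕ} {t : Fin N → A} {y : Fin n → A}
    (hy : IsBetheSolution β q t y) : IsBetheSolution β q (t ∘ Fin.rev) y := by
  intro i
  rw [← hy i]
  congr 2
  exact Equiv.prod_comp Fin.revPerm fun j => fsub β (y i) (t j)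

/-- The dual Bethe vectors are left eigenvectors. -/
theorem sum_betheCovector_mul_moveCoeff (ht : ∀ j, IsUnit (1 + β * t j)) {y : Fin n → A}
    (hu : ∀ i, IsUnit (1 + β * y i)) (hy : IsBetheSolution β q t y) (hd : IsUnit (diffProd y))
    (hn0 : 0 < n) (hn : n < N) (b : Fin N → Fin 2) (hb : ones b = n) :
    ∑ c, betheCovector β t y c * (moveCoeff β q c b * wordWeight β t b) =
      (∏ i, (1 + β * y i)) * betheCovector β t y b := by
  have hP : IsUnit (∏ i, (1 + β * y i)) :=
    Finset.prod_induction _ IsUnit (fun _ _ => IsUnit.mul) isUnit_one fun l _ => hu l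
  have h := sum_moveCoeff_mul_betheVector (t := t ∘ Fin.rev) (fun j => ht _) hu hy.comp_rev hd
    hn0 hn (b ∘ Fin.rev) (by rwa [ones_comp_rev])
  refine hP.mul_left_cancel ?_
  rw [betheCovector_eq ht, mul_left_comm, ← h, Finset.mul_sum, Finset.mul_sum]
  refine Eq.trans ?_ (Equiv.sum_comp (Equiv.arrowCongr Fin.revPerm (Equiv.refl (Fin 2))) _)
  refine Finset.sum_congr rfl fun c _ => ?_
  have h1 : (Equiv.arrowCongr Fin.revPerm (Equiv.refl (Fin 2))) c = c ∘ Fin.rev := rfl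
  rw [h1, moveCoeff_rev, wordWeight_comp_rev, ← betheCovector_eq ht]
  ring

/-- A dual Bethe vector is orthogonal to all right eigenvectors with a different eigenvalue. -/
theorem sub_mul_sum_betheCovector_mul (ht : ∀ j, IsUnit (1 + β * t j)) {y : Fin n → A}
    (hu : ∀ i, IsUnit (1 + β * y i)) (hy : IsBetheSolution β q t y) (hd : IsUnit (diffProd y))
    (hn0 : 0 < n) (hn : n < N) (U : (Fin N → Fin 2) → A) (hU : ∀ b, ones b ≠ n → U b = 0)
    (χ : A) (hχ : ∀ b, ones b = n →
      ∑ c, moveCoeff β q b c * (wordWeight β t c * U c) = χ * U b) :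
    (χ - ∏ i, (1 + β * y i)) * ∑ b, betheCovector β t y b * U b = 0 := by
  have h1 (b) : betheCovector β t y b * (χ * U b) =
      ∑ c, betheCovector β t y b * (moveCoeff β q b c * wordWeight β t c) * U c := by
    by_cases hb : ones b = n
    · rw [← hχ b hb, Finset.mul_sum]
      exact Finset.sum_congr rfl fun c _ => by ring
    · rw [betheCovector_eq_zero ht hu b hb]
      simp
  have h2 (c) : ∑ b, betheCovector β t y b * (moveCoeff β q b c * wordWeight β t c) * U c =
      (∏ i, (1 + β * y i)) * betheCovector β t y c * U c := by
    rw [← Finset.sum_mul]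
    by_cases hc : ones c = n
    · rw [sum_betheCovector_mul_moveCoeff ht hu hy hd hn0 hn c hc]
    · rw [hU c hc, mul_zero, mul_zero]
  have h3 : χ * ∑ b, betheCovector β t y b * U b =
      (∏ i, (1 + β * y i)) * ∑ b, betheCovector β t y b * U b := by
    rw [Finset.mul_sum, Finset.mul_sum]
    rw [Finset.sum_congr rfl fun b _ => (mul_left_comm χ _ _).trans (h1 b), Finset.sum_comm]
    exact Finset.sum_congr rfl fun c _ => (h2 c).trans (mul_assoc _ _ _)
  rw [sub_mul, h3, sub_self]

end Eigen

/-! ### The substitution `t_i ↦ ⊖ t_{N+1-i}` -/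

section Substitution

variable {N : ℕ}

theorem lr₀_algebraMap (p : MvPolynomial (Fin N) (Polynomial ℤ)) :
    lr₀ N (algebraMap _ (RT N) p) = lrPoly N p := IsLocalization.lift_eq _ p

theorem lr₀_C (r : Polynomial ℤ) :
    lr₀ N (algebraMap (MvPolynomial (Fin N) (Polynomial ℤ)) (RT N) (MvPolynomial.C r)) =
      algebraMap (MvPolynomial (Fin N) (Polynomial ℤ)) (RT N) (MvPolynomial.C r) := by
  rw [lr₀_algebraMap, lrPoly, MvPolynomial.coe_eval₂Hom, MvPolynomial.eval₂_C,
    RingHom.comp_apply]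

theorem lr₀_beta₀ : lr₀ N (beta₀ N) = beta₀ N := lr₀_C _

theorem lr₀_t₀ (j : Fin N) : lr₀ N (t₀ j) = fsub (beta₀ N) 0 (t₀ j.rev) := by
  rw [t₀, lr₀_algebraMap, lrPoly, MvPolynomial.coe_eval₂Hom, MvPolynomial.eval₂_X]

theorem map_fsub {A B : Type*} [CommRing A] [CommRing B] (f : A →+* B) {β s : A}
    (hs : IsUnit (1 + β * s)) (x : A) : f (fsub β x s) = fsub (f β) (f x) (f s) := by
  have h1 := congrArg f (Ring.mul_inverse_cancel _ hs)
  have h2 := Ring.mul_inverse_cancel _ (hs.map f)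
  simp only [map_mul, map_add, map_one] at h1 h2
  simp only [fsub, map_mul, map_sub]
  linear_combination ((f x - f s) * Ring.inverse (1 + f β * f s)) * h1 -
    ((f x - f s) * f (Ring.inverse (1 + β * s))) * h2

theorem one_add_mul_fsub_zero {A : Type*} [CommRing A] {β s : A} (hs : IsUnit (1 + β * s)) :
    (1 + β * fsub β 0 s) * (1 + β * s) = 1 := by
  have h := Ring.mul_inverse_cancel _ hs
  rw [fsub]
  linear_combination (-β * s) * h

theorem fsub_zero_fsub_zero {A : Type*} [CommRing A] {β s : A} (hs : IsUnit (1 + β * s)) :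
    fsub β 0 (fsub β 0 s) = s := by
  have h := one_add_mul_fsub_zero hs
  have h1 : Ring.inverse (1 + β * fsub β 0 s) = 1 + β * s :=
    (Ring.inverse_of_isUnit (IsUnit.of_mul_eq_one _ h)).trans
      (Units.inv_eq_of_mul_eq_one_right h)
  rw [fsub, h1, fsub]
  linear_combination s * Ring.mul_inverse_cancel _ hs

theorem lr₀_one_add (j : Fin N) :
    lr₀ N (1 + beta₀ N * t₀ j) * (1 + beta₀ N * t₀ j.rev) = 1 := by
  have h : lr₀ N (1 + beta₀ N * t₀ j) = 1 + beta₀ N * fsub (beta₀ N) 0 (t₀ j.rev) := by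
    rw [map_add, map_one, map_mul, lr₀_beta₀, lr₀_t₀]
  rw [h]
  exact one_add_mul_fsub_zero (A := RT N) (β := beta₀ N) (s := t₀ j.rev) (isUnit_one_add j.rev)

theorem lr₀_lr₀ (a : RT N) : lr₀ N (lr₀ N a) = a := by
  have h : (lr₀ N).comp (lr₀ N) = RingHom.id (RT N) := by
    refine IsLocalization.ringHom_ext (reg N) (MvPolynomial.ringHom_ext (fun r => ?_) fun i => ?_)
    · simp only [RingHom.comp_apply, lr₀_C, RingHom.id_apply]
    · change lr₀ N (lr₀ N (t₀ i)) = t₀ i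
      have h1 := map_fsub (A := RT N) (B := RT N) (lr₀ N) (β := beta₀ N) (s := t₀ i.rev)
        (isUnit_one_add i.rev) 0
      rw [lr₀_t₀, h1, lr₀_beta₀, lr₀_t₀, map_zero, Fin.rev_rev]
      exact fsub_zero_fsub_zero (A := RT N) (β := beta₀ N) (s := t₀ i) (isUnit_one_add i)
  exact congrArg (fun f => f a) (congrArg DFunLike.coe h)

theorem lr_lr (f : RTq N) : lr N (lr N f) = f := by
  ext m
  simp [lr, lr₀_lr₀]

theorem lr_C (a : RT N) : lr N (PowerSeries.C a) = PowerSeries.C (lr₀ N a) := by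
  simp [lr]

theorem lr_β : lr N (β N) = β N := by
  rw [β, lr_C, lr₀_beta₀]

theorem lr_q : lr N (q N) = q N := by
  simp [lr, q]

theorem lr_one_add (j : Fin N) : lr N (1 + β N * t j) * (1 + β N * t j.rev) = 1 := by
  have h := congrArg PowerSeries.C (lr₀_one_add j)
  rw [map_mul, ← lr_C] at h
  simpa [β, t] using h

theorem lr₀_constRT (c : R) : lr₀ N (constRT N c) = constRT N c := by
  have h : (lr₀ N).comp (constRT N) = constRT N := by
    refine IsLocalization.ringHom_ext regConst (RingHom.ext fun r => ?_)
    simp only [RingHom.comp_apply, constRT, IsLocalization.map_eq, lr₀_C]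
  exact congrArg (fun f => f c) (congrArg DFunLike.coe h)

theorem lr_constRTq (c : PowerSeries R) : lr N (constRTq N c) = constRTq N c := by
  ext m
  simp [lr, constRTq, lr₀_constRT]

theorem reg_le_nonZeroDivisors (N : ℕ) :
    reg N ≤ nonZeroDivisors (MvPolynomial (Fin N) (Polynomial ℤ)) := by
  rintro p ⟨hp, -⟩
  rw [mem_nonZeroDivisors_iff_ne_zero]
  rintro rfl
  simp at hp

theorem algebraMap_RT_injective :
    Function.Injective (algebraMap (MvPolynomial (Fin N) (Polynomial ℤ)) (RT N)) :=
  IsLocalization.injective (RT N) (reg_le_nonZeroDivisors N)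

/-- A letter 1 at j turns into the inverse of 1 + β t at the reversed site and cancels that factor
of the full product; the factors left over sit at the reversed zeros. -/
theorem wordWeight_dualWord {A : Type*} [CommRing A] (f : A →+* A) {β : A} {t : Fin N → A}
    (hf : ∀ j, f (1 + β * t j) * (1 + β * t j.rev) = 1) (c : Fin N → Fin 2) :
    (∏ j, (1 + β * t j)) * f (wordWeight β t c) = wordWeight β t (dualWord c) := by
  have h1 : wordWeight β t (dualWord c) =
      ∏ j : Fin N, if dualWord c j.rev = 1 then 1 + β * t j.rev else 1 :=
    (Equiv.prod_comp Fin.revPerm fun j => if dualWord c j = 1 then 1 + β * t j else 1).symm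
  rw [h1, ← Equiv.prod_comp Fin.revPerm fun j => 1 + β * t j, wordWeight, map_prod,
    ← Finset.prod_mul_distrib]
  refine Finset.prod_congr rfl fun j _ => ?_
  simp only [Fin.revPerm_apply, dualWord, Fin.rev_rev]
  generalize c j = a
  fin_cases a
  · simp
  · simpa [mul_comm] using hf j

/-- Setting t_j = 1 and all other parameters to 0 detects the letter at j. -/
theorem wordWeight_injective : Function.Injective (wordWeight (beta₀ N) t₀) := by
  intro b b' h
  let p (b : Fin N → Fin 2) : MvPolynomial (Fin N) (Polynomial ℤ) :=
    ∏ j, if b j = 1 then 1 + MvPolynomial.C Polynomial.X * MvPolynomial.X j else 1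
  have hp (b) : wordWeight (beta₀ N) t₀ b = algebraMap _ (RT N) (p b) := by
    rw [wordWeight, map_prod]
    refine Finset.prod_congr rfl fun j _ => ?_
    split_ifs <;> simp [beta₀, t₀]
  rw [hp, hp] at h
  funext j
  have h1 := congrArg (MvPolynomial.eval fun l => if l = j then (1 : Polynomial ℤ) else 0)
    (algebraMap_RT_injective h)
  have h2 (b : Fin N → Fin 2) : MvPolynomial.eval (fun l => if l = j then (1 : Polynomial ℤ) else 0)
      (p b) = if b j = 1 then 1 + Polynomial.X else 1 := by
    rw [map_prod, Finset.prod_eq_single j]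
    · split_ifs <;> simp
    · intro l _ hl
      split_ifs <;> simp [hl]
    · simp
  rw [h2, h2] at h1
  have h3 : (1 + Polynomial.X : Polynomial ℤ) ≠ 1 := by simp
  generalize b j = a, b' j = a' at *
  fin_cases a <;> fin_cases a' <;> simp at h1 ⊢

/-- Only β and q occur in these coefficients; all dependence on t is in the weights. -/
theorem lr_moveCoeff [NeZero N] (b c : Fin N → Fin 2) :
    lr N (moveCoeff (β N) (q N) b c) = moveCoeff (β N) (q N) b c := by
  rw [moveCoeff, map_sum]
  refine Finset.sum_congr rfl fun S _ => ?_
  split_ifs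
  · rw [moveWeight, map_mul, map_pow, lr_β]
    split_ifs <;> simp [lr_q]
  · simp

end Substitution

/-! ### Binary strings of boxed partitions -/

theorem ones_dualWord {N : ℕ} (b : Fin N → Fin 2) : ones (dualWord b) + ones b = N := by
  rw [← ones_comp_rev b, ones, ones, ← Finset.sum_add_distrib]
  have h2 (p : Fin N) : ((dualWord b p : Fin 2) : ℕ) + ((b ∘ Fin.rev) p : Fin 2) = 1 := by
    simp only [dualWord, Function.comp_apply]
    generalize b p.rev = a
    fin_cases a <;> simp
  simp only [h2]
  simp

namespace BoxedPartition

variable {N n k : ℕ}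

theorem pos_strictMono (h : n + k = N) (l : BoxedPartition n k) : StrictMono (l.pos h) := by
  intro i j hij
  have h1 : l.1 i.rev ≤ l.1 j.rev := l.2 (Fin.rev_le_rev.2 hij.le)
  simp only [pos, Fin.lt_def, Fin.le_def] at *
  omega

theorem word_eq (h : n + k = N) (l : BoxedPartition n k) : l.word h = wordOf (l.pos h) := rfl

theorem ones_word (h : n + k = N) (l : BoxedPartition n k) : ones (l.word h) = n :=
  ones_wordOf (l.pos_strictMono h).injective

theorem exists_word_eq (h : n + k = N) (b : Fin N → Fin 2) (hb : ones b = n) :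
    ∃ l : BoxedPartition n k, l.word h = b := by
  obtain ⟨w, hw, rfl⟩ := exists_strictMono_wordOf b hb
  -- Strictly increasing integers grow at least as fast as their index. Hence w_i - i is weakly
  -- increasing with values between 0 and k, and read backwards it is the partition.
  have h1 (d : ℕ) : ∀ i j : Fin n, (j : ℕ) = i + d → (w i : ℕ) + d ≤ w j := by
    induction d with
    | zero => intro i j hij; rw [Fin.ext (show (i : ℕ) = j by omega)]; simp
    | succ d ih =>
      intro i j hij
      have h2 := ih i ⟨i + d, by omega⟩ rfl
      have h3 : w ⟨i + d, by omega⟩ < w j := hw (by rw [Fin.lt_def]; simp; omega)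
      rw [Fin.lt_def] at h3
      omega
  have h2 (i j : Fin n) (hij : i ≤ j) : (w i : ℕ) + (j - i) ≤ w j :=
    h1 _ i j (by rw [Fin.le_def] at hij; omega)
  have h3 (i : Fin n) : (i : ℕ) ≤ w i ∧ (w i : ℕ) - i ≤ k := by
    have hi := i.2
    have h4 := h2 ⟨0, by omega⟩ i (by simp [Fin.le_def])
    have h5 := h2 i ⟨n - 1, by omega⟩ (by simp [Fin.le_def]; omega)
    simp only at h4 h5
    have := (w ⟨n - 1, by omega⟩).2
    omega
  refine ⟨⟨fun i => ⟨w i.rev - i.rev, by have := h3 i.rev; omega⟩, fun i j hij => ?_⟩, ?_⟩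
  · have h4 := h2 _ _ (Fin.rev_le_rev.2 hij)
    have h5 := (h3 i.rev).1
    have h6 := (h3 j.rev).1
    rw [Fin.le_def]
    have h7 : (j.rev : ℕ) ≤ i.rev := Fin.rev_le_rev.2 hij
    simp only
    omega
  · rw [word_eq]
    congr 1
    funext i
    refine Fin.ext ?_
    have := (h3 i).1
    simp only [pos, Fin.rev_rev]
    omega

theorem pos_injective (h : n + k = N) : Function.Injective (pos (n := n) (k := k) h) := by
  intro l m hlm
  refine Subtype.ext (funext fun i => Fin.ext ?_)
  have h1 := congrArg Fin.val (congrFun hlm i.rev)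
  simp only [pos, Fin.rev_rev] at h1
  omega

theorem word_injective (h : n + k = N) : Function.Injective (word (n := n) (k := k) h) := by
  intro l m hlm
  refine pos_injective h ?_
  have h1 : Set.range (l.pos h) = Set.range (m.pos h) := by
    ext p
    rw [Set.mem_range, Set.mem_range, ← wordOf_eq_one, ← wordOf_eq_one, ← word_eq, ← word_eq, hlm]
  exact ((l.pos_strictMono h).range_inj (m.pos_strictMono h)).1 h1

theorem sum_word {M : Type*} [AddCommMonoid M] (h : n + k = N) (f : (Fin N → Fin 2) → M)
    (hf : ∀ b, ones b ≠ n → f b = 0) :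
    ∑ l : BoxedPartition n k, f (l.word h) = ∑ b, f b := by
  classical
  rw [← Finset.sum_image (s := Finset.univ) (g := word h) (f := f)
    fun l _ m _ hlm => word_injective h hlm]
  refine Finset.sum_subset (Finset.subset_univ _) fun b _ hb => hf b fun hb' => ?_
  obtain ⟨l, rfl⟩ := exists_word_eq h b hb'
  exact hb (Finset.mem_image_of_mem _ (Finset.mem_univ l))

theorem word_empty (h : n + k = N) : (empty n k).word h = firstWord N n := by
  funext j
  have h1 : (∃ i, (empty n k).pos h i = j) ↔ (j : ℕ) < n := by
    constructor
    · rintro ⟨i, rfl⟩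
      simp [pos, empty]
    · intro hj
      exact ⟨⟨j, hj⟩, Fin.ext (by simp [pos, empty])⟩
  simp only [word, h1, firstWord]

/-- The rows longer than s form an initial segment, so their number decides whether row r is one of
them. -/
theorem card_lt_apply (l : BoxedPartition n k) (r : Fin n) (s : ℕ) :
    (s < (l.1 r : ℕ) → (r : ℕ) < (Finset.univ.filter fun i => s < (l.1 i : ℕ)).card) ∧
      (¬ s < (l.1 r : ℕ) → (Finset.univ.filter fun i => s < (l.1 i : ℕ)).card ≤ r) := by
  constructor
  · intro hr
    have h1 : Finset.Iic r ⊆ Finset.univ.filter fun i => s < (l.1 i : ℕ) := fun i hi => by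
      have h2 : l.1 r ≤ l.1 i := l.2 (Finset.mem_Iic.1 hi)
      rw [Fin.le_def] at h2
      simpa using lt_of_lt_of_le hr h2
    have h2 := Finset.card_le_card h1
    rw [Fin.card_Iic] at h2
    omega
  · intro hr
    have h1 : (Finset.univ.filter fun i => s < (l.1 i : ℕ)) ⊆ Finset.Iio r := fun i hi => by
      rw [Finset.mem_Iio]
      by_contra hir
      have h2 : l.1 i ≤ l.1 r := l.2 (not_lt.1 hir)
      rw [Fin.le_def] at h2
      simp only [Finset.mem_filter, Finset.mem_univ, true_and] at hi
      omega
    have h2 := Finset.card_le_card h1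
    rwa [Fin.card_Iio] at h2

/-- The string of the conjugate partition is the reversed complement. -/
theorem word_conj (h : n + k = N) (h' : k + n = N) (l : BoxedPartition n k) :
    l.conj.word h' = dualWord (l.word h) := by
  -- Both strings have k letters 1, so a pointwise inequality forces equality.
  have hle (p : Fin N) : ((l.conj.word h' p : Fin 2) : ℕ) ≤ (dualWord (l.word h) p : Fin 2) := by
    by_cases hp : ∃ j, l.conj.pos h' j = p
    · obtain ⟨j, hj⟩ := hp
      have h0 : l.word h p.rev = 0 := by
        refine wordOf_eq_zero_iff.2 ?_
        rintro ⟨i, hi⟩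
        have h1 := congrArg Fin.val hj
        have h2 := congrArg Fin.val hi
        have h3 := l.card_lt_apply i.rev j.rev
        simp only [pos, conj, Fin.val_rev] at h1 h2 h3
        have := i.2
        have := j.2
        -- The positions p and `p.rev` add up to N - 1. A letter of λ' and a letter of λ have
        -- positions with sum at least N if the box lies in the diagram, and at most N - 2
        -- otherwise.
        by_cases h4 : k - (j + 1) < (l.1 i.rev : ℕ)
        · have := h3.1 h4
          omega
        · have := h3.2 h4
          omega
      rw [dualWord, h0]
      generalize l.conj.word h' p = a
      fin_cases a <;> simp
    · rw [show l.conj.word h' p = 0 from wordOf_eq_zero_iff.2 hp]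
      simp
  have hsum : ones (dualWord (l.word h)) = k := by
    have h1 := ones_dualWord (l.word h)
    rw [ones_word] at h1
    omega
  have h2 := (Finset.sum_eq_sum_iff_of_le fun p _ => hle p).1
    ((ones_word h' l.conj).trans hsum.symm)
  funext p
  exact Fin.ext (h2 p (Finset.mem_univ p))

theorem conj_conj (l : BoxedPartition n k) : l.conj.conj = l := by
  refine word_injective (rfl : n + k = n + k) ?_
  rw [word_conj (Nat.add_comm k n), word_conj rfl, dualWord_dualWord]

theorem conj_empty (n k : ℕ) : (empty n k).conj = empty k n := by
  refine Subtype.ext (funext fun j => Fin.ext ?_)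
  simp [conj, empty]

/-- Conjugation as a bijection. -/
def conjEquiv (n k : ℕ) : BoxedPartition n k ≃ BoxedPartition k n :=
  ⟨conj, conj, conj_conj, conj_conj⟩

/-- The eigenvector equations require 0 < n < N. Orthogonality concerns two different labels, and
these exist only in that range. -/
theorem exists_between {l m : BoxedPartition n k} (hlm : l ≠ m) : 0 < n ∧ 0 < k := by
  constructor <;> refine Nat.pos_of_ne_zero fun h0 => hlm ?_ <;> subst h0 <;>
    refine Subtype.ext (funext fun i => ?_)
  · exact i.elim0
  · have := (l.1 i).2
    have := (m.1 i).2
    exact Fin.ext (by omega)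

end BoxedPartition

/-! ### Bethe vectors at `q = 0` -/

section Triangularity

variable {A : Type*} [CommRing A] {N n : ℕ}

/-- No permutation sends the r + 1 columns up to r into the r rows below index r, so every term of
the determinant meets the zero block. -/
theorem det_eq_zero_of_block (M : Matrix (Fin n) (Fin n) A) (r : Fin n)
    (hM : ∀ i j, r ≤ i → j ≤ r → M i j = 0) : M.det = 0 := by
  rw [Matrix.det_apply]
  refine Finset.sum_eq_zero fun σ _ => ?_
  obtain ⟨j, hj, hj'⟩ : ∃ j, j ≤ r ∧ r ≤ σ j := by
    by_contra! hcon
    have h1 : (Finset.Iic r).map σ.toEmbedding ⊆ Finset.Iio r := fun i hi => by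
      obtain ⟨j, hj, rfl⟩ := Finset.mem_map.1 hi
      exact Finset.mem_Iio.2 (hcon j (Finset.mem_Iic.1 hj))
    have h2 := Finset.card_le_card h1
    rw [Finset.card_map, Fin.card_Iic, Fin.card_Iio] at h2
    omega
  rw [Finset.prod_eq_zero (f := fun i => M (σ i) i) (Finset.mem_univ j) (hM _ _ hj' hj), smul_zero]

variable {β : A} {t : Fin N → A} {w w' : Fin n → Fin N}

theorem oneParticle_eq_zero {p r : Fin N} (h : p < r) : oneParticle β t p (t r) = 0 := by
  rw [oneParticle, Finset.prod_eq_zero (Finset.mem_Ioi.2 h), mul_zero]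
  simp [fsub]

theorem isUnit_oneParticle (ht : ∀ j, IsUnit (1 + β * t j))
    (ht' : ∀ i j, i ≠ j → IsUnit (t i - t j)) (p : Fin N) : IsUnit (oneParticle β t p (t p)) := by
  rw [oneParticle]
  refine IsUnit.mul (by simp [fsub]) (Finset.prod_induction _ IsUnit (fun _ _ => IsUnit.mul)
    isUnit_one fun l hl => (ht' _ _ ?_).mul (ht l).ringInverse)
  exact (Finset.mem_Ioi.1 hl).ne

/-- If w r < w' r, the entries with j ≤ r ≤ i vanish by `oneParticle_eq_zero`. This is the
triangularity at q = 0. -/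
theorem det_particleMatrix_eq_zero (hw : StrictMono w) (hw' : StrictMono w')
    (h : ¬ w' ≤ w) : (particleMatrix β t w (t ∘ w')).det = 0 := by
  obtain ⟨r, hr⟩ := not_forall.1 h
  refine det_eq_zero_of_block _ r fun i j hi hj => ?_
  rw [particleMatrix, Matrix.of_apply, Function.comp_apply, oneParticle_eq_zero, zero_mul]
  exact (hw.monotone hj).trans_lt ((not_le.1 hr).trans_le (hw'.monotone hi))

theorem isUnit_det_particleMatrix (ht : ∀ j, IsUnit (1 + β * t j))
    (ht' : ∀ i j, i ≠ j → IsUnit (t i - t j)) (hw : StrictMono w) :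
    IsUnit (particleMatrix β t w (t ∘ w)).det := by
  rw [Matrix.det_of_isUpperTriangular]
  · exact Finset.prod_induction _ IsUnit (fun _ _ => IsUnit.mul) isUnit_one fun i _ =>
      (isUnit_oneParticle ht ht' _).mul ((ht _).pow _)
  · intro i j hij
    rw [particleMatrix, Matrix.of_apply, Function.comp_apply,
      oneParticle_eq_zero (show w j < w i from hw hij), zero_mul]

theorem map_particleMatrix {B : Type*} [CommRing B] (f : A →+* B)
    (ht : ∀ j, IsUnit (1 + β * t j)) (y : Fin n → A) :
    f (particleMatrix β t w y).det = (particleMatrix (f β) (f ∘ t) w (f ∘ y)).det := by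
  rw [RingHom.map_det]
  congr 1
  ext i j
  simp [particleMatrix, oneParticle, map_fsub f (ht _)]

/-- Reversing the chain reverses the order of the letters. This symmetry allows them to be listed
increasingly again. -/
theorem betheVector_comp_rev (ht : ∀ j, IsUnit (1 + β * t j)) (y : Fin n → A) :
    betheVector β t (y ∘ Fin.rev) = betheVector β t y := by
  rw [betheVector, betheVector]
  congr 1
  refine List.Perm.prod_eq' ?_ ?_
  · refine (List.reverse_perm _).trans (.trans ?_ (List.reverse_perm _).symm)
    rw [List.ofFn_eq_map, List.ofFn_eq_map]
    have h1 : (List.finRange n).map (fun i => Bop β t ((y ∘ Fin.rev) i)) =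
        ((List.finRange n).map Fin.rev).map fun i => Bop β t (y i) := by
      rw [List.map_map]
      rfl
    rw [h1, ← List.finRange_reverse]
    exact (List.reverse_perm _).map _
  · refine List.pairwise_of_forall_mem_list fun X hX Y hY => ?_
    rw [List.mem_reverse, List.mem_ofFn] at hX hY
    obtain ⟨i, rfl⟩ := hX
    obtain ⟨j, rfl⟩ := hY
    exact commute_Bop β t ht _ _

variable {τ : Fin N → A} {b : A}

open PowerSeries (C constantCoeff)

theorem isUnit_C_one_add (hb : ∀ j, IsUnit (1 + b * τ j)) (j : Fin N) :
    IsUnit (1 + C b * (C ∘ τ) j) := isUnit_one_add_t hb j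

theorem isUnit_diffProd_of_constantCoeff (hτ : ∀ i j, i ≠ j → IsUnit (τ i - τ j))
    {y : Fin n → PowerSeries A} (hw' : Function.Injective w')
    (hy : ∀ i, constantCoeff (y i) = τ (w' i)) : IsUnit (diffProd y) := by
  refine isUnit_diffProd _ fun i j hij => ?_
  rw [PowerSeries.isUnit_iff_constantCoeff, map_sub, hy, hy]
  exact hτ _ _ fun h => hij (hw' h)

theorem constantCoeff_diffProd_mul_betheVector (hb : ∀ j, IsUnit (1 + b * τ j))
    {y : Fin n → PowerSeries A} (hw : StrictMono w)
    (hy : ∀ i, constantCoeff (y i) = τ (w' i)) :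
    constantCoeff (diffProd y * betheVector (C b) (C ∘ τ) y (wordOf w)) =
      (particleMatrix b τ w (τ ∘ w')).det := by
  rw [diffProd_mul_betheVector _ _ (isUnit_C_one_add hb) y w hw,
    map_particleMatrix _ (isUnit_C_one_add hb)]
  have h1 : constantCoeff ∘ C ∘ τ = τ := by funext j; simp
  have h2 : constantCoeff ∘ y = τ ∘ w' := by funext j; simp [hy]
  rw [h1, h2, PowerSeries.constantCoeff_C]

theorem constantCoeff_betheVector_eq_zero (hb : ∀ j, IsUnit (1 + b * τ j))
    (hτ : ∀ i j, i ≠ j → IsUnit (τ i - τ j)) {y : Fin n → PowerSeries A} (hw : StrictMono w)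
    (hw' : StrictMono w') (hy : ∀ i, constantCoeff (y i) = τ (w' i)) (h : ¬ w' ≤ w) :
    constantCoeff (betheVector (C b) (C ∘ τ) y (wordOf w)) = 0 := by
  have h1 := constantCoeff_diffProd_mul_betheVector hb hw hy
  rw [det_particleMatrix_eq_zero hw hw' h, map_mul] at h1
  exact ((isUnit_diffProd_of_constantCoeff hτ hw'.injective hy).map
    constantCoeff).mul_right_eq_zero.1 h1

theorem isUnit_betheVector (hb : ∀ j, IsUnit (1 + b * τ j))
    (hτ : ∀ i j, i ≠ j → IsUnit (τ i - τ j)) {y : Fin n → PowerSeries A} (hw : StrictMono w)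
    (hy : ∀ i, constantCoeff (y i) = τ (w i)) :
    IsUnit (betheVector (C b) (C ∘ τ) y (wordOf w)) := by
  have h1 := constantCoeff_diffProd_mul_betheVector hb hw hy
  have h2 : IsUnit (constantCoeff (diffProd y * betheVector (C b) (C ∘ τ) y (wordOf w))) :=
    h1 ▸ isUnit_det_particleMatrix hb hτ hw
  rw [← PowerSeries.isUnit_iff_constantCoeff] at h2
  exact isUnit_of_mul_isUnit_right h2

theorem strictMono_rev_comp (hw : StrictMono w) : StrictMono (Fin.rev ∘ w ∘ Fin.rev) :=
  fun _ _ hij => Fin.rev_lt_rev.2 (hw (Fin.rev_lt_rev.2 hij))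

theorem wordOf_comp_rev (w : Fin n → Fin N) :
    wordOf w ∘ Fin.rev = wordOf (Fin.rev ∘ w ∘ Fin.rev) := by
  funext p
  have h : (∃ i, w i = p.rev) ↔ ∃ i, (Fin.rev ∘ w ∘ Fin.rev) i = p := by
    rw [Fin.rev_surjective.exists]
    simp [Fin.rev_eq_iff]
  simp only [Function.comp_apply, wordOf] at h ⊢
  simp only [h]

/-- The mirror identity `betheCovector_eq` reverses positions, so the triangularity is opposite to
that of Bethe vectors. -/
theorem constantCoeff_betheCovector_eq_zero (hb : ∀ j, IsUnit (1 + b * τ j))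
    (hτ : ∀ i j, i ≠ j → IsUnit (τ i - τ j)) {y : Fin n → PowerSeries A} (hw : StrictMono w)
    (hw' : StrictMono w') (hy : ∀ i, constantCoeff (y i) = τ (w' i)) (h : ¬ w ≤ w') :
    constantCoeff (betheCovector (C b) (C ∘ τ) y (wordOf w)) = 0 := by
  have hu : IsUnit (∏ i, (1 + C b * y i)) := Finset.prod_induction _ IsUnit
    (fun _ _ => IsUnit.mul) isUnit_one fun i _ => isUnit_one_add_y hb hy i
  have h1 := constantCoeff_betheVector_eq_zero (b := b) (τ := τ ∘ Fin.rev) (fun j => hb _)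
    (fun i j hij => hτ _ _ (Fin.rev_injective.ne hij)) (y := y ∘ Fin.rev)
    (strictMono_rev_comp hw) (strictMono_rev_comp hw') (fun i => by simp [hy]) fun h' => h fun i => by
      simpa using h' i.rev
  rw [betheVector_comp_rev (isUnit_C_one_add (τ := τ ∘ Fin.rev) fun j => hb _),
    ← wordOf_comp_rev] at h1
  have h2 := congrArg constantCoeff (betheCovector_eq (isUnit_C_one_add hb) y (wordOf w))
  rw [map_mul, map_mul] at h2
  refine (hu.map constantCoeff).mul_right_eq_zero.1 (h2.trans ?_)
  exact mul_eq_zero_of_right _ h1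

theorem isUnit_betheCovector (hb : ∀ j, IsUnit (1 + b * τ j))
    (hτ : ∀ i j, i ≠ j → IsUnit (τ i - τ j)) {y : Fin n → PowerSeries A} (hw : StrictMono w)
    (hy : ∀ i, constantCoeff (y i) = τ (w i)) :
    IsUnit (betheCovector (C b) (C ∘ τ) y (wordOf w)) := by
  have h1 := isUnit_betheVector (b := b) (τ := τ ∘ Fin.rev) (fun j => hb _)
    (fun i j hij => hτ _ _ (Fin.rev_injective.ne hij)) (y := y ∘ Fin.rev)
    (strictMono_rev_comp hw) fun i => by simp [hy]
  rw [betheVector_comp_rev (isUnit_C_one_add (τ := τ ∘ Fin.rev) fun j => hb _),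
    ← wordOf_comp_rev] at h1
  have h2 := betheCovector_eq (isUnit_C_one_add hb) y (wordOf w)
  have h3 : IsUnit (wordWeight (C b) (C ∘ τ) (wordOf w)) := by
    rw [wordWeight_wordOf _ _ hw.injective]
    exact Finset.prod_induction _ IsUnit (fun _ _ => IsUnit.mul) isUnit_one fun i _ =>
      isUnit_C_one_add hb _
  exact isUnit_of_mul_isUnit_right (h2 ▸ h3.mul h1)

end Triangularity

/-! ### The normalised Bethe vectors -/

section Idempotents

open PowerSeries (constantCoeff)

variable {N n k : ℕ} (h : n + k = N) (l m : BoxedPartition n k)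

theorem isUnit_of_constantCoeff {A : Type*} [CommRing A] {f : PowerSeries A} {a : A}
    (hf : constantCoeff f = a) (ha : IsUnit a) : IsUnit f :=
  PowerSeries.isUnit_iff_constantCoeff.2 (hf ▸ ha)

theorem isUnit_of_constantCoeff_eq_mul {A : Type*} [CommRing A] {f g g' : PowerSeries A}
    (hf : constantCoeff f = constantCoeff g * constantCoeff g') (hg : IsUnit g)
    (hg' : IsUnit g') : IsUnit f :=
  isUnit_of_constantCoeff hf ((hg.map constantCoeff).mul (hg'.map constantCoeff))

theorem constantCoeff_prod_mul_map {A : Type*} [CommRing A] (f : A →+* A) {b : A} {τ : Fin N → A}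
    (hf : ∀ j, f (1 + b * τ j) * (1 + b * τ j.rev) = 1) {x : PowerSeries A} {c : Fin N → Fin 2}
    (hx : constantCoeff x = wordWeight b τ c) :
    constantCoeff ((∏ j, (1 + PowerSeries.C b * PowerSeries.C (τ j))) * PowerSeries.map f x) =
      wordWeight b τ (dualWord c) := by
  rw [map_mul, ← wordWeight_dualWord f hf, ← hx]
  have h1 : constantCoeff (PowerSeries.map f x) = f (constantCoeff x) := by
    rw [← PowerSeries.coeff_zero_eq_constantCoeff_apply,
      ← PowerSeries.coeff_zero_eq_constantCoeff_apply, PowerSeries.coeff_map]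
  rw [h1]
  simp

theorem isUnit_one_add_q (j : Fin N) : IsUnit (1 + β N * t j) :=
  isUnit_one_add_t (b := beta₀ N) (τ := t₀) isUnit_one_add j

theorem constantCoeff_one_add_betheRoot (i : Fin n) :
    constantCoeff (1 + β N * betheRoot h l i) = 1 + beta₀ N * t₀ (l.pos h i) := by
  simp [β, (betheRoot_spec h l).1 i]

theorem isUnit_one_add_betheRoot (i : Fin n) : IsUnit (1 + β N * betheRoot h l i) :=
  isUnit_of_constantCoeff (A := RT N) (constantCoeff_one_add_betheRoot h l i) (isUnit_one_add _)

theorem isUnit_diffProd_betheRoot : IsUnit (diffProd (betheRoot h l)) :=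
  isUnit_diffProd_of_constantCoeff (τ := t₀) (fun _ _ => isUnit_t₀_sub)
    (l.pos_strictMono h).injective (betheRoot_spec h l).1

/-- The eigenvalue `Π(y_λ) = ∏_i (1 + β y_i)`. -/
def eigenvalue : RTq N := ∏ i, (1 + β N * betheRoot h l i)

theorem constantCoeff_eigenvalue :
    constantCoeff (eigenvalue h l) = wordWeight (beta₀ N) t₀ (l.word h) := by
  rw [BoxedPartition.word_eq, wordWeight_wordOf (A := RT N) _ _ (l.pos_strictMono h).injective, eigenvalue,
    map_prod]
  exact Finset.prod_congr rfl fun i _ => constantCoeff_one_add_betheRoot h l i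

theorem constantCoeff_prod_mul_lr {x : RTq N} {c : Fin N → Fin 2}
    (hx : constantCoeff x = wordWeight (beta₀ N) t₀ c) :
    constantCoeff ((∏ j, (1 + β N * t j)) * lr N x) = wordWeight (beta₀ N) t₀ (dualWord c) := by
  have h1 := constantCoeff_prod_mul_map (A := RT N) (lr₀ N) (b := beta₀ N) (τ := t₀)
    lr₀_one_add (x := x) (c := c) hx
  exact h1

theorem sum_betheCovector_mul_eq_zero [NeZero N] (hn : 0 < n) (hk : 0 < k)
    (U : (Fin N → Fin 2) → RTq N) (hU : ∀ b, ones b ≠ n → U b = 0) (χ : RTq N)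
    (hχ : ∀ b, ones b = n →
      ∑ c, moveCoeff (β N) (q N) b c * (wordWeight (β N) t c * U c) = χ * U b)
    {b : Fin N → Fin 2} (hb : constantCoeff χ = wordWeight (beta₀ N) t₀ b)
    (hbl : b ≠ l.word h) :
    ∑ c, betheCovector (β N) t (betheRoot h l) c * U c = 0 := by
  have h1 := sub_mul_sum_betheCovector_mul isUnit_one_add_q (isUnit_one_add_betheRoot h l)
    (betheRoot_spec h l).2 (isUnit_diffProd_betheRoot h l) hn (by omega) U hU χ hχ
  -- The difference of the eigenvalues need not be a unit, because its constant term is divisible by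
  -- β. It suffices that it is nonzero and that the ring has no zero divisors.
  refine (mul_eq_zero.1 h1).resolve_left fun h2 => hbl (wordWeight_injective ?_)
  have h3 : χ = eigenvalue h l := sub_eq_zero.1 h2
  rw [← hb, h3, constantCoeff_eigenvalue]

theorem betheNorm_eq_sum :
    betheNorm (β N) t (betheRoot h l) (betheRoot h m) =
      ∑ r : BoxedPartition n k, betheCovector (β N) t (betheRoot h l) (r.word h) *
        betheVector (β N) t (betheRoot h m) (r.word h) := by
  rw [BoxedPartition.sum_word h fun b => betheCovector (β N) t (betheRoot h l) b *
    betheVector (β N) t (betheRoot h m) b, betheNorm_eq]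
  intro b hb
  rw [betheVector_eq_zero _ _ isUnit_one_add_q _ _ hb, mul_zero]

theorem betheNorm_eq_zero (hlm : l ≠ m) :
    betheNorm (β N) t (betheRoot h l) (betheRoot h m) = 0 := by
  obtain ⟨hn, hk⟩ := BoxedPartition.exists_between hlm
  have : NeZero N := ⟨by omega⟩
  refine sum_betheCovector_mul_eq_zero h l hn hk _
    (fun b hb => betheVector_eq_zero _ _ isUnit_one_add_q _ _ hb) (eigenvalue h m)
    (fun b hb => ?_) (constantCoeff_eigenvalue h m) fun h1 =>
      hlm (BoxedPartition.word_injective h h1.symm)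
  exact sum_moveCoeff_mul_betheVector isUnit_one_add_q (isUnit_one_add_betheRoot h m)
    (betheRoot_spec h m).2 (isUnit_diffProd_betheRoot h m) hn (by omega) b hb

/-- At q = 0 a string r contributes only if its positions are both ≤ and ≥ those of l. Only r = l
survives, and its two factors are units. -/
theorem isUnit_betheNorm : IsUnit (betheNorm (β N) t (betheRoot h l) (betheRoot h l)) := by
  have h1 := isUnit_betheCovector (A := RT N) (b := beta₀ N) (τ := t₀) (y := betheRoot h l)
    isUnit_one_add (fun _ _ => isUnit_t₀_sub) (l.pos_strictMono h) (betheRoot_spec h l).1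
  have h2 := isUnit_betheVector (A := RT N) (b := beta₀ N) (τ := t₀) (y := betheRoot h l)
    isUnit_one_add (fun _ _ => isUnit_t₀_sub) (l.pos_strictMono h) (betheRoot_spec h l).1
  refine isUnit_of_constantCoeff_eq_mul (A := RT N) ?_ h1 h2
  rw [betheNorm_eq_sum, map_sum, Finset.sum_eq_single_of_mem l (Finset.mem_univ l), map_mul]
  · rfl
  · intro r _ hr
    refine (map_mul constantCoeff _ _).trans ?_
    by_cases h1 : r.pos h ≤ l.pos h
    · have h2 : ¬ l.pos h ≤ r.pos h := fun h2 =>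
        hr (BoxedPartition.pos_injective h (le_antisymm h1 h2))
      exact mul_eq_zero_of_right _ (constantCoeff_betheVector_eq_zero (A := RT N)
        (b := beta₀ N) (τ := t₀) (y := betheRoot h l) isUnit_one_add
        (fun _ _ => isUnit_t₀_sub) (r.pos_strictMono h) (l.pos_strictMono h)
        (betheRoot_spec h l).1 h2)
    · exact mul_eq_zero_of_left (constantCoeff_betheCovector_eq_zero (A := RT N)
        (b := beta₀ N) (τ := t₀) (y := betheRoot h l) isUnit_one_add
        (fun _ _ => isUnit_t₀_sub) (r.pos_strictMono h) (l.pos_strictMono h)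
        (betheRoot_spec h l).1 h1) _

end Idempotents

/-! ### Coordinates in the basis of idempotents, and the unit -/

namespace QH

variable {N n k : ℕ} (h : n + k = N)

/-- The matrix of coordinates with respect to the `Y_λ`: its row `λ` is the dual Bethe vector
`⟨0| C(y₁) ⋯ C(y_n)`. -/
def coordMatrix : Matrix (BoxedPartition n k) (BoxedPartition n k) (RTq N) :=
  Matrix.of fun l m => betheCovector (β N) t (betheRoot h l) (m.word h)

/-- The entries are pairings of dual Bethe vectors with normalised Bethe vectors: orthogonality off
the diagonal, normalisation on it. -/
theorem coordMatrix_mul_transition : coordMatrix h * transition h = 1 := by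
  ext1 l m
  have h1 : (coordMatrix h * transition h) l m =
      Ring.inverse (betheNorm (β N) t (betheRoot h m) (betheRoot h m)) *
        betheNorm (β N) t (betheRoot h l) (betheRoot h m) := by
    rw [betheNorm_eq_sum h l m, Matrix.mul_apply, Finset.mul_sum]
    refine Finset.sum_congr rfl fun r _ => ?_
    change (_ : RTq N) * (Ring.inverse (_ : RTq N) * _) = _
    rw [mul_left_comm]
    rfl
  rw [h1]
  by_cases hlm : l = m
  · subst hlm
    rw [Ring.inverse_mul_cancel _ (isUnit_betheNorm h l), Matrix.one_apply_eq]
  · rw [betheNorm_eq_zero h l m hlm, mul_zero, Matrix.one_apply_ne hlm]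

theorem transition_mul_coordMatrix : transition h * coordMatrix h = 1 :=
  mul_eq_one_comm.1 (coordMatrix_mul_transition h)

theorem transition_inv : (transition h)⁻¹ = coordMatrix h :=
  Matrix.inv_eq_left_inv (coordMatrix_mul_transition h)

/-- The coordinates with respect to the `Y_λ`. -/
def coord (u : QH h) : BoxedPartition n k → RTq N := coordMatrix h *ᵥ coeff h u

theorem coord_mul (u w : QH h) : coord h (u * w) = coord h u * coord h w := by
  change coordMatrix h *ᵥ (transition h *ᵥ (((transition h)⁻¹ *ᵥ coeff h u) *
    ((transition h)⁻¹ *ᵥ coeff h w))) = _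
  rw [Matrix.mulVec_mulVec, coordMatrix_mul_transition, Matrix.one_mulVec, transition_inv]
  rfl

theorem coord_add (u w : QH h) : coord h (u + w) = coord h u + coord h w :=
  Matrix.mulVec_add _ _ _

theorem transition_mulVec_coord (u : QH h) : transition h *ᵥ coord h u = coeff h u := by
  rw [coord, Matrix.mulVec_mulVec, transition_mul_coordMatrix, Matrix.one_mulVec]

theorem coord_injective : Function.Injective (coord h) := by
  intro u w huw
  have h1 := congrArg (transition h *ᵥ ·) huw
  simp only [transition_mulVec_coord] at h1
  exact h1

/-- The coordinates with respect to the `Y_λ`, as a linear equivalence. -/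
def coordEquiv : QH h ≃ₗ[RTq N] (BoxedPartition n k → RTq N) where
  toFun := coord h
  map_add' := coord_add h
  map_smul' f u := Matrix.mulVec_smul _ f (coeff h u)
  invFun a := transition h *ᵥ a
  left_inv := transition_mulVec_coord h
  right_inv a := by
    change coordMatrix h *ᵥ (transition h *ᵥ a) = a
    rw [Matrix.mulVec_mulVec, coordMatrix_mul_transition, Matrix.one_mulVec]

theorem coord_Y (l : BoxedPartition n k) : coord h (Y h l) = Pi.single l 1 := by
  have h1 : coeff h (Y h l) = transition h *ᵥ Pi.single l 1 := by
    rw [Matrix.mulVec_single_one]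
    rfl
  rw [coord, h1, Matrix.mulVec_mulVec, coordMatrix_mul_transition, Matrix.one_mulVec]

/-- The basis of normalised Bethe vectors. -/
def basisY : Module.Basis (BoxedPartition n k) (RTq N) (QH h) := Module.Basis.ofEquivFun (coordEquiv h)

theorem coe_basisY : ⇑(basisY h) = Y h := by
  funext l
  refine (coordEquiv h).injective ?_
  change coordEquiv h ((Module.Basis.ofEquivFun (coordEquiv h)) l) = coord h (Y h l)
  rw [coord_Y, Module.Basis.coe_ofEquivFun, LinearEquiv.apply_symm_apply]

theorem Y_mul_Y (l m : BoxedPartition n k) : Y h l * Y h m = if l = m then Y h m else 0 := by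
  refine (coordEquiv h).injective ?_
  change coord h (Y h l * Y h m) = coordEquiv h (if l = m then Y h m else 0)
  rw [coord_mul, coord_Y, coord_Y]
  by_cases hlm : l = m
  · rw [if_pos hlm, hlm]
    change _ = coord h (Y h m)
    rw [coord_Y, ← Pi.single_mul, mul_one]
  · rw [if_neg hlm, map_zero]
    funext r
    by_cases hr : r = l
    · subst hr; simp [hlm]
    · simp [hr]

theorem coord_v (l m : BoxedPartition n k) :
    coord h (v h l) m = betheCovector (β N) t (betheRoot h m) (l.word h) := by
  change (coordMatrix h *ᵥ Pi.single l 1) m = _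
  rw [Matrix.mulVec_single_one]
  rfl

theorem coord_v_empty : coord h (v h (BoxedPartition.empty n k)) = 1 := by
  funext m
  rw [coord_v, BoxedPartition.word_empty, betheCovector_firstWord _ _ _ (by omega)]
  rfl

theorem v_empty_mul (u : QH h) : v h (BoxedPartition.empty n k) * u = u :=
  coord_injective h (by rw [coord_mul, coord_v_empty, one_mul])

/-! ### Level-rank duality -/

theorem sum_dualWord {M : Type*} [AddCommMonoid M] (f : (Fin N → Fin 2) → M) :
    ∑ c, f (dualWord c) = ∑ c, f c :=
  Equiv.sum_comp (⟨dualWord, dualWord, dualWord_dualWord, dualWord_dualWord⟩ :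
    (Fin N → Fin 2) ≃ (Fin N → Fin 2)) f

/-- The map `f(t, q) v_λ ↦ f(⊖t', q) v_{λ'}`. -/
def dual (h' : k + n = N) : QH h →+ QH h' where
  toFun u := fun m => lr N (u m.conj)
  map_zero' := funext fun _ => map_zero (lr N)
  map_add' _ _ := funext fun _ => map_add (lr N) _ _

variable (h' : k + n = N)

theorem dual_apply (u : QH h) (m : BoxedPartition k n) : dual h h' u m = lr N (u m.conj) := rfl

theorem dual_dual (u : QH h) : dual h' h (dual h h' u) = u := by
  funext m
  rw [dual_apply, dual_apply, lr_lr, BoxedPartition.conj_conj]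

theorem dual_smul (f : RTq N) (u : QH h) : dual h h' (f • u) = lr N f • dual h h' u := by
  funext m
  exact map_mul (lr N) _ _

theorem dual_v (l : BoxedPartition n k) : dual h h' (v h l) = v h' l.conj := by
  funext m
  change lr N ((Pi.single l 1 : BoxedPartition n k → RTq N) m.conj) =
    (Pi.single l.conj 1 : BoxedPartition k n → RTq N) m
  by_cases hm : m = l.conj
  · rw [hm, BoxedPartition.conj_conj]
    simp
  · have h1 : m.conj ≠ l := fun h1 => hm (by rw [← h1, BoxedPartition.conj_conj])
    simp [hm, h1]

/-- The transported Bethe vector is a right eigenvector for the k-letter strings with eigenvalue ∏(1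
+ β t_j) times the substituted old one. At q = 0 this is the weight of the string of l', so only
that dual Bethe vector can pair nontrivially with it. -/
theorem coord_dual_betheVector_eq_zero {l : BoxedPartition n k} {r : BoxedPartition k n}
    (hlr : r ≠ l.conj) :
    ∑ c, betheCovector (β N) t (betheRoot h' r) c *
      lr N (betheVector (β N) t (betheRoot h l) (dualWord c)) = 0 := by
  obtain ⟨hk, hn⟩ := BoxedPartition.exists_between hlr
  have : NeZero N := ⟨by omega⟩
  refine sum_betheCovector_mul_eq_zero h' r hk hn _ (fun b hb => ?_)
    ((∏ j, (1 + β N * t j)) * lr N (eigenvalue h l)) (fun b hb => ?_)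
    (b := dualWord (l.word h)) ?_ fun h1 => ?_
  · rw [betheVector_eq_zero _ _ isUnit_one_add_q, map_zero]
    have := ones_dualWord b
    omega
  · have h1 := congrArg (lr N) (sum_moveCoeff_mul_betheVector isUnit_one_add_q
      (isUnit_one_add_betheRoot h l) (betheRoot_spec h l).2 (isUnit_diffProd_betheRoot h l) hn
      (by omega) (dualWord b) (by have := ones_dualWord b; omega))
    rw [map_mul, ← sum_dualWord, map_sum] at h1
    rw [eigenvalue, mul_assoc, ← h1, Finset.mul_sum]
    refine Finset.sum_congr rfl fun c _ => ?_
    -- The prefactor ∏(1 + β t_j) of the eigenvalue is absorbed here, turning the substituted weight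
    -- of `dualWord c` into the weight of c.
    have h2 := wordWeight_dualWord (lr N) (β := β N) (t := t) lr_one_add (dualWord c)
    rw [dualWord_dualWord] at h2
    rw [moveCoeff_dualWord, map_mul, map_mul, lr_moveCoeff, ← h2]
    ring
  · exact constantCoeff_prod_mul_lr (constantCoeff_eigenvalue h l)
  · rw [← BoxedPartition.word_conj h h'] at h1
    exact hlr (BoxedPartition.word_injective h' h1).symm

theorem coord_dual_Y_eq_zero {l : BoxedPartition n k} {r : BoxedPartition k n}
    (hlr : r ≠ l.conj) : coord h' (dual h h' (Y h l)) r = 0 := by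
  have h1 : coord h' (dual h h' (Y h l)) r =
      lr N (Ring.inverse (betheNorm (β N) t (betheRoot h l) (betheRoot h l))) *
        ∑ m : BoxedPartition k n, betheCovector (β N) t (betheRoot h' r) (m.word h') *
          lr N (betheVector (β N) t (betheRoot h l) (dualWord (m.word h'))) := by
    rw [Finset.mul_sum]
    refine Finset.sum_congr rfl fun m _ => ?_
    change betheCovector (β N) t (betheRoot h' r) (m.word h') * lr N (Ring.inverse _ *
      betheVector (β N) t (betheRoot h l) (m.conj.word h)) = _
    rw [BoxedPartition.word_conj h' h, map_mul, mul_left_comm]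
  rw [h1, BoxedPartition.sum_word h' fun c => betheCovector (β N) t (betheRoot h' r) c *
    lr N (betheVector (β N) t (betheRoot h l) (dualWord c)),
    coord_dual_betheVector_eq_zero h h' hlr, mul_zero]
  intro b hb
  rw [betheCovector_eq_zero isUnit_one_add_q (isUnit_one_add_betheRoot h' r) b hb, zero_mul]

/-- Both sides have all coordinates equal to 1. This fixes the normalisation in `dual_Y`. -/
theorem sum_Y : ∑ l, Y h l = v h (BoxedPartition.empty n k) := by
  refine (coordEquiv h).injective ?_
  rw [map_sum]
  change ∑ l, coord h (Y h l) = coord h _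
  simp only [coord_Y]
  rw [coord_v_empty]
  exact Finset.univ_sum_single 1

theorem dual_Y (l : BoxedPartition n k) : dual h h' (Y h l) = Y h' l.conj := by
  refine coord_injective h' (funext fun r => ?_)
  rw [coord_Y]
  by_cases hr : r = l.conj
  -- Dualising the sum gives `v_∅`, whose coordinate at r is 1. Only the summand with label l
  -- contributes there, so its coordinate is 1.
  · have h1 := congrArg (fun u => coordEquiv h' (dual h h' u) r) (sum_Y h)
    simp only [map_sum, Finset.sum_apply, dual_v, BoxedPartition.conj_empty] at h1
    rw [Finset.sum_eq_single_of_mem l (Finset.mem_univ l) fun m _ hm => by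
      exact coord_dual_Y_eq_zero h h' fun h2 => hm
        ((BoxedPartition.conjEquiv n k).injective (h2.symm.trans hr))] at h1
    rw [hr, Pi.single_eq_same, ← hr]
    exact h1.trans (congrFun (coord_v_empty h') r)
  · rw [coord_dual_Y_eq_zero h h' hr, Pi.single_eq_of_ne hr]

/-- Since idempotents go to idempotents, the duality permutes coordinates by conjugation and applies
the substitution. It is therefore multiplicative. -/
theorem coord_dual (u : QH h) (r : BoxedPartition k n) :
    coord h' (dual h h' u) r = lr N (coord h u r.conj) := by
  have h1 := (basisY h).sum_repr u
  rw [coe_basisY] at h1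
  have h2 (l) : (basisY h).repr u l = coord h u l := rfl
  have h3 := congrArg (fun u => coordEquiv h' (dual h h' u) r) h1
  simp only [map_sum, dual_smul, dual_Y, map_smul, Finset.sum_apply, h2] at h3
  refine h3.symm.trans ?_
  have h4 (l : BoxedPartition n k) : coordEquiv h' (Y h' l.conj) r = if l = r.conj then 1 else 0 := by
    change coord h' (Y h' l.conj) r = _
    rw [coord_Y, Pi.single_apply]
    refine if_congr ⟨?_, ?_⟩ rfl rfl
    · rintro rfl
      exact (BoxedPartition.conj_conj l).symm
    · rintro rfl
      exact (BoxedPartition.conj_conj r).symm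
  simp [h4]

theorem dual_mul (u w : QH h) : dual h h' (u * w) = dual h h' u * dual h h' w := by
  refine coord_injective h' (funext fun r => ?_)
  rw [coord_dual, coord_mul, coord_mul, Pi.mul_apply, Pi.mul_apply, coord_dual, coord_dual, map_mul]

/-- Level-rank duality `f(t, q) v_λ ↦ f(⊖t', q) v_{λ'}` as a ring isomorphism. -/
def dualEquiv : QH h ≃+* QH h' where
  toFun := dual h h'
  invFun := dual h' h
  left_inv := dual_dual h h'
  right_inv := dual_dual h' h
  map_mul' := dual_mul h h'
  map_add' := map_add _

theorem dual_smul_v (f : RTq N) (l : BoxedPartition n k) :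
    dual h h' (f • v h l) = lr N f • v h' l.conj := by
  rw [dual_smul, dual_v]

theorem structureConst_conj (l m m' : BoxedPartition n k) :
    structureConst h m m' l = lr N (structureConst h' m.conj m'.conj l.conj) := by
  have h1 : dual h h' (v h m * v h m') = v h' m.conj * v h' m'.conj := by
    rw [dual_mul, dual_v, dual_v]
  rw [structureConst, structureConst, ← h1]
  change (v h m * v h m') l = lr N (lr N ((v h m * v h m') l.conj.conj))
  rw [lr_lr, BoxedPartition.conj_conj]

end QH

end GrQH

end

theorem mainTheorem10 (N n k : ℕ) (h : n + k = N) :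
    -- the normalised Bethe vectors form a basis and are orthogonal idempotents, so that the product
    -- of `qh_n^*` is well defined, and `v_∅` is its unit
    LinearIndependent (GrQH.RTq N) (GrQH.QH.Y h) ∧
    Submodule.span (GrQH.RTq N) (Set.range (GrQH.QH.Y h)) = ⊤ ∧
    (∀ l m : GrQH.BoxedPartition n k,
      GrQH.QH.Y h l * GrQH.QH.Y h m = if l = m then GrQH.QH.Y h m else 0) ∧
    (∀ u : GrQH.QH h, GrQH.QH.v h (GrQH.BoxedPartition.empty n k) * u = u) ∧
    -- level-rank duality `f(t, q) v_λ ↦ f(⊖t', q) v_{λ'}` is a ring isomorphism over `R⟦q⟧`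
    (∃ Φ : GrQH.QH h ≃+* GrQH.QH ((Nat.add_comm k n).trans h),
      (∀ (f : GrQH.RTq N) (l : GrQH.BoxedPartition n k),
        Φ (f • GrQH.QH.v h l) =
          GrQH.lr N f • GrQH.QH.v ((Nat.add_comm k n).trans h) l.conj) ∧
      (∀ (f : GrQH.RTq N) (l : GrQH.BoxedPartition k n),
        Φ.symm (f • GrQH.QH.v ((Nat.add_comm k n).trans h) l) =
          GrQH.lr N f • GrQH.QH.v h l.conj) ∧
      ∀ (c : PowerSeries GrQH.R) (u : GrQH.QH h),
        Φ (GrQH.constRTq N c • u) = GrQH.constRTq N c • Φ u) ∧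
    -- the corresponding identity of structure constants
    ∀ l m m' : GrQH.BoxedPartition n k,
      GrQH.QH.structureConst h m m' l =
        GrQH.lr N (GrQH.QH.structureConst ((Nat.add_comm k n).trans h) m.conj m'.conj l.conj) := by
  have hl := (GrQH.QH.basisY h).linearIndependent
  have hs := (GrQH.QH.basisY h).span_eq
  rw [GrQH.QH.coe_basisY] at hl hs
  refine ⟨hl, hs, GrQH.QH.Y_mul_Y h, GrQH.QH.v_empty_mul h,
    ⟨GrQH.QH.dualEquiv h _, GrQH.QH.dual_smul_v h _, GrQH.QH.dual_smul_v _ h, fun c u => ?_⟩,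
    GrQH.QH.structureConst_conj h _⟩
  refine (GrQH.QH.dual_smul h _ _ u).trans ?_
  rw [GrQH.lr_constRTq]
  rfl
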